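/- **Setting.** A *polygonal domain* is a nonempty bounded connected open set of $\mathbb R^2$ whose boundary is a finite union of segments; cracks are allowed, and the two lips of a crack count as distinct edges. Let $\Omega$ be a polygonal domain and let $\mathcal T_n$ be a finite decomposition of $\Omega$ into nonoverlapping polygonal domains (elements, possibly cracked along $\partial\Omega$), every edge of an element lying on $\partial\Omega$ or being shared with another element. For an element $K$ let $\mathcal E^K$ be its set of edges, $\mathbf x_K$ its barycenter, $\mathbf n_K$ its outward unit normal; let $h_e$ be the length of an edge $e$ and let $\mathbf n_e=\pm\mathbf n_K{}_{|e}$ be a fixed unit normal of $e$. Fix an integer $p\ge 1$. Let $\mathbf A$ be a vertex (or crack tip) of $\Omega$ with interior angle $\omega\in(0,2\pi]$, and $(r,\theta)$ the polar coordinates at $\mathbf A$, with $\theta\in[0,2\pi)$ (its limit values being taken from the side of the domain) and $\Omega$ occupying the sector $0<\theta<\omega$ near $\mathbf A$. For an integer $j\ge 1$, let $\alpha=j\pi/\omega$ or $\alpha=(j-\frac12)\pi/\omega$, and let $S_{\mathbf A}$ be one of $r^\alpha\sin(\alpha\theta)$, $r^\alpha\cos(\alpha\theta)$ if $\alpha\notin\mathbb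 N$, and one of $r^\alpha(\log r\,\sin(\alpha\theta)+\theta\cos(\alpha\theta))$, $r^\alpha(\log r\,\cos(\alpha\theta)-\theta\sin(\alpha\theta))$ if $\alpha\in\mathbb N$. Put $S^e_{\mathbf A}(r,\theta)=S_{\mathbf A}(r/h_e,\theta)$ and $s_e:=(\mathbf n_e\cdot\nabla S^e_{\mathbf A})_{|e}$, the limit from the element under consideration. Given $\widetilde\gamma>0$, let $\mathcal T^1_n$ be the set of elements $K$ with $\mathrm{dist}(\mathbf A,\mathbf x_K)\le\widetilde\gamma\,\mathrm{diam}(\Omega)$, and $\mathcal E^1_n$ the set of edges contained in $\partial K$ for some $K\in\mathcal T_n^1$. Let $\widetilde{\mathbb P}_{p-1}(e)=\mathbb P_{p-1}(e)+\mathrm{span}\{s_e\}$ if $e\in\mathcal E_n^1$ and $\widetilde{\mathbb P}_{p-1}(e)=\mathbb P_{p-1}(e)$ otherwise. For an element $K$ set $$V_n(K)=\{v\in H^1(K)\mid \Delta v\in\mathbb P_{p-2}(K),\ \mathbf n_e\cdot\nabla v_{|e}\in\widetilde{\mathbb P}_{p-1}(e)\ \ \forall e\in\mathcal E^K\},$$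 where $\mathbb P_{-1}(K)=\{0\}$, $\Delta v$ is the weak Laplacian and the normal derivative is understood in the weak sense, through the Green formula $\int_K\nabla v\cdot\nabla w+\int_K\Delta v\,w=\sum_{e\in\mathcal E^K}\int_e(\mathbf n_K\cdot\nabla v)\,w$ for all $w\in H^1(K)$. Let $\{m_k\}$ be a basis of $\mathbb P_{p-2}(K)$ and, for each $e\in\mathcal E^K$, $\{b^e_l\}_{l=1}^{p}$ a basis of $\mathbb P_{p-1}(e)$. **Lemma 3.1.** For every $K\in\mathcal T_n$, consider on $V_n(K)$ the functionals * $\frac1{|K|}\int_K v\,m_k$ for all $k$; * $\frac1{h_e}\int_e v\,b^e_l$ for all $e\in\mathcal E^K$ and $1\le l\le p$; * $\int_e v\,s_e$ for all $e\in\mathcal E^K\cap\mathcal E^1_n$ (on edges $v$ denotes the trace from $K$). They are well defined and linear, and they form a unisolvent set of degrees of freedom for $V_n(K)$: if all of them vanish at $v\in V_n(K)$, then $v=0$; and, if $s_e\notin\mathbb P_{p-1}(e)$ for all $e\in\mathcal E^K\cap\mathcal E_n^1$ (that is, if the sums defining $\widetilde{\mathbb P}_{p-1}(e)$ are direct), then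 they form a basis of the dual space of $V_n(K)$, so that every tuple of values is attained by exactly one $v\in V_n(K)$. In general the latter holds after removal of the redundant special moments, those of the edges $e\in\mathcal E^K\cap\mathcal E_n^1$ with $s_e\in\mathbb P_{p-1}(e)$. -/

import Mathlib

open MeasureTheory Set Filter Topology
open scoped ContDiff ComplexConjugate RealInnerProductSpace

noncomputable section

namespace EVEM

/-! The plane `ℝ²` is identified with `ℂ`. An edge is an ordered pair `(a, b)` of points; the
domain it belongs to lies on the left of the vector from `a` to `b`. -/

/-- The cross product of `b - a` and `z - a`: positive strictly to the left of the edge. -/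
def cross (e : ℂ × ℂ) (z : ℂ) : ℝ := (conj (e.2 - e.1) * (z - e.1)).im

/-- The length of an edge. -/
def edgeLength (e : ℂ × ℂ) : ℝ := ‖e.2 - e.1‖

/-- The affine parametrization of an edge by `t ∈ [0, 1]`. -/
def edgePoint (e : ℂ × ℂ) (t : ℝ) : ℂ := e.1 + (t : ℂ) * (e.2 - e.1)

/-- The unit normal of an edge pointing to its right, i.e. out of the domain on its left. -/
def outwardNormal (e : ℂ × ℂ) : ℂ := -Complex.I * (e.2 - e.1) / (edgeLength e : ℂ)

/-- The integral over an edge, with respect to arc length, of a function of the parameter. -/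
def edgeIntegral (e : ℂ × ℂ) (f : ℝ → ℝ) : ℝ := edgeLength e * ∫ t in Ioo (0 : ℝ) 1, f t

/-- A bounded polygonal domain, possibly with cracks: a nonempty bounded connected open set whose
boundary is a finite union of segments. The oriented edges list every side of the boundary from
which the domain is reached exactly once; the two lips of a crack are distinct edges with opposite
orientations. Consecutive edges may be collinear, so hanging nodes are allowed. -/
structure PolygonalDomain where
  carrier : Set ℂ
  edges : Finset (ℂ × ℂ)
  isOpen : IsOpen carrier
  isConnected : IsConnected carrier
  isBounded : Bornology.IsBounded carrier
  edge_ne : ∀ e ∈ edges, e.1 ≠ e.2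
  frontier_eq : frontier carrier = ⋃ e ∈ edges, segment ℝ e.1 e.2
  /-- the domain lies, locally, on the left of each edge -/
  left_mem : ∀ e ∈ edges, ∀ x ∈ openSegment ℝ e.1 e.2,
    ∃ ρ > 0, ∀ y ∈ Metric.ball x ρ, 0 < cross e y → y ∈ carrier
  /-- no side is listed twice: overlapping edges have opposite orientations -/
  opposite : ∀ e ∈ edges, ∀ e' ∈ edges, e ≠ e' → ∀ x ∈ openSegment ℝ e.1 e.2,
    x ∈ openSegment ℝ e'.1 e'.2 → ¬ SameRay ℝ (e.2 - e.1) (e'.2 - e'.1)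
  /-- no side is missing: if the domain also lies on the right of an edge at a boundary point that
  is not a node, then the point belongs to an edge with the opposite orientation as well -/
  complete : ∀ e ∈ edges, ∀ x ∈ openSegment ℝ e.1 e.2,
    (∀ e' ∈ edges, x ≠ e'.1 ∧ x ≠ e'.2) →
    (∀ ρ > 0, ∃ y ∈ Metric.ball x ρ, cross e y < 0 ∧ y ∈ carrier) →
    ∃ e' ∈ edges, x ∈ openSegment ℝ e'.1 e'.2 ∧ ¬ SameRay ℝ (e.2 - e.1) (e'.2 - e'.1)

/-- A finite decomposition of a polygonal domain into nonoverlapping polygons (elements). Every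
edge of an element lies on the boundary of the domain or is shared with another element. -/
structure PolygonalMesh (Ω : PolygonalDomain) where
  ι : Type
  [fintype : Fintype ι]
  elem : ι → PolygonalDomain
  subset : ∀ i, (elem i).carrier ⊆ Ω.carrier
  disjoint : ∀ i j, i ≠ j → Disjoint (elem i).carrier (elem j).carrier
  cover : closure Ω.carrier = ⋃ i, closure (elem i).carrier
  conforming : ∀ i, ∀ e ∈ (elem i).edges,
    openSegment ℝ e.1 e.2 ⊆ frontier Ω.carrier ∨ ∃ j, j ≠ i ∧ e.swap ∈ (elem j).edges

/-! ### Singular functions -/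

/-- `Ω` has at its boundary point `A` a corner (or crack tip) with interior angle `β`, occupying
the directions between `φ` and `φ + β`, taken counterclockwise. -/
def HasCorner (Ω : PolygonalDomain) (A : ℂ) (φ β : ℝ) : Prop :=
  0 < β ∧ β ≤ 2 * Real.pi ∧ ∃ ρ > 0, ∀ r : ℝ, 0 < r → r < ρ →
    (A + r * Complex.exp (φ * Complex.I) ∈ frontier Ω.carrier) ∧
    (A + r * Complex.exp ((φ + β) * Complex.I) ∈ frontier Ω.carrier) ∧
    ∀ θ : ℝ, 0 < θ → θ < β → A + r * Complex.exp ((φ + θ) * Complex.I) ∈ Ω.carrier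

/-- The polar angle at `A`, in `[0, 2π)`, measured counterclockwise from the direction `φ`. -/
def polarAngle (A : ℂ) (φ : ℝ) (z : ℂ) : ℝ :=
  toIcoMod Real.two_pi_pos 0 (Complex.arg ((z - A) * Complex.exp (-(φ * Complex.I))))

/-- The singular exponents at a vertex with angle `β`; `mixed` says that the type of the boundary
condition changes at the vertex. -/
def singularExponent (mixed : Bool) (β : ℝ) (j : ℕ) : ℝ :=
  if mixed then ((j : ℝ) - 1 / 2) * (Real.pi / β) else (j : ℝ) * (Real.pi / β)

open Classical in
/-- The singular functions in polar coordinates: the imaginary or the real part of `z ^ α` if `α`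
is not a natural number, and of `z ^ α * log z` if it is. -/
def singularFunction (dirichlet : Bool) (α r θ : ℝ) : ℝ :=
  if ∃ m : ℕ, α = m then
    if dirichlet then r ^ α * (Real.log r * Real.sin (α * θ) + θ * Real.cos (α * θ))
    else r ^ α * (Real.log r * Real.cos (α * θ) - θ * Real.sin (α * θ))
  else
    if dirichlet then r ^ α * Real.sin (α * θ) else r ^ α * Real.cos (α * θ)

/-- The edge-scaled enriching function, as a function on the plane. -/
def edgeScaledSingular (dirichlet : Bool) (α : ℝ) (A : ℂ) (φ : ℝ) (e : ℂ × ℂ) (z : ℂ) : ℝ :=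
  singularFunction dirichlet α (‖z - A‖ / edgeLength e) (polarAngle A φ z)

/-- The derivative of the edge-scaled enriching function in the direction `n`, restricted to the
edge `e`: the limit from the element on the left of `e` (this matters on the lips of a crack). -/
def singularNormalDeriv (dirichlet : Bool) (α : ℝ) (A : ℂ) (φ : ℝ) (n : ℂ) (e : ℂ × ℂ) (t : ℝ) :
    ℝ :=
  limUnder (𝓝[>] (0 : ℝ)) fun ε : ℝ =>
    fderiv ℝ (edgeScaledSingular dirichlet α A φ e) (edgePoint e t - (ε : ℂ) * outwardNormal e) n

/-! ### Layers -/

/-- The barycenter of an element. -/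
def barycenter (K : PolygonalDomain) : ℂ := ⨍ z in K.carrier, z

/-- The first layer of elements. -/
def firstLayer {Ω : PolygonalDomain} (T : PolygonalMesh Ω) (A : ℂ) (γ : ℝ) : Set T.ι :=
  {i | dist A (barycenter (T.elem i)) ≤ γ * Metric.diam Ω.carrier}

/-- The first layer of edges: those contained in the boundary of an element of the first layer. -/
def firstLayerEdges {Ω : PolygonalDomain} (T : PolygonalMesh Ω) (A : ℂ) (γ : ℝ) : Set (ℂ × ℂ) :=
  {e | (∃ i, e ∈ (T.elem i).edges) ∧
    ∃ i ∈ firstLayer T A γ, segment ℝ e.1 e.2 ⊆ frontier (T.elem i).carrier}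

/-! ### Polynomial spaces -/

/-- Polynomials of total degree at most `p - 2` on the plane (the zero space if `p < 2`). -/
def bulkPoly (p : ℕ) : Submodule ℝ (ℂ → ℝ) :=
  Submodule.span ℝ {f | ∃ k l : ℕ, k + l + 2 ≤ p ∧ f = fun z => z.re ^ k * z.im ^ l}

/-- Polynomials of degree at most `p - 1` on an edge, in the affine parameter. -/
def edgePoly (p : ℕ) : Submodule ℝ (ℝ → ℝ) :=
  Submodule.span ℝ {f | ∃ k : ℕ, k < p ∧ f = fun t => t ^ k}

open Classical in
/-- The enriched edge space: polynomials, plus the special function `s e` if `e` belongs to the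
set `E₁`. -/
def enrichedEdgePoly (p : ℕ) (E₁ : Set (ℂ × ℂ)) (s : ℂ × ℂ → ℝ → ℝ) (e : ℂ × ℂ) :
    Submodule ℝ (ℝ → ℝ) :=
  if e ∈ E₁ then edgePoly p ⊔ Submodule.span ℝ {s e} else edgePoly p

/-! ### Sobolev functions, traces, normal derivatives -/

/-- The Lebesgue measure on a polygonal domain. -/
abbrev PolygonalDomain.vol (K : PolygonalDomain) : Measure ℂ := volume.restrict K.carrier

/-- Test functions: smooth with compact support in `U`. -/
def IsTest (U : Set ℂ) (ψ : ℂ → ℝ) : Prop :=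
  ContDiff ℝ ∞ ψ ∧ HasCompactSupport ψ ∧ tsupport ψ ⊆ U

/-- `w ∈ H¹(K)` with weak gradient `G` (the vector `(∂₁w, ∂₂w)` is the complex number
`∂₁w + i ∂₂w`). -/
def HasWeakGrad (K : PolygonalDomain) (w : ℂ → ℝ) (G : ℂ → ℂ) : Prop :=
  MemLp w 2 K.vol ∧ MemLp G 2 K.vol ∧ ∀ ψ, IsTest K.carrier ψ → ∀ u : ℂ,
    ∫ z in K.carrier, w z * fderiv ℝ ψ z u = -∫ z in K.carrier, ⟪G z, u⟫ * ψ z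

/-- `τ` is the trace of `w ∈ H¹(K)` on the edge `e` of `K`, from the left side of `e`: the Green
formula holds against all smooth functions of compact support which, on the closed left half-plane,
are supported in `K` and the relatively open edge. -/
def IsTrace (K : PolygonalDomain) (e : ℂ × ℂ) (w : ℂ → ℝ) (τ : ℝ → ℝ) : Prop :=
  MemLp τ 2 (volume.restrict (Ioo (0 : ℝ) 1)) ∧ ∃ G, HasWeakGrad K w G ∧
    ∀ ψ : ℂ → ℝ, ContDiff ℝ ∞ ψ → HasCompactSupport ψ →
      tsupport ψ ∩ {z | 0 ≤ cross e z} ⊆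
        (K.carrier ∩ {z | 0 < cross e z}) ∪ openSegment ℝ e.1 e.2 →
      ∀ u : ℂ,
        ∫ z in K.carrier ∩ {z | 0 < cross e z}, (w z * fderiv ℝ ψ z u + ⟪G z, u⟫ * ψ z) =
          ⟪outwardNormal e, u⟫ * edgeIntegral e fun t => τ t * ψ (edgePoint e t)

open Classical in
/-- The trace on an edge (almost everywhere unique; zero if there is none). -/
def edgeTrace (K : PolygonalDomain) (e : ℂ × ℂ) (w : ℂ → ℝ) : ℝ → ℝ :=
  if h : ∃ τ, IsTrace K e w τ then h.choose else 0

/-- `v ∈ H¹(K)` has the weak gradient `G`, the weak Laplacian `q ∈ L²(K)`, and, on each edge `e`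
of `K`, the derivative `g e` in the direction of the unit normal `n e` (which is the outward normal
or its opposite). As usual, the normal derivative of a function of `H¹(K)` with Laplacian in `L²(K)`
is the functional on the traces of `H¹(K)` given by the Green formula. -/
structure HasNormalDeriv (K : PolygonalDomain) (n : ℂ × ℂ → ℂ) (v : ℂ → ℝ) (G : ℂ → ℂ) (q : ℂ → ℝ)
    (g : ℂ × ℂ → ℝ → ℝ) : Prop where
  grad : HasWeakGrad K v G
  memLp : MemLp q 2 K.vol
  laplacian : ∀ ψ, IsTest K.carrier ψ →
    ∫ z in K.carrier, fderiv ℝ ψ z (G z) = -∫ z in K.carrier, q z * ψ z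
  normal : ∀ w H, HasWeakGrad K w H → ∀ τ : ℂ × ℂ → ℝ → ℝ,
    (∀ e ∈ K.edges, IsTrace K e w (τ e)) →
    (∀ e ∈ K.edges, IntegrableOn (fun t => g e t * τ e t) (Ioo (0 : ℝ) 1)) ∧
    (∫ z in K.carrier, ⟪G z, H z⟫) + ∫ z in K.carrier, q z * w z =
      ∑ e ∈ K.edges, ⟪outwardNormal e, n e⟫ * edgeIntegral e fun t => g e t * τ e t

theorem HasWeakGrad.congr {K : PolygonalDomain} {w w' : ℂ → ℝ} {G : ℂ → ℂ}
    (h : HasWeakGrad K w G) (hw : w =ᵐ[K.vol] w') : HasWeakGrad K w' G := by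
  obtain ⟨h1, h2, h3⟩ := h
  refine ⟨(memLp_congr_ae hw).1 h1, h2, fun ψ hψ u => ?_⟩
  rw [← h3 ψ hψ u]
  refine integral_congr_ae ?_
  filter_upwards [hw] with z hz
  rw [hz]

theorem HasNormalDeriv.congr {K : PolygonalDomain} {n : ℂ × ℂ → ℂ} {v v' : ℂ → ℝ} {G : ℂ → ℂ}
    {q : ℂ → ℝ} {g : ℂ × ℂ → ℝ → ℝ}
    (h : HasNormalDeriv K n v G q g) (hv : v =ᵐ[K.vol] v') : HasNormalDeriv K n v' G q g :=
  ⟨h.grad.congr hv, h.memLp, h.laplacian, h.normal⟩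

theorem IsTest.integrable_fderiv {K : PolygonalDomain} {ψ : ℂ → ℝ} (hψ : IsTest K.carrier ψ)
    {w : ℂ → ℝ} (hw : MemLp w 2 K.vol) (u : ℂ) :
    Integrable (fun z => w z * fderiv ℝ ψ z u) K.vol := by
  have hc : Continuous fun z => fderiv ℝ ψ z u :=
    (hψ.1.continuous_fderiv (by simp)).clm_apply continuous_const
  have hs : HasCompactSupport fun z => fderiv ℝ ψ z u := hψ.2.1.fderiv_apply ℝ u
  have h2 : MemLp (fun z => fderiv ℝ ψ z u) 2 K.vol :=
    (hc.memLp_of_hasCompactSupport hs).restrict _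
  exact hw.integrable_mul h2

theorem IsTest.memLp {K : PolygonalDomain} {ψ : ℂ → ℝ} (hψ : IsTest K.carrier ψ) :
    MemLp ψ 2 K.vol :=
  (hψ.1.continuous.memLp_of_hasCompactSupport hψ.2.1).restrict _

theorem integrable_inner {K : PolygonalDomain} {G H : ℂ → ℂ} (hG : MemLp G 2 K.vol)
    (hH : MemLp H 2 K.vol) : Integrable (fun z => ⟪G z, H z⟫) K.vol := by
  have h := (hG.re.integrable_mul hH.re).add (hG.im.integrable_mul hH.im)
  refine h.congr (Eventually.of_forall fun z => ?_)
  simp [Complex.inner]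
  ring

theorem IsTest.integrable_inner {K : PolygonalDomain} {ψ : ℂ → ℝ} (hψ : IsTest K.carrier ψ)
    {G : ℂ → ℂ} (hG : MemLp G 2 K.vol) (u : ℂ) :
    Integrable (fun z => ⟪G z, u⟫ * ψ z) K.vol := by
  have h : MemLp (fun z => ⟪G z, u⟫) 2 K.vol := by
    have h := (hG.re.mul_const u.re).add (hG.im.mul_const u.im)
    refine h.congr_norm ?_ (Eventually.of_forall fun z => ?_)
    · exact hG.1.inner_const
    · simp [Complex.inner, mul_comm]
  exact h.integrable_mul hψ.memLp

theorem IsTest.integrable_grad {K : PolygonalDomain} {ψ : ℂ → ℝ} (hψ : IsTest K.carrier ψ)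
    {G : ℂ → ℂ} (hG : MemLp G 2 K.vol) :
    Integrable (fun z => fderiv ℝ ψ z (G z)) K.vol := by
  have h1 : MemLp (fun z => (G z).re) 2 K.vol := hG.re
  have h2 : MemLp (fun z => (G z).im) 2 K.vol := hG.im
  refine ((hψ.integrable_fderiv h1 1).add (hψ.integrable_fderiv h2 Complex.I)).congr
    (Eventually.of_forall fun z => ?_)
  have : G z = (G z).re • (1 : ℂ) + (G z).im • Complex.I := by simp
  change (G z).re * fderiv ℝ ψ z 1 + (G z).im * fderiv ℝ ψ z Complex.I = fderiv ℝ ψ z (G z)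
  conv_rhs => rw [this, map_add, map_smul, map_smul]
  rfl

theorem HasWeakGrad.lin {K : PolygonalDomain} {w₁ w₂ : ℂ → ℝ} {G₁ G₂ : ℂ → ℂ} (c : ℝ)
    (h₁ : HasWeakGrad K w₁ G₁) (h₂ : HasWeakGrad K w₂ G₂) :
    HasWeakGrad K (c • w₁ + w₂) (c • G₁ + G₂) := by
  refine ⟨(h₁.1.const_smul c).add h₂.1, (h₁.2.1.const_smul c).add h₂.2.1, fun ψ hψ u => ?_⟩
  have e1 := h₁.2.2 ψ hψ u
  have e2 := h₂.2.2 ψ hψ u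
  have i1 := hψ.integrable_fderiv h₁.1 u
  have i2 := hψ.integrable_fderiv h₂.1 u
  have j1 := hψ.integrable_inner h₁.2.1 u
  have j2 := hψ.integrable_inner h₂.2.1 u
  simp only [Pi.add_apply, Pi.smul_apply, smul_eq_mul, inner_add_left, real_inner_smul_left,
    add_mul, mul_assoc]
  rw [integral_add (i1.const_mul c) i2, integral_add (j1.const_mul c) j2,
    integral_const_mul, integral_const_mul, e1, e2]
  ring

theorem HasNormalDeriv.lin {K : PolygonalDomain} {n : ℂ × ℂ → ℂ} {v₁ v₂ : ℂ → ℝ} {G₁ G₂ : ℂ → ℂ}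
    {q₁ q₂ : ℂ → ℝ} {g₁ g₂ : ℂ × ℂ → ℝ → ℝ} (c : ℝ)
    (h₁ : HasNormalDeriv K n v₁ G₁ q₁ g₁) (h₂ : HasNormalDeriv K n v₂ G₂ q₂ g₂) :
    HasNormalDeriv K n (c • v₁ + v₂) (c • G₁ + G₂) (c • q₁ + q₂) (c • g₁ + g₂) := by
  refine ⟨h₁.grad.lin c h₂.grad, (h₁.memLp.const_smul c).add h₂.memLp, fun ψ hψ => ?_,
    fun w H hw τ hτ => ?_⟩
  · have e1 := h₁.laplacian ψ hψ
    have e2 := h₂.laplacian ψ hψ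
    have i1 := hψ.integrable_grad h₁.grad.2.1
    have i2 := hψ.integrable_grad h₂.grad.2.1
    have j1 : Integrable (fun z => q₁ z * ψ z) K.vol := h₁.memLp.integrable_mul hψ.memLp
    have j2 : Integrable (fun z => q₂ z * ψ z) K.vol := h₂.memLp.integrable_mul hψ.memLp
    simp only [Pi.add_apply, Pi.smul_apply, smul_eq_mul, map_add, map_smul, add_mul, mul_assoc]
    rw [integral_add (i1.const_mul c) i2, integral_add (j1.const_mul c) j2,
      integral_const_mul, integral_const_mul, e1, e2]
    ring
  · obtain ⟨a1, b1⟩ := h₁.normal w H hw τ hτ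
    obtain ⟨a2, b2⟩ := h₂.normal w H hw τ hτ
    have i1 := integrable_inner h₁.grad.2.1 hw.2.1
    have i2 := integrable_inner h₂.grad.2.1 hw.2.1
    have j1 : Integrable (fun z => q₁ z * w z) K.vol := h₁.memLp.integrable_mul hw.1
    have j2 : Integrable (fun z => q₂ z * w z) K.vol := h₂.memLp.integrable_mul hw.1
    simp only [Pi.add_apply, Pi.smul_apply, smul_eq_mul, inner_add_left, real_inner_smul_left,
      add_mul, mul_assoc]
    refine ⟨fun e he => ((a1 e he).const_mul c).add (a2 e he), ?_⟩
    rw [integral_add (i1.const_mul c) i2, integral_add (j1.const_mul c) j2,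
      integral_const_mul, integral_const_mul]
    have : ∀ e ∈ K.edges,
        ⟪outwardNormal e, n e⟫ * edgeIntegral e (fun t => c * (g₁ e t * τ e t) + g₂ e t * τ e t) =
        c * (⟪outwardNormal e, n e⟫ * edgeIntegral e fun t => g₁ e t * τ e t) +
        ⟪outwardNormal e, n e⟫ * edgeIntegral e fun t => g₂ e t * τ e t := by
      intro e he
      unfold edgeIntegral
      rw [integral_add ((a1 e he).const_mul c) (a2 e he), integral_const_mul]
      ring
    rw [Finset.sum_congr rfl this, Finset.sum_add_distrib, ← Finset.mul_sum, ← b1, ← b2]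
    ring

theorem HasNormalDeriv.zero (K : PolygonalDomain) (n : ℂ × ℂ → ℂ) : HasNormalDeriv K n 0 0 0 0 :=
  ⟨⟨MemLp.zero', MemLp.zero', by simp⟩, MemLp.zero', by simp,
    by simp [edgeIntegral]⟩

/-! ### The local space and its degrees of freedom -/

/-- The local enriched virtual element space `V_n(K)`, for the unit normals `n e`, the polynomial
order `p` and the edge spaces `P e`: the functions of `H¹(K)` (classes modulo equality almost
everywhere) with Laplacian in the polynomials of degree at most `p - 2` and with normal derivative
in `P e` on each edge `e`. -/
def localSpace (K : PolygonalDomain) (n : ℂ × ℂ → ℂ) (p : ℕ) (P : ℂ × ℂ → Submodule ℝ (ℝ → ℝ)) :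
    Submodule ℝ (Lp ℝ 2 K.vol) where
  carrier := {v | ∃ G, ∃ q ∈ bulkPoly p, ∃ g : ℂ × ℂ → ℝ → ℝ, (∀ e ∈ K.edges, g e ∈ P e) ∧
    HasNormalDeriv K n v G q g}
  zero_mem' := ⟨0, 0, zero_mem _, 0, fun _ _ => zero_mem _,
    (HasNormalDeriv.zero K n).congr (Lp.coeFn_zero ℝ 2 K.vol).symm⟩
  add_mem' := by
    rintro v₁ v₂ ⟨G₁, q₁, hq₁, g₁, hg₁, h₁⟩ ⟨G₂, q₂, hq₂, g₂, hg₂, h₂⟩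
    have h := h₁.lin 1 h₂
    simp only [one_smul] at h
    exact ⟨_, _, add_mem hq₁ hq₂, _, fun e he => add_mem (hg₁ e he) (hg₂ e he),
      h.congr (Lp.coeFn_add v₁ v₂).symm⟩
  smul_mem' := by
    rintro c v ⟨G, q, hq, g, hg, h⟩
    have h := h.lin c (HasNormalDeriv.zero K n)
    simp only [add_zero] at h
    exact ⟨_, _, Submodule.smul_mem _ c hq, _, fun e he => Submodule.smul_mem _ c (hg e he),
      h.congr (Lp.coeFn_smul c v).symm⟩

/-- The functionals: internal moments against a family `m`, scaled by the area; edge moments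
against a family `b e` on each edge `e`, scaled by the length; and, for the edges in `E₁`, the
special moment against the function `s e`. -/
def dofs (K : PolygonalDomain) {κ : Type*} (m : κ → ℂ → ℝ) {p : ℕ}
    (b : ℂ × ℂ → Fin p → ℝ → ℝ) (s : ℂ × ℂ → ℝ → ℝ) (E₁ : Set (ℂ × ℂ)) (v : ℂ → ℝ) :
    κ ⊕ ({e // e ∈ K.edges} × Fin p) ⊕ {e // e ∈ K.edges ∧ e ∈ E₁} → ℝ
  | .inl k => (volume.real K.carrier)⁻¹ * ∫ z in K.carrier, v z * m k z
  | .inr (.inl (e, l)) =>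
      (edgeLength e)⁻¹ * edgeIntegral e fun t => edgeTrace K e v t * b e l t
  | .inr (.inr e) => edgeIntegral e fun t => edgeTrace K e v t * s e t

/-- The edges of `E₁` on which the special function is not (almost everywhere) a polynomial of
degree at most `p - 1`, i.e. on which it really enlarges the polynomial space. -/
def directEdges (p : ℕ) (E₁ : Set (ℂ × ℂ)) (s : ℂ × ℂ → ℝ → ℝ) : Set (ℂ × ℂ) :=
  {e ∈ E₁ | ∀ f ∈ edgePoly p, ¬ s e =ᵐ[volume.restrict (Ioo (0 : ℝ) 1)] f}

end EVEM
end

open MeasureTheory Set Filter Topology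
open scoped ContDiff ComplexConjugate RealInnerProductSpace

noncomputable section

namespace EVEM


/-! The functionals and the space are two faces of one variational problem. Write `Λ i` for the
functionals (internal moments, edge moments, special moments on the edges of `directEdges`),
regarded on all of `H¹(K)`. By Green's formula a function `v` lies in the local space exactly when
there are coefficients `μ` with `∫ ∇v·∇w = ∑ μ i Λ i(w)` for every `w ∈ H¹(K)`: the right-hand side
integrates `w` against a polynomial on `K` and against elements of the edge spaces
(`exists_coeff_of_mem_localSpace`, `mem_localSpace_of_coeff`).

Injectivity: if all `Λ i v` vanish, then `w = v` gives `∇v = 0`; so `v` is constant, and it is zero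
because `1` is among the edge polynomials when `p ≥ 1`. Surjectivity: the form `∫ ∇u·∇w + ∑ Λ i(u) Λ
i(w)` is coercive on `H¹(K)`, so Lax–Milgram represents each `Λ i` by some `x i`. The square linear
map `μ ↦ Λ(∑ μ i x i)` is injective when the `Λ i` are linearly independent on `H¹(K)`, hence onto
(`exists_of_coercive`). Where `s e` is almost everywhere a polynomial it is absorbed into the
polynomial part and its moment is dropped.

The analysis has to supply three facts on a domain that may be cracked. (1) The Poincaré inequality
(`PolygonalDomain.poincare`). The lines through the edges cut `K` into finitely many convex cells,
on which the inequality follows by integrating along segments; the cells are glued through balls,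
using connectedness. (2) Continuity of the special moments. Since `α ≥ 1/4`, the function `s e` may
blow up almost like `r ^ (-3/4)`, so it need not be square integrable on the edge. But traces of
`H¹` functions satisfy `∫ |τ|² |t - a| ^ (-7/10) ≤ C ‖w‖²` (`exists_weighted`, by dyadic iteration
towards `a`), and `s e` is square integrable for the dual weight
(`isEdgeWeight_singularNormalDeriv`). (3) Independence of the functionals (`ae_eq_zero_of_forall`).
A smooth function supported in an edge away from the nodes is the trace of an `H¹(K)` function with
zero trace on all other edges, the opposite lip of a crack included (`exists_hasWeakGrad_trace`). -/

/-! ### Weak gradients on open sets -/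

/-- `w` and `G` are square integrable on the plane, and `G` is the weak gradient of `w` on `U`. -/
structure IsSobolev (U : Set ℂ) (w : ℂ → ℝ) (G : ℂ → ℂ) : Prop where
  meas : Measurable w
  measG : Measurable G
  memLp : MemLp w 2 volume
  memLpG : MemLp G 2 volume
  weak : ∀ ψ, IsTest U ψ → ∀ u : ℂ,
    ∫ z, w z * fderiv ℝ ψ z u = -∫ z, ⟪G z, u⟫ * ψ z

/-- The shear makes `(s, x) ↦ G (x + s • h)` jointly square integrable, so Fubini applies to the
integrals of a merely square integrable `G` along the translates of a segment. -/
theorem measurePreserving_shear {E : Type*} [NormedAddCommGroup E] [NormedSpace ℝ E]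
    [MeasurableSpace E] [BorelSpace E] [SecondCountableTopology E]
    (μ : Measure ℝ) [SFinite μ] (ν : Measure E) [SFinite ν] [ν.IsAddRightInvariant] (h : E) :
    MeasurePreserving (fun p : ℝ × E => (p.1, p.2 + p.1 • h)) (μ.prod ν) (μ.prod ν) := by
  refine (MeasurePreserving.id μ).skew_product (g := fun s x => x + s • h) ?_ ?_
  · fun_prop
  · exact Eventually.of_forall fun s => map_add_right_eq_self ν (s • h)

theorem memLp_shear {F : Type*} [NormedAddCommGroup F] {G : ℂ → F} (hG : MemLp G 2 volume)
    (h : ℂ) :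
    MemLp (fun p : ℝ × ℂ => G (p.2 + p.1 • h)) 2
      ((volume.restrict (Ioc (0 : ℝ) 1)).prod volume) :=
  (hG.comp_snd (volume.restrict (Ioc (0 : ℝ) 1))).comp_measurePreserving
    (measurePreserving_shear (volume.restrict (Ioc (0 : ℝ) 1)) volume h)

theorem memLp_inner_const {μ : Measure ℂ} {G : ℂ → ℂ} (hG : MemLp G 2 μ) (u : ℂ) :
    MemLp (fun z => ⟪G z, u⟫) 2 μ := by
  have h := (hG.re.mul_const u.re).add (hG.im.mul_const u.im)
  refine h.congr_norm ?_ (Eventually.of_forall fun z => ?_)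
  · exact hG.1.inner_const
  · simp [Complex.inner, mul_comm]

theorem IsTest.translate {U W : Set ℂ} {ψ : ℂ → ℝ} (hψ : IsTest W ψ) (a : ℂ)
    (ha : ∀ x ∈ W, x + a ∈ U) : IsTest U fun x => ψ (x - a) := by
  obtain ⟨h1, h2, h3⟩ := hψ
  have hcomp : (fun x => ψ (x - a)) = ψ ∘ (Homeomorph.subRight a) := rfl
  refine ⟨h1.comp (contDiff_id.sub contDiff_const), ?_, ?_⟩
  · rw [hcomp]; exact h2.comp_homeomorph _
  · rw [hcomp, tsupport_comp_eq_preimage]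
    intro x hx
    simpa using ha _ (h3 hx)

theorem IsTest.memLp_volume {W : Set ℂ} {ψ : ℂ → ℝ} (hψ : IsTest W ψ) : MemLp ψ 2 volume :=
  hψ.1.continuous.memLp_of_hasCompactSupport hψ.2.1

theorem IsTest.memLp_fderiv {W : Set ℂ} {ψ : ℂ → ℝ} (hψ : IsTest W ψ) (u : ℂ) :
    MemLp (fun z => fderiv ℝ ψ z u) 2 volume :=
  ((hψ.1.continuous_fderiv (by simp)).clm_apply continuous_const).memLp_of_hasCompactSupport
    (hψ.2.1.fderiv_apply ℝ u)

theorem intervalIntegral_fderiv_segment {ψ : ℂ → ℝ} (hψ : ContDiff ℝ ∞ ψ) (x h : ℂ) :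
    ∫ s in (0 : ℝ)..1, fderiv ℝ ψ (x + s • h) h = ψ (x + h) - ψ x := by
  have hd : ∀ s : ℝ, HasDerivAt (fun s : ℝ => ψ (x + s • h)) (fderiv ℝ ψ (x + s • h) h) s := by
    intro s
    have h1 : HasDerivAt (fun s : ℝ => x + s • h) h s := by
      simpa using ((hasDerivAt_id s).smul_const h).const_add x
    exact ((hψ.differentiable (by simp)).differentiableAt.hasFDerivAt).comp_hasDerivAt s h1
  rw [intervalIntegral.integral_eq_sub_of_hasDerivAt (fun s _ => hd s)]
  · simp
  · apply Continuous.intervalIntegrable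
    exact ((hψ.continuous_fderiv (by simp)).comp (by fun_prop)).clm_apply continuous_const

/-- A function with a weak gradient is, along almost every translate of a fixed segment, the
integral of its gradient. -/
theorem IsSobolev.ae_segment {U W : Set ℂ} {w : ℂ → ℝ} {G : ℂ → ℂ} (hw : IsSobolev U w G)
    (hW : IsOpen W) (h : ℂ) (hseg : ∀ x ∈ W, ∀ s ∈ Icc (0 : ℝ) 1, x + s • h ∈ U) :
    ∀ᵐ x ∂volume, x ∈ W → w (x + h) - w x = ∫ s in (0 : ℝ)..1, ⟪G (x + s • h), h⟫ := by
  set μ : Measure ℝ := volume.restrict (Ioc (0 : ℝ) 1) with hμ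
  have hF : MemLp (fun p : ℝ × ℂ => ⟪G (p.2 + p.1 • h), h⟫) 2 (μ.prod volume) :=
    memLp_shear (memLp_inner_const hw.memLpG h) h
  have hwh : MemLp (fun x => w (x + h)) 2 volume :=
    hw.memLp.comp_measurePreserving (measurePreserving_add_right volume h)
  have hi1 : LocallyIntegrable w volume := hw.memLp.locallyIntegrable (by norm_num)
  have hi2 : LocallyIntegrable (fun x => w (x + h)) volume :=
    hwh.locallyIntegrable (by norm_num)
  have hi3 : LocallyIntegrable (fun x => ∫ s in (0 : ℝ)..1, ⟪G (x + s • h), h⟫) volume := by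
    rw [locallyIntegrable_iff]
    intro k hk
    have : IsFiniteMeasure (volume.restrict k) := ⟨by simpa using hk.measure_lt_top⟩
    have h1 : MemLp (fun p : ℝ × ℂ => ⟪G (p.2 + p.1 • h), h⟫) 2
        (μ.prod (volume.restrict k)) := by
      have := hF.restrict (univ ×ˢ k)
      rwa [← Measure.prod_restrict, Measure.restrict_univ] at this
    have h2 := (h1.integrable (by norm_num)).integral_prod_right
    simp only [intervalIntegral.integral_of_le zero_le_one]
    exact h2
  -- It suffices to test against `ψ` supported in `W`. After Fubini, for each `s` the translate of
  -- `ψ` by `s • h` is a test function on `U`, so the weak gradient can be traded for a derivative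
  -- of `ψ`; integrating over `s` produces `ψ (x - h) - ψ x`.
  have key : ∀ᵐ x ∂volume, x ∈ W →
      w (x + h) - w x - ∫ s in (0 : ℝ)..1, ⟪G (x + s • h), h⟫ = 0 := by
    refine hW.ae_eq_zero_of_integral_contDiff_smul_eq_zero
      (((hi2.sub hi1).sub hi3).locallyIntegrableOn W) ?_
    intro ψ hψ1 hψ2 hψ3
    have hψ : IsTest W ψ := ⟨hψ1, hψ2, hψ3⟩
    have hψL := hψ.memLp_volume
    have j1 : Integrable (fun x => ψ x * w (x + h)) volume := hψL.integrable_mul hwh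
    have j2 : Integrable (fun x => ψ x * w x) volume := hψL.integrable_mul hw.memLp
    have P1 : Integrable (fun p : ℝ × ℂ => ψ p.2 * ⟪G (p.2 + p.1 • h), h⟫) (μ.prod volume) :=
      (hψL.comp_snd μ).integrable_mul hF
    have P2 : Integrable (fun p : ℝ × ℂ => w p.2 * fderiv ℝ ψ (p.2 + p.1 • (-h)) (-h))
        (μ.prod volume) :=
      (hw.memLp.comp_snd μ).integrable_mul (memLp_shear (hψ.memLp_fderiv (-h)) (-h))
    have e1 : ∀ x, ψ x * ∫ s in (0 : ℝ)..1, ⟪G (x + s • h), h⟫ =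
        ∫ s, ψ x * ⟪G (x + s • h), h⟫ ∂μ := by
      intro x
      rw [intervalIntegral.integral_of_le zero_le_one, integral_const_mul]
    have j3 : Integrable (fun x => ψ x * ∫ s in (0 : ℝ)..1, ⟪G (x + s • h), h⟫) volume := by
      simp only [e1]
      exact P1.integral_prod_right
    have e2 : ∫ x, ψ x * ∫ s in (0 : ℝ)..1, ⟪G (x + s • h), h⟫ =
        ∫ s, (∫ x, ψ x * ⟪G (x + s • h), h⟫) ∂μ := by
      simp only [e1]
      exact (integral_integral_swap (f := fun s x => ψ x * ⟪G (x + s • h), h⟫) P1).symm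
    have e3 : ∀ᵐ s ∂μ, (∫ x, ψ x * ⟪G (x + s • h), h⟫) =
        ∫ x, w x * fderiv ℝ ψ (x + s • (-h)) (-h) := by
      rw [hμ]
      filter_upwards [ae_restrict_mem measurableSet_Ioc] with s hs
      have ht : IsTest U fun x => ψ (x - s • h) :=
        hψ.translate _ fun x hx => hseg x hx s ⟨hs.1.le, hs.2⟩
      have h1 := hw.weak _ ht h
      have h2 : ∀ x, fderiv ℝ (fun x => ψ (x - s • h)) x h = fderiv ℝ ψ (x - s • h) h := by
        intro x; rw [fderiv_comp_sub]
      simp only [h2] at h1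
      have h3 : (∫ x, ψ x * ⟪G (x + s • h), h⟫) = ∫ x, ψ (x - s • h) * ⟪G x, h⟫ := by
        rw [← integral_sub_right_eq_self _ (s • h)]
        simp
      rw [h3]
      simp only [map_neg, mul_neg, integral_neg, smul_neg, ← sub_eq_add_neg]
      rw [h1, neg_neg]
      simp only [mul_comm]
    have e4 : ∫ s, (∫ x, w x * fderiv ℝ ψ (x + s • (-h)) (-h)) ∂μ =
        ∫ x, w x * (ψ (x - h) - ψ x) := by
      rw [integral_integral_swap (f := fun s x => w x * fderiv ℝ ψ (x + s • (-h)) (-h)) P2]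
      refine integral_congr_ae (Eventually.of_forall fun x => ?_)
      have := intervalIntegral_fderiv_segment hψ1 x (-h)
      rw [intervalIntegral.integral_of_le zero_le_one] at this
      simp only
      rw [integral_const_mul, this, sub_eq_add_neg x h]
    have e5 : ∫ x, ψ x * w (x + h) = ∫ x, ψ (x - h) * w x := by
      rw [← integral_sub_right_eq_self _ h]
      simp
    have j4 : Integrable (fun x => ψ (x - h) * w x) volume :=
      (hψL.comp_measurePreserving (measurePreserving_sub_right volume h)).integrable_mul hw.memLp
    simp only [smul_eq_mul, mul_sub]
    have e6 : ∫ x, w x * (ψ (x - h) - ψ x) = (∫ x, ψ (x - h) * w x) - ∫ x, ψ x * w x := by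
      rw [← integral_sub j4 j2]
      exact integral_congr_ae (Eventually.of_forall fun x => by simp only; ring)
    have e7 := integral_sub (j1.sub j2) j3
    simp only [Pi.sub_apply] at e7
    rw [e7, integral_sub j1 j2, e2, integral_congr_ae e3, e4, e5, e6, sub_self]
  filter_upwards [key] with x hx hxW
  linarith [hx hxW]

theorem setIntegral_eq_of_ae_indicator {K : PolygonalDomain} {f g : ℂ → ℝ}
    (h1 : f =ᵐ[K.vol] g) (h2 : ∀ z ∉ K.carrier, g z = 0) :
    ∫ z in K.carrier, f z = ∫ z, g z := by
  rw [integral_congr_ae h1]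
  exact setIntegral_eq_integral_of_forall_compl_eq_zero h2

/-- The functions of `H¹(K)` have measurable representatives, extended by zero. -/
theorem HasWeakGrad.exists_isSobolev {K : PolygonalDomain} {w : ℂ → ℝ} {G : ℂ → ℂ}
    (h : HasWeakGrad K w G) :
    ∃ w' G', IsSobolev K.carrier w' G' ∧ w =ᵐ[K.vol] w' ∧ G =ᵐ[K.vol] G' ∧
      (∀ z ∉ K.carrier, w' z = 0) ∧ ∀ z ∉ K.carrier, G' z = 0 := by
  obtain ⟨h1, h2, h3⟩ := h
  have hm := K.isOpen.measurableSet
  set w' := K.carrier.indicator (h1.1.mk w)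
  set G' := K.carrier.indicator (h2.1.mk G)
  have ew : w =ᵐ[K.vol] w' := h1.1.ae_eq_mk.trans (indicator_ae_eq_restrict hm).symm
  have eG : G =ᵐ[K.vol] G' := h2.1.ae_eq_mk.trans (indicator_ae_eq_restrict hm).symm
  have zw : ∀ z ∉ K.carrier, w' z = 0 := fun z hz => indicator_of_notMem hz _
  have zG : ∀ z ∉ K.carrier, G' z = 0 := fun z hz => indicator_of_notMem hz _
  refine ⟨w', G', ⟨?_, ?_, ?_, ?_, ?_⟩, ew, eG, zw, zG⟩
  · exact h1.1.stronglyMeasurable_mk.measurable.indicator hm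
  · exact h2.1.stronglyMeasurable_mk.measurable.indicator hm
  · rw [memLp_indicator_iff_restrict hm]
    exact (memLp_congr_ae h1.1.ae_eq_mk).1 h1
  · rw [memLp_indicator_iff_restrict hm]
    exact (memLp_congr_ae h2.1.ae_eq_mk).1 h2
  · intro ψ hψ u
    have := h3 ψ hψ u
    rw [setIntegral_eq_of_ae_indicator (g := fun z => w' z * fderiv ℝ ψ z u),
      setIntegral_eq_of_ae_indicator (g := fun z => ⟪G' z, u⟫ * ψ z)] at this
    · exact this
    · filter_upwards [eG] with z hz; rw [hz]
    · intro z hz; rw [zG z hz]; simp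
    · filter_upwards [ew] with z hz; rw [hz]
    · intro z hz; rw [zw z hz]; simp

/-- The weak gradient is unique. -/
theorem HasWeakGrad.ae_unique {K : PolygonalDomain} {w : ℂ → ℝ} {G H : ℂ → ℂ}
    (h : HasWeakGrad K w G) (h' : HasWeakGrad K w H) : G =ᵐ[K.vol] H := by
  have key : ∀ u : ℂ, ∀ᵐ z ∂K.vol, ⟪G z, u⟫ - ⟪H z, u⟫ = 0 := by
    intro u
    have i1 : LocallyIntegrableOn (fun z => ⟪G z, u⟫) K.carrier volume :=
      locallyIntegrableOn_of_locallyIntegrable_restrict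
        ((memLp_inner_const h.2.1 u).locallyIntegrable (by norm_num))
    have i2 : LocallyIntegrableOn (fun z => ⟪H z, u⟫) K.carrier volume :=
      locallyIntegrableOn_of_locallyIntegrable_restrict
        ((memLp_inner_const h'.2.1 u).locallyIntegrable (by norm_num))
    have := K.isOpen.ae_eq_zero_of_integral_contDiff_smul_eq_zero (i1.sub i2) ?_
    · rw [ae_restrict_iff' K.isOpen.measurableSet]
      filter_upwards [this] with z hz hz'
      exact hz hz'
    · intro ψ hψ1 hψ2 hψ3
      have hψ : IsTest K.carrier ψ := ⟨hψ1, hψ2, hψ3⟩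
      have e1 := h.2.2 ψ hψ u
      have e2 := h'.2.2 ψ hψ u
      have k1 := hψ.integrable_inner h.2.1 u
      have k2 := hψ.integrable_inner h'.2.1 u
      rw [← setIntegral_eq_integral_of_forall_compl_eq_zero (s := K.carrier)]
      · have : ∀ z, ψ z • ((fun z => ⟪G z, u⟫) - fun z => ⟪H z, u⟫) z =
            ⟪G z, u⟫ * ψ z - ⟪H z, u⟫ * ψ z := by
          intro z; simp only [Pi.sub_apply, smul_eq_mul]; ring
        simp only [this]
        rw [integral_sub k1 k2]
        linarith
      · intro z hz
        have : ψ z = 0 := by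
          by_contra hne
          exact hz (hψ3 (subset_tsupport _ hne))
        simp [this]
  filter_upwards [key 1, key Complex.I] with z h1 h2
  apply Complex.ext
  · simpa [Complex.inner, sub_eq_zero] using h1
  · simpa [Complex.inner, sub_eq_zero] using h2

/-! ### The Poincaré inequality -/

theorem enorm_add_sq_le {E : Type*} [SeminormedAddCommGroup E] (a b : E) :
    ‖a + b‖ₑ ^ 2 ≤ 2 * ‖a‖ₑ ^ 2 + 2 * ‖b‖ₑ ^ 2 := by
  have h : ‖a + b‖ ^ 2 ≤ 2 * ‖a‖ ^ 2 + 2 * ‖b‖ ^ 2 := by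
    have := norm_add_le a b
    nlinarith [sq_nonneg (‖a‖ - ‖b‖), norm_nonneg (a + b), norm_nonneg a, norm_nonneg b]
  have e : ∀ x : E, ‖x‖ₑ ^ 2 = ENNReal.ofReal (‖x‖ ^ 2) := fun x => by
    rw [← ofReal_norm, ENNReal.ofReal_pow (norm_nonneg _)]
  have e2 : (2 : ENNReal) = ENNReal.ofReal 2 := by simp
  rw [e, e, e, e2, ← ENNReal.ofReal_mul (by norm_num), ← ENNReal.ofReal_mul (by norm_num),
    ← ENNReal.ofReal_add (by positivity) (by positivity)]
  exact ENNReal.ofReal_le_ofReal h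

/-- Cauchy–Schwarz against the constant function. -/
theorem sq_lintegral_le {α : Type*} [MeasurableSpace α] (μ : Measure α) {f : α → ENNReal}
    (hf : AEMeasurable f μ) : (∫⁻ a, f a ∂μ) ^ 2 ≤ μ univ * ∫⁻ a, f a ^ 2 ∂μ := by
  have h := ENNReal.lintegral_mul_le_Lp_mul_Lq μ Real.HolderConjugate.two_two
    (aemeasurable_const (b := (1 : ENNReal))) hf
  simp only [Pi.mul_apply, one_mul, ENNReal.one_rpow, lintegral_one] at h
  calc (∫⁻ a, f a ∂μ) ^ 2
      ≤ (μ univ ^ (1 / (2 : ℝ)) * (∫⁻ a, f a ^ (2 : ℝ) ∂μ) ^ (1 / (2 : ℝ))) ^ 2 := by gcongr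
    _ = μ univ * ∫⁻ a, f a ^ 2 ∂μ := by
      rw [mul_pow, ← ENNReal.rpow_natCast, ← ENNReal.rpow_natCast, ← ENNReal.rpow_mul,
        ← ENNReal.rpow_mul]
      simp

theorem enorm_sq_intervalIntegral_le {f : ℝ → ℝ} {a b : ℝ} (hab : a ≤ b)
    (hf : AEMeasurable f (volume.restrict (Ioc a b))) :
    ‖∫ s in a..b, f s‖ₑ ^ 2 ≤ ENNReal.ofReal (b - a) * ∫⁻ s in Ioc a b, ‖f s‖ₑ ^ 2 := by
  rw [intervalIntegral.integral_of_le hab]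
  calc ‖∫ s in Ioc a b, f s‖ₑ ^ 2 ≤ (∫⁻ s in Ioc a b, ‖f s‖ₑ) ^ 2 := by
        gcongr; exact enorm_integral_le_lintegral_enorm _
    _ ≤ _ := by
        refine (sq_lintegral_le _ hf.enorm).trans ?_
        simp

/-- Cauchy–Schwarz along the segment from `x` to `x + h`, then Fubini: for each `s`, translation
invariance of Lebesgue measure turns the inner integral into the full integral of `‖G‖²`. -/
theorem IsSobolev.lintegral_translate_le {U W : Set ℂ} {w : ℂ → ℝ} {G : ℂ → ℂ}
    (hw : IsSobolev U w G) (hW : IsOpen W) (h : ℂ)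
    (hseg : ∀ x ∈ W, ∀ s ∈ Icc (0 : ℝ) 1, x + s • h ∈ U) :
    ∫⁻ x in W, ‖w (x + h) - w x‖ₑ ^ 2 ≤ ‖h‖ₑ ^ 2 * ∫⁻ z, ‖G z‖ₑ ^ 2 := by
  have hG := hw.measG
  have hm : Measurable fun p : ℝ × ℂ => ‖G (p.2 + p.1 • h)‖ₑ ^ 2 := by
    refine (hG.comp ?_).enorm.pow_const 2
    fun_prop
  calc ∫⁻ x in W, ‖w (x + h) - w x‖ₑ ^ 2
      ≤ ∫⁻ x in W, ‖h‖ₑ ^ 2 * ∫⁻ s in Ioc (0 : ℝ) 1, ‖G (x + s • h)‖ₑ ^ 2 := by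
        refine lintegral_mono_ae ?_
        rw [ae_restrict_iff' hW.measurableSet]
        filter_upwards [hw.ae_segment hW h hseg] with x hx hxW
        rw [hx hxW]
        have hgm : Measurable fun s : ℝ => G (x + s • h) := hG.comp (by fun_prop)
        refine (enorm_sq_intervalIntegral_le zero_le_one
          (hgm.inner_const (c := h)).aemeasurable).trans ?_
        simp only [sub_zero, ENNReal.ofReal_one, one_mul]
        rw [← lintegral_const_mul _ (hgm.enorm.pow_const 2)]
        refine lintegral_mono fun s => ?_
        rw [← mul_pow]
        gcongr
        rw [mul_comm, ← ofReal_norm, ← ofReal_norm, ← ofReal_norm,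
          ← ENNReal.ofReal_mul (norm_nonneg _)]
        exact ENNReal.ofReal_le_ofReal (norm_inner_le_norm _ _)
    _ = ‖h‖ₑ ^ 2 * ∫⁻ x in W, ∫⁻ s in Ioc (0 : ℝ) 1, ‖G (x + s • h)‖ₑ ^ 2 := by
        refine lintegral_const_mul _ ?_
        exact hm.lintegral_prod_left'
    _ ≤ ‖h‖ₑ ^ 2 * ∫⁻ x, ∫⁻ s in Ioc (0 : ℝ) 1, ‖G (x + s • h)‖ₑ ^ 2 := by
        gcongr; exact Measure.restrict_le_self
    _ = ‖h‖ₑ ^ 2 * ∫⁻ s in Ioc (0 : ℝ) 1, ∫⁻ x, ‖G (x + s • h)‖ₑ ^ 2 := by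
        rw [lintegral_lintegral_swap]
        exact (hm.comp measurable_swap).aemeasurable
    _ = ‖h‖ₑ ^ 2 * ∫⁻ z, ‖G z‖ₑ ^ 2 := by
        congr 1
        have : ∀ s : ℝ, ∫⁻ x, ‖G (x + s • h)‖ₑ ^ 2 = ∫⁻ z, ‖G z‖ₑ ^ 2 := fun s =>
          lintegral_add_right_eq_self (fun z => ‖G z‖ₑ ^ 2) _
        simp only [this, lintegral_const, Measure.restrict_apply MeasurableSet.univ, univ_inter,
          Real.volume_Ioc, sub_zero, ENNReal.ofReal_one, mul_one]

/-- With `y = x + h` and the order of integration exchanged, the translation estimate applies for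
each fixed `h`: by convexity the segment from `x` to `x + h` stays in `C`. Only `h` in the ball of
radius `D` contributes. -/
theorem IsSobolev.lintegral_sub_convex_le {U C : Set ℂ} {w : ℂ → ℝ} {G : ℂ → ℂ}
    (hw : IsSobolev U w G) (hC : IsOpen C) (hconv : Convex ℝ C) (hCU : C ⊆ U) {D : ℝ}
    (hD : ∀ x ∈ C, ∀ y ∈ C, ‖y - x‖ ≤ D) :
    ∫⁻ x in C, ∫⁻ y in C, ‖w y - w x‖ₑ ^ 2 ≤
      (ENNReal.ofReal D ^ 2 * volume (Metric.closedBall (0 : ℂ) D)) * ∫⁻ z, ‖G z‖ₑ ^ 2 := by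
  have hCm := hC.measurableSet
  have hwm := hw.meas
  set I : ℂ → ENNReal := C.indicator 1 with hI
  have hIm : Measurable I := measurable_const.indicator hCm
  have hind : ∀ f : ℂ → ENNReal, ∫⁻ x in C, f x = ∫⁻ x, I x * f x := by
    intro f
    rw [← lintegral_indicator hCm]
    congr 1; ext x
    by_cases hx : x ∈ C <;> simp [I, hx]
  have e1 : ∫⁻ x in C, ∫⁻ y in C, ‖w y - w x‖ₑ ^ 2 =
      ∫⁻ x, ∫⁻ h, I x * I (x + h) * ‖w (x + h) - w x‖ₑ ^ 2 := by
    rw [hind]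
    congr 1; ext x
    rw [hind, ← lintegral_add_left_eq_self _ x, ← lintegral_const_mul]
    · simp only [mul_assoc]
    · have : Measurable fun h : ℂ => x + h := by fun_prop
      exact (hIm.comp this).mul (((hwm.comp this).sub_const _).enorm.pow_const 2)
  have hm : Measurable fun p : ℂ × ℂ => I p.1 * I (p.1 + p.2) * ‖w (p.1 + p.2) - w p.1‖ₑ ^ 2 := by
    have : Measurable fun p : ℂ × ℂ => p.1 + p.2 := by fun_prop
    exact ((hIm.comp measurable_fst).mul (hIm.comp this)).mul
      (((hwm.comp this).sub (hwm.comp measurable_fst)).enorm.pow_const 2)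
  rw [e1, lintegral_lintegral_swap hm.aemeasurable]
  calc ∫⁻ h, ∫⁻ x, I x * I (x + h) * ‖w (x + h) - w x‖ₑ ^ 2
      ≤ ∫⁻ h, (Metric.closedBall (0 : ℂ) D).indicator
          (fun _ => ENNReal.ofReal D ^ 2 * ∫⁻ z, ‖G z‖ₑ ^ 2) h := by
        refine lintegral_mono fun h => ?_
        set W : Set ℂ := C ∩ {x | x + h ∈ C} with hW
        have hWo : IsOpen W := hC.inter (hC.preimage (by fun_prop))
        have e2 : ∫⁻ x, I x * I (x + h) * ‖w (x + h) - w x‖ₑ ^ 2 =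
            ∫⁻ x in W, ‖w (x + h) - w x‖ₑ ^ 2 := by
          rw [← lintegral_indicator hWo.measurableSet]
          congr 1; ext x
          by_cases h1 : x ∈ C <;> by_cases h2 : x + h ∈ C <;> simp [I, W, h1, h2]
        change ∫⁻ x, I x * I (x + h) * ‖w (x + h) - w x‖ₑ ^ 2 ≤ _
        rw [e2]
        by_cases hh : ‖h‖ ≤ D
        · rw [indicator_of_mem (by simpa using hh)]
          refine (hw.lintegral_translate_le hWo h ?_).trans ?_
          · intro x hx s hs
            apply hCU
            have := hconv hx.1 hx.2 (sub_nonneg.2 hs.2) hs.1 (by ring)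
            convert this using 1
            simp only [Complex.real_smul]; push_cast; ring
          · gcongr
            rw [← ofReal_norm]
            exact ENNReal.ofReal_le_ofReal hh
        · have : W = ∅ := by
            ext x
            simp only [mem_empty_iff_false, iff_false]
            intro hx
            apply hh
            simpa using hD x hx.1 _ hx.2
          simp [this]
    _ = _ := by
        rw [lintegral_indicator Metric.isClosed_closedBall.measurableSet, lintegral_const]
        simp only [Measure.restrict_apply MeasurableSet.univ, univ_inter]
        ring

/-- The Poincaré inequality on the part `U` of `Ω`, up to the choice of a constant. -/
def HasPoincare (Ω U : Set ℂ) : Prop :=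
  ∃ M : ENNReal, M ≠ ⊤ ∧ ∀ w G, IsSobolev Ω w G →
    ∃ c : ℝ, ∫⁻ x in U, ‖w x - c‖ₑ ^ 2 ≤ M * ∫⁻ z, ‖G z‖ₑ ^ 2

theorem HasPoincare.mono {Ω U V : Set ℂ} (h : HasPoincare Ω V) (hUV : U ⊆ V) :
    HasPoincare Ω U := by
  obtain ⟨M, hM, h⟩ := h
  refine ⟨M, hM, fun w G hw => ?_⟩
  obtain ⟨c, hc⟩ := h w G hw
  exact ⟨c, (lintegral_mono_set hUV).trans hc⟩

/-- The constant is `w x` for a point `x` at which the inner integral of the double integral does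
not exceed its average over `C`. -/
theorem HasPoincare.of_convex {Ω C : Set ℂ} (hC : IsOpen C) (hconv : Convex ℝ C) (hCΩ : C ⊆ Ω)
    (hne : C.Nonempty) (hb : Bornology.IsBounded C) : HasPoincare Ω C := by
  obtain ⟨D, hD⟩ := Metric.isBounded_iff.1 hb
  have hpos : volume C ≠ 0 := (hC.measure_pos volume hne).ne'
  have hfin : volume C ≠ ⊤ := hb.measure_lt_top.ne
  refine ⟨(ENNReal.ofReal D ^ 2 * volume (Metric.closedBall (0 : ℂ) D)) / volume C, ?_, ?_⟩
  · exact ENNReal.div_ne_top (ENNReal.mul_ne_top (by simp) measure_closedBall_lt_top.ne) hpos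
  · intro w G hw
    have hwm := hw.meas
    have hm : Measurable fun p : ℂ × ℂ => ‖w p.2 - w p.1‖ₑ ^ 2 := by
      exact ((hwm.comp measurable_snd).sub (hwm.comp measurable_fst)).enorm.pow_const 2
    obtain ⟨x, hx, hle⟩ := exists_le_setLAverage (μ := volume) hpos hfin
      (f := fun x => ∫⁻ y in C, ‖w y - w x‖ₑ ^ 2)
      (hm.lintegral_prod_right' (ν := volume.restrict C)).aemeasurable
    refine ⟨w x, hle.trans ?_⟩
    rw [setLAverage_eq]
    have := hw.lintegral_sub_convex_le hC hconv hCΩ (D := D) fun x hx y hy => by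
      rw [← dist_eq_norm]; exact hD hy hx
    rw [ENNReal.div_eq_inv_mul, ENNReal.div_eq_inv_mul, mul_assoc]
    gcongr

/-- On the overlap, which has positive measure, `w` is close to both constants `c` and `d`; this
bounds `|d - c|`, and `c` can then replace `d` on `V`. -/
theorem HasPoincare.union {Ω U V : Set ℂ} (hU : HasPoincare Ω U) (hV : HasPoincare Ω V)
    (hUV : volume (U ∩ V) ≠ 0) (hVf : volume V ≠ ⊤) : HasPoincare Ω (U ∪ V) := by
  obtain ⟨M, hM, hU⟩ := hU
  obtain ⟨N, hN, hV⟩ := hV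
  have hfin : volume (U ∩ V) ≠ ⊤ := measure_ne_top_of_subset inter_subset_right hVf
  refine ⟨M + (2 * N + 2 * (volume V * ((2 * M + 2 * N) / volume (U ∩ V)))), ?_, ?_⟩
  · have : (2 * M + 2 * N) / volume (U ∩ V) ≠ ⊤ :=
      ENNReal.div_ne_top (by finiteness) hUV
    finiteness
  intro w G hw
  obtain ⟨c, hc⟩ := hU w G hw
  obtain ⟨d, hd⟩ := hV w G hw
  set E := ∫⁻ z, ‖G z‖ₑ ^ 2
  have hwm := hw.meas
  have hm : ∀ c : ℝ, Measurable fun x => ‖w x - c‖ₑ ^ 2 := fun c =>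
    (hwm.sub_const c).enorm.pow_const 2
  have h1 : ‖d - c‖ₑ ^ 2 ≤ (2 * M + 2 * N) / volume (U ∩ V) * E := by
    rw [ENNReal.div_eq_inv_mul, mul_assoc, ← ENNReal.div_eq_inv_mul,
      ENNReal.le_div_iff_mul_le (Or.inl hUV) (Or.inl hfin)]
    calc ‖d - c‖ₑ ^ 2 * volume (U ∩ V) = ∫⁻ x in U ∩ V, ‖d - c‖ₑ ^ 2 := by simp
      _ ≤ ∫⁻ x in U ∩ V, (2 * ‖w x - c‖ₑ ^ 2 + 2 * ‖w x - d‖ₑ ^ 2) := by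
        refine lintegral_mono fun x => ?_
        have := enorm_add_sq_le (w x - c) (-(w x - d))
        rw [enorm_neg] at this
        convert this using 3
        ring
      _ = 2 * (∫⁻ x in U ∩ V, ‖w x - c‖ₑ ^ 2) + 2 * ∫⁻ x in U ∩ V, ‖w x - d‖ₑ ^ 2 := by
        rw [lintegral_add_left ((hm c).const_mul 2), lintegral_const_mul _ (hm c),
          lintegral_const_mul _ (hm d)]
      _ ≤ 2 * (M * E) + 2 * (N * E) := by
        gcongr
        · exact (lintegral_mono_set inter_subset_left).trans hc
        · exact (lintegral_mono_set inter_subset_right).trans hd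
      _ = _ := by ring
  refine ⟨c, (lintegral_union_le _ _ _).trans ?_⟩
  rw [add_mul]
  refine add_le_add hc ?_
  calc ∫⁻ x in V, ‖w x - c‖ₑ ^ 2 ≤ ∫⁻ x in V, (2 * ‖w x - d‖ₑ ^ 2 + 2 * ‖d - c‖ₑ ^ 2) := by
        refine lintegral_mono fun x => ?_
        have := enorm_add_sq_le (w x - d) (d - c)
        simpa using this
    _ = 2 * (∫⁻ x in V, ‖w x - d‖ₑ ^ 2) + 2 * (volume V * ‖d - c‖ₑ ^ 2) := by
        rw [lintegral_add_left ((hm d).const_mul 2), lintegral_const_mul _ (hm d)]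
        simp only [lintegral_const, Measure.restrict_apply MeasurableSet.univ, univ_inter]
        ring
    _ ≤ 2 * (N * E) + 2 * (volume V * ((2 * M + 2 * N) / volume (U ∩ V) * E)) := by gcongr
    _ = _ := by ring

/-! ### The arrangement of the lines through the edges -/

theorem cross_segment {e : ℂ × ℂ} {z : ℂ} (hz : z ∈ segment ℝ e.1 e.2) : cross e z = 0 := by
  rw [segment_eq_image_lineMap] at hz
  obtain ⟨t, -, rfl⟩ := hz
  simp only [cross, AffineMap.lineMap_apply, vsub_eq_sub, vadd_eq_add, add_sub_cancel_right]
  simp only [Complex.real_smul, Complex.mul_im, Complex.conj_re, Complex.conj_im, Complex.mul_re,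
    Complex.ofReal_re, Complex.ofReal_im]
  ring

theorem cross_combo (e : ℂ × ℂ) (x y : ℂ) {a b : ℝ} (hab : a + b = 1) :
    cross e (a • x + b • y) = a * cross e x + b * cross e y := by
  obtain rfl : a = 1 - b := by linarith
  simp [cross]
  ring

theorem continuous_cross (e : ℂ × ℂ) : Continuous (cross e) := by
  unfold cross; fun_prop

/-- The line through an edge has measure zero. -/
theorem volume_cross_eq_zero {e : ℂ × ℂ} (he : e.1 ≠ e.2) : volume {z | cross e z = 0} = 0 := by
  let f : ℂ →ₗ[ℝ] ℝ := Complex.imLm ∘ₗ LinearMap.mulLeft ℝ (conj (e.2 - e.1))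
  have hf : ∀ z, f z = (conj (e.2 - e.1) * z).im := fun z => rfl
  have h1 : LinearMap.ker f ≠ ⊤ := by
    intro h
    have : f (Complex.I * (e.2 - e.1)) = 0 := by
      rw [← LinearMap.mem_ker, h]; trivial
    rw [hf] at this
    have h2 : conj (e.2 - e.1) * (Complex.I * (e.2 - e.1)) =
        Complex.I * (Complex.normSq (e.2 - e.1) : ℂ) := by
      rw [Complex.normSq_eq_conj_mul_self]; ring
    rw [h2] at this
    simp at this
    exact he (sub_eq_zero.1 this).symm
  have h2 : {z | cross e z = 0} = (fun z => z + -e.1) ⁻¹' (LinearMap.ker f : Set ℂ) := by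
    ext z
    simp [hf, cross, sub_eq_add_neg]
  rw [h2, measure_preimage_add_right]
  exact Measure.addHaar_submodule _ _ h1

namespace PolygonalDomain

variable (K : PolygonalDomain)

/-- A cell of the arrangement of the lines through the edges. -/
def cell (S : Finset (ℂ × ℂ)) : Set ℂ :=
  {z | ∀ e ∈ K.edges, (e ∈ S → 0 < cross e z) ∧ (e ∉ S → cross e z < 0)}

theorem cell_convex (S : Finset (ℂ × ℂ)) : Convex ℝ (K.cell S) := by
  intro x hx y hy a b ha hb hab e he
  rw [cross_combo e x y hab]
  refine ⟨fun h => ?_, fun h => ?_⟩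
  · have h1 := (hx e he).1 h
    have h2 := (hy e he).1 h
    rcases ha.eq_or_lt with rfl | ha
    · obtain rfl : b = 1 := by linarith
      simpa using h2
    · have := mul_pos ha h1; have := mul_nonneg hb h2.le; linarith
  · have h1 := (hx e he).2 h
    have h2 := (hy e he).2 h
    rcases ha.eq_or_lt with rfl | ha
    · obtain rfl : b = 1 := by linarith
      simpa using h2
    · have := mul_neg_of_pos_of_neg ha h1
      have := mul_nonpos_of_nonneg_of_nonpos hb h2.le; linarith

theorem cell_isOpen (S : Finset (ℂ × ℂ)) : IsOpen (K.cell S) := by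
  have : K.cell S = ⋂ e ∈ K.edges,
      {z | (e ∈ S → 0 < cross e z) ∧ (e ∉ S → cross e z < 0)} := by
    ext z; simp [cell]
  rw [this]
  refine isOpen_biInter_finset fun e _ => ?_
  by_cases h : e ∈ S
  · simpa [h] using isOpen_lt continuous_const (continuous_cross e)
  · simpa [h] using isOpen_lt (continuous_cross e) continuous_const

theorem disjoint_frontier : Disjoint K.carrier (frontier K.carrier) :=
  disjoint_iff_inter_eq_empty.2 K.isOpen.inter_frontier_eq

/-- Off the frontier, the plane is separated by the two open sets `K.carrier` and the complement of
its closure. This turns avoidance of the boundary segments into inclusion in the domain. -/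
theorem subset_of_preconnected {s : Set ℂ} (hs : IsPreconnected s)
    (hd : Disjoint s (frontier K.carrier)) (hne : (s ∩ K.carrier).Nonempty) : s ⊆ K.carrier := by
  refine hs.subset_left_of_subset_union K.isOpen isClosed_closure.isOpen_compl
    (disjoint_compl_right_iff_subset.2 subset_closure) (fun z hz => ?_) hne
  by_contra hcon
  simp only [mem_union, mem_compl_iff, not_or, not_not] at hcon
  refine hd.le_bot ⟨hz, ?_⟩
  rw [K.isOpen.frontier_eq]
  exact ⟨hcon.2, hcon.1⟩

theorem cell_disjoint_frontier (S : Finset (ℂ × ℂ)) :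
    Disjoint (K.cell S) (frontier K.carrier) := by
  rw [K.frontier_eq, Set.disjoint_left]
  intro z hz hz'
  simp only [mem_iUnion] at hz'
  obtain ⟨e, he, hze⟩ := hz'
  have h0 := cross_segment hze
  by_cases h : e ∈ S
  · exact absurd ((hz e he).1 h) (by simp [h0])
  · exact absurd ((hz e he).2 h) (by simp [h0])

theorem cell_subset {S : Finset (ℂ × ℂ)} (h : (K.cell S ∩ K.carrier).Nonempty) :
    K.cell S ⊆ K.carrier :=
  K.subset_of_preconnected (K.cell_convex S).isPreconnected (K.cell_disjoint_frontier S) h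

theorem ae_mem_cell : ∀ᵐ z ∂(volume : Measure ℂ), ∃ S ∈ K.edges.powerset, z ∈ K.cell S := by
  have h : ∀ᵐ z ∂(volume : Measure ℂ), ∀ e ∈ K.edges, cross e z ≠ 0 := by
    refine (ae_ball_iff K.edges.countable_toSet).2 fun e he => ?_
    simpa [ae_iff] using volume_cross_eq_zero (K.edge_ne e he)
  filter_upwards [h] with z hz
  classical
  refine ⟨K.edges.filter fun e => 0 < cross e z, by simp, fun e he => ⟨fun h => ?_, fun h => ?_⟩⟩
  · exact (Finset.mem_filter.1 h).2
  · have h1 : ¬ 0 < cross e z := fun h2 => h (Finset.mem_filter.2 ⟨he, h2⟩)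
    exact lt_of_le_of_ne (not_lt.1 h1) (hz e he)

theorem exists_cell_inter {B : Set ℂ} (hB : IsOpen B) (hne : B.Nonempty) :
    ∃ S ∈ K.edges.powerset, (K.cell S ∩ B).Nonempty := by
  have h : volume B ≠ 0 := (hB.measure_pos volume hne).ne'
  obtain ⟨z, hz, S, hS, hzS⟩ := nonempty_of_measure_ne_zero (μ := volume)
    (s := B ∩ {z | ∃ S ∈ K.edges.powerset, z ∈ K.cell S}) (by
      rw [measure_inter_conull]
      · exact h
      · exact ae_iff.1 K.ae_mem_cell)
  exact ⟨S, hS, z, hzS, hz⟩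

/-- The cells are dense because they fill the plane up to null sets; as they are finitely many, the
closure of their union is the union of their closures. -/
theorem exists_closure_cell {x : ℂ} (hx : x ∈ K.carrier) :
    ∃ S, (K.cell S ∩ K.carrier).Nonempty ∧ x ∈ closure (K.cell S) := by
  have h : x ∈ closure (⋃ S ∈ K.edges.powerset, K.cell S ∩ K.carrier) := by
    rw [mem_closure_iff]
    intro o ho hxo
    obtain ⟨S, hS, z, hz, hz'⟩ := K.exists_cell_inter (ho.inter K.isOpen) ⟨x, hxo, hx⟩
    refine ⟨z, hz'.1, ?_⟩
    simp only [mem_iUnion]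
    exact ⟨S, hS, hz, hz'.2⟩
  rw [Finset.closure_biUnion] at h
  simp only [mem_iUnion] at h
  obtain ⟨S, hS, hxS⟩ := h
  refine ⟨S, ?_, closure_mono inter_subset_left hxS⟩
  exact closure_nonempty_iff.1 ⟨x, hxS⟩

/-- Distinct cells are disjoint, so they have no overlap through which to be glued. A ball inside
the domain meets each cell adherent to one of its points in a nonempty open set and serves as the
glue. -/
theorem hasPoincare_cell_union_ball {S : Finset (ℂ × ℂ)} {x y : ℂ} {ρ : ℝ} (hρ : 0 < ρ)
    (hB : Metric.ball x ρ ⊆ K.carrier) (hy : y ∈ Metric.ball x ρ) (hS : y ∈ closure (K.cell S)) :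
    (K.cell S ∩ Metric.ball x ρ).Nonempty ∧
      HasPoincare K.carrier (K.cell S ∪ Metric.ball x ρ) := by
  obtain ⟨z, hzB, hzS⟩ := mem_closure_iff.1 hS _ Metric.isOpen_ball hy
  have hsub : K.cell S ⊆ K.carrier := K.cell_subset ⟨z, hzS, hB hzB⟩
  refine ⟨⟨z, hzS, hzB⟩, ?_⟩
  refine (HasPoincare.of_convex (K.cell_isOpen S) (K.cell_convex S) hsub ⟨z, hzS⟩
    (K.isBounded.subset hsub)).union ?_ ?_ measure_ball_lt_top.ne
  · exact HasPoincare.of_convex Metric.isOpen_ball (convex_ball x ρ) hB ⟨x, by simpa⟩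
      Metric.isBounded_ball
  · exact (((K.cell_isOpen S).inter Metric.isOpen_ball).measure_pos volume ⟨z, hzS, hzB⟩).ne'

/-- Connectedness of the domain as an induction principle. Two points are related when the
inequality holds on the union of any two cells adherent to them. The relation holds locally, through
a ball, and is transitive, through a cell adherent to the middle point. -/
theorem hasPoincare_cells {S S' : Finset (ℂ × ℂ)} (hS : (K.cell S ∩ K.carrier).Nonempty)
    (hS' : (K.cell S' ∩ K.carrier).Nonempty) :
    HasPoincare K.carrier (K.cell S ∪ K.cell S') := by
  obtain ⟨x, hx, hxK⟩ := hS
  obtain ⟨y, hy, hyK⟩ := hS'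
  have hfin : ∀ {U : Set ℂ}, U ⊆ K.carrier → volume U ≠ ⊤ := fun h =>
    (K.isBounded.subset h).measure_lt_top.ne
  have key := K.isConnected.isPreconnected.induction₂' (fun x y => ∀ S S',
    x ∈ closure (K.cell S) → y ∈ closure (K.cell S') →
      HasPoincare K.carrier (K.cell S ∪ K.cell S')) ?_ ?_ hxK hyK
  · exact key S S' (subset_closure hx) (subset_closure hy)
  · intro x hx
    obtain ⟨ρ, hρ, hB⟩ := Metric.isOpen_iff.1 K.isOpen x hx
    have hloc : ∀ y ∈ Metric.ball x ρ, ∀ y' ∈ Metric.ball x ρ, ∀ S S',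
        y ∈ closure (K.cell S) → y' ∈ closure (K.cell S') →
        HasPoincare K.carrier (K.cell S ∪ K.cell S') := by
      intro y hy y' hy' S S' hS hS'
      obtain ⟨⟨z, hz⟩, h1⟩ := K.hasPoincare_cell_union_ball hρ hB hy hS
      obtain ⟨⟨z', hz'⟩, h2⟩ := K.hasPoincare_cell_union_ball hρ hB hy' hS'
      refine (h1.union h2 ?_ ?_).mono (union_subset_union subset_union_left subset_union_left)
      · have : Metric.ball x ρ ⊆ (K.cell S ∪ Metric.ball x ρ) ∩ (K.cell S' ∪ Metric.ball x ρ) :=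
          subset_inter subset_union_right subset_union_right
        exact ((Metric.measure_ball_pos volume x hρ).trans_le (measure_mono this)).ne'
      · exact hfin (union_subset (K.cell_subset ⟨z', hz'.1, hB hz'.2⟩) hB)
    filter_upwards [mem_nhdsWithin_of_mem_nhds (Metric.ball_mem_nhds x hρ)] with y hy
    exact ⟨hloc x (Metric.mem_ball_self hρ) y hy, hloc y hy x (Metric.mem_ball_self hρ)⟩
  · intro x y z hx hy hz hxy hyz S S' hS hS'
    obtain ⟨S'', hne, hS''⟩ := K.exists_closure_cell hy
    have hz' : z ∈ closure K.carrier := subset_closure hz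
    have h1 := hxy S S'' hS hS''
    have h2 := hyz S'' S' hS'' hS'
    have hsub : K.cell S'' ⊆ K.carrier := K.cell_subset hne
    have hsub' : K.cell S' ⊆ K.carrier := by
      obtain ⟨v, hv, hv'⟩ := mem_closure_iff.1 hS' _ K.isOpen hz
      exact K.cell_subset ⟨v, hv', hv⟩
    refine (h1.union h2 ?_ (hfin (union_subset hsub hsub'))).mono
      (union_subset_union subset_union_left subset_union_right)
    have : K.cell S'' ⊆ (K.cell S ∪ K.cell S'') ∩ (K.cell S'' ∪ K.cell S') :=
      subset_inter subset_union_right subset_union_left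
    exact (((K.cell_isOpen S'').measure_pos volume (hne.mono inter_subset_left)).trans_le
      (measure_mono this)).ne'

/-- All cells contained in the domain are attached one by one to a fixed cell `S₀`, which provides
the overlap of positive measure at each stage. -/
theorem hasPoincare : HasPoincare K.carrier K.carrier := by
  classical
  obtain ⟨S₀, -, hS₀⟩ := K.exists_cell_inter K.isOpen K.isConnected.nonempty
  set F := K.edges.powerset.filter fun S => (K.cell S ∩ K.carrier).Nonempty with hF
  have hfin : ∀ {U : Set ℂ}, U ⊆ K.carrier → volume U ≠ ⊤ := fun h =>
    (K.isBounded.subset h).measure_lt_top.ne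
  have hsub₀ := K.cell_subset hS₀
  have hind : ∀ F' ⊆ F, HasPoincare K.carrier (K.cell S₀ ∪ ⋃ S ∈ F', K.cell S) := by
    intro F'
    induction F' using Finset.induction_on with
    | empty =>
      intro _
      simpa using (K.hasPoincare_cells hS₀ hS₀)
    | insert S F' _ ih =>
      intro hsub
      have hS : (K.cell S ∩ K.carrier).Nonempty :=
        (Finset.mem_filter.1 (hsub (Finset.mem_insert_self S F'))).2
      refine ((ih ((Finset.subset_insert S F').trans hsub)).union (K.hasPoincare_cells hS₀ hS)
        ?_ ?_).mono ?_
      · have : K.cell S₀ ⊆ (K.cell S₀ ∪ ⋃ S ∈ F', K.cell S) ∩ (K.cell S₀ ∪ K.cell S) :=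
          subset_inter subset_union_left subset_union_left
        exact (((K.cell_isOpen S₀).measure_pos volume (hS₀.mono inter_subset_left)).trans_le
          (measure_mono this)).ne'
      · exact hfin (union_subset hsub₀ (K.cell_subset hS))
      · rw [Finset.set_biUnion_insert]
        intro z hz
        rcases hz with hz | hz | hz
        · exact Or.inl (Or.inl hz)
        · exact Or.inr (Or.inr hz)
        · exact Or.inl (Or.inr hz)
  obtain ⟨M, hM, h⟩ := hind F subset_rfl
  refine ⟨M, hM, fun w G hw => ?_⟩
  obtain ⟨c, hc⟩ := h w G hw
  refine ⟨c, le_trans ?_ hc⟩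
  refine lintegral_mono' (Measure.restrict_mono_ae ?_) le_rfl
  filter_upwards [K.ae_mem_cell] with z hz hzK
  obtain ⟨S, hS, hzS⟩ := hz
  refine Or.inr ?_
  change z ∈ ⋃ S ∈ F, K.cell S
  simp only [mem_iUnion]
  exact ⟨S, Finset.mem_filter.2 ⟨hS, z, hzS, hzK⟩, hzS⟩

end PolygonalDomain

/-- The Poincaré inequality on a polygonal domain. -/
theorem PolygonalDomain.poincare (K : PolygonalDomain) : ∃ M : ENNReal, M ≠ ⊤ ∧
    ∀ w G, HasWeakGrad K w G → ∃ c : ℝ,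
      ∫⁻ x in K.carrier, ‖w x - c‖ₑ ^ 2 ≤ M * ∫⁻ z in K.carrier, ‖G z‖ₑ ^ 2 := by
  obtain ⟨M, hM, h⟩ := K.hasPoincare
  refine ⟨M, hM, fun w G hw => ?_⟩
  obtain ⟨w', G', hw', e1, e2, -, h2⟩ := hw.exists_isSobolev
  obtain ⟨c, hc⟩ := h w' G' hw'
  refine ⟨c, ?_⟩
  have h3 : ∫⁻ x in K.carrier, ‖w x - c‖ₑ ^ 2 = ∫⁻ x in K.carrier, ‖w' x - c‖ₑ ^ 2 :=
    lintegral_congr_ae (by filter_upwards [e1] with x hx; rw [hx])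
  have h4 : ∫⁻ z in K.carrier, ‖G z‖ₑ ^ 2 = ∫⁻ z, ‖G' z‖ₑ ^ 2 := by
    rw [lintegral_congr_ae (g := fun z => ‖G' z‖ₑ ^ 2)
      (by filter_upwards [e2] with x hx; rw [hx]),
      ← lintegral_indicator K.isOpen.measurableSet]
    congr 1; ext z
    by_cases hz : z ∈ K.carrier
    · simp [hz]
    · simp [hz, h2 z hz]
  rw [h3, h4]
  exact hc

/-! ### Coordinates along an edge -/

/-- The affine coordinates attached to an edge: the edge is the image of `[0, 1] × {0}`, and its
left side is the image of the upper half-plane. -/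
def edgeMap (e : ℂ × ℂ) (p : ℝ × ℝ) : ℂ := e.1 + ((p.1 : ℂ) + p.2 * Complex.I) * (e.2 - e.1)

/-- The inverse of `edgeMap`. -/
def edgeCoord (e : ℂ × ℂ) (z : ℂ) : ℝ × ℝ :=
  (((z - e.1) / (e.2 - e.1)).re, ((z - e.1) / (e.2 - e.1)).im)

/-- In edge coordinates, a triangle over the edge. -/
def edgeRegion (c : ℝ) : Set (ℝ × ℝ) := {p | 0 < p.2 ∧ p.2 < c * p.1 ∧ p.2 < c * (1 - p.1)}

theorem edgeMap_zero (e : ℂ × ℂ) (t : ℝ) : edgeMap e (t, 0) = edgePoint e t := by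
  simp [edgeMap, edgePoint]

theorem edgeMap_edgeCoord {e : ℂ × ℂ} (he : e.1 ≠ e.2) (z : ℂ) :
    edgeMap e (edgeCoord e z) = z := by
  have h : e.2 - e.1 ≠ 0 := sub_ne_zero.2 he.symm
  simp only [edgeMap, edgeCoord, Complex.re_add_im]
  field_simp
  ring

theorem edgeCoord_edgeMap {e : ℂ × ℂ} (he : e.1 ≠ e.2) (p : ℝ × ℝ) :
    edgeCoord e (edgeMap e p) = p := by
  have h : e.2 - e.1 ≠ 0 := sub_ne_zero.2 he.symm
  simp only [edgeMap, edgeCoord, add_sub_cancel_left, mul_div_assoc, div_self h, mul_one]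
  ext <;> simp

theorem continuous_edgeMap (e : ℂ × ℂ) : Continuous (edgeMap e) := by
  unfold edgeMap; fun_prop

theorem continuous_edgeCoord (e : ℂ × ℂ) : Continuous (edgeCoord e) := by
  unfold edgeCoord; fun_prop

/-- `edgeMap` as a homeomorphism. -/
def edgeHomeo (e : ℂ × ℂ) (he : e.1 ≠ e.2) : ℝ × ℝ ≃ₜ ℂ where
  toFun := edgeMap e
  invFun := edgeCoord e
  left_inv := edgeCoord_edgeMap he
  right_inv := edgeMap_edgeCoord he
  continuous_toFun := continuous_edgeMap e
  continuous_invFun := continuous_edgeCoord e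

theorem cross_edgeMap (e : ℂ × ℂ) (p : ℝ × ℝ) :
    cross e (edgeMap e p) = edgeLength e ^ 2 * p.2 := by
  have h : conj (e.2 - e.1) * (((p.1 : ℂ) + p.2 * Complex.I) * (e.2 - e.1)) =
      ((p.1 : ℂ) + p.2 * Complex.I) * ((Complex.normSq (e.2 - e.1) : ℝ) : ℂ) := by
    rw [Complex.normSq_eq_conj_mul_self]; ring
  simp only [cross, edgeMap, add_sub_cancel_left]
  rw [h, Complex.im_mul_ofReal, edgeLength, Complex.normSq_eq_norm_sq]
  simp [mul_comm]

theorem edgeLength_pos {e : ℂ × ℂ} (he : e.1 ≠ e.2) : 0 < edgeLength e :=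
  norm_pos_iff.2 (sub_ne_zero.2 he.symm)

theorem cross_edgeMap_pos {e : ℂ × ℂ} (he : e.1 ≠ e.2) (p : ℝ × ℝ) :
    0 < cross e (edgeMap e p) ↔ 0 < p.2 := by
  rw [cross_edgeMap]
  exact mul_pos_iff_of_pos_left (by have := edgeLength_pos he; positivity)

theorem map_edgeMap {e : ℂ × ℂ} (he : e.1 ≠ e.2) :
    Measure.map (edgeMap e) volume = ENNReal.ofReal ((edgeLength e ^ 2)⁻¹) • volume := by
  have h : e.2 - e.1 ≠ 0 := sub_ne_zero.2 he.symm
  let f : ℂ →ₗ[ℝ] ℂ := LinearMap.mul ℝ ℂ (e.2 - e.1)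
  -- Multiplication by a complex number has real determinant equal to its algebra norm, the square
  -- of its modulus.
  have hdet : LinearMap.det f = edgeLength e ^ 2 := by
    have := Algebra.norm_apply ℝ (e.2 - e.1)
    rw [Algebra.norm_complex_apply, Complex.normSq_eq_norm_sq] at this
    exact this.symm
  have hpos := edgeLength_pos he
  have e1 : edgeMap e = (fun z => z + e.1) ∘ f ∘ Complex.measurableEquivRealProd.symm := by
    ext p
    have : Complex.measurableEquivRealProd.symm p = (p.1 : ℂ) + p.2 * Complex.I := by
      apply Complex.ext <;> simp [Complex.measurableEquivRealProd]
    simp only [Function.comp, this]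
    simp [f, edgeMap]
    ring
  have hfm : Measurable f := f.continuous_of_finiteDimensional.measurable
  rw [e1, ← Measure.map_map (by fun_prop) (hfm.comp (MeasurableEquiv.measurable _)),
    ← Measure.map_map hfm (MeasurableEquiv.measurable _),
    Complex.volume_preserving_equiv_real_prod.symm.map_eq,
    Measure.map_linearMap_addHaar_eq_smul_addHaar volume (f := f)
      (by rw [hdet]; positivity), Measure.map_smul, map_add_right_eq_self, hdet,
    abs_of_pos (by positivity)]

theorem quasiMeasurePreserving_edgeMap {e : ℂ × ℂ} (he : e.1 ≠ e.2) :
    Measure.QuasiMeasurePreserving (edgeMap e) volume volume :=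
  ⟨(continuous_edgeMap e).measurable, by
    rw [map_edgeMap he]; exact Measure.smul_absolutelyContinuous⟩

theorem lintegral_edgeMap {e : ℂ × ℂ} (he : e.1 ≠ e.2) (f : ℂ → ENNReal) :
    ∫⁻ p, f (edgeMap e p) = ENNReal.ofReal ((edgeLength e ^ 2)⁻¹) * ∫⁻ z, f z := by
  have h : MeasurableEmbedding (edgeMap e) :=
    (edgeHomeo e he).toMeasurableEquiv.measurableEmbedding
  rw [← h.lintegral_map, map_edgeMap he, lintegral_smul_measure, smul_eq_mul]

theorem integral_edgeMap {e : ℂ × ℂ} (he : e.1 ≠ e.2) (f : ℂ → ℝ) :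
    ∫ z, f z = edgeLength e ^ 2 * ∫ p, f (edgeMap e p) := by
  have h : MeasurableEmbedding (edgeMap e) :=
    (edgeHomeo e he).toMeasurableEquiv.measurableEmbedding
  have hpos := edgeLength_pos he
  rw [← h.integral_map, map_edgeMap he, integral_smul_measure,
    ENNReal.toReal_ofReal (by positivity), smul_eq_mul]
  field_simp

theorem memLp_edgeMap {F : Type*} [NormedAddCommGroup F] {e : ℂ × ℂ} (he : e.1 ≠ e.2)
    {f : ℂ → F} (hf : MemLp f 2 volume) : MemLp (fun p => f (edgeMap e p)) 2 volume := by
  have h : MemLp f 2 (Measure.map (edgeMap e) volume) := by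
    rw [map_edgeMap he]; exact hf.smul_measure ENNReal.ofReal_ne_top
  exact h.comp_of_map (continuous_edgeMap e).measurable.aemeasurable

/-! ### The domain near an edge -/

theorem edgeRegion_fst {c : ℝ} (hc : 0 < c) {p : ℝ × ℝ} (hp : p ∈ edgeRegion c) :
    0 < p.1 ∧ p.1 < 1 := by
  obtain ⟨h0, h1, h2⟩ := hp
  constructor
  · by_contra h
    have := mul_nonpos_of_nonneg_of_nonpos hc.le (not_lt.1 h); linarith
  · by_contra h
    have := mul_nonpos_of_nonneg_of_nonpos hc.le (sub_nonpos.2 (not_lt.1 h)); linarith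

theorem edgeRegion_two_mul_snd {c : ℝ} {p : ℝ × ℝ} (hp : p ∈ edgeRegion c) : 2 * p.2 < c := by
  obtain ⟨h0, h1, h2⟩ := hp
  linarith

theorem edgeRegion_mono {c c' : ℝ} (hc : 0 < c) (h : c ≤ c') : edgeRegion c ⊆ edgeRegion c' := by
  intro p hp
  obtain ⟨h0, h1⟩ := edgeRegion_fst hc hp
  obtain ⟨h2, h3, h4⟩ := hp
  refine ⟨h2, h3.trans_le ?_, h4.trans_le ?_⟩
  · exact mul_le_mul_of_nonneg_right h h0.le
  · exact mul_le_mul_of_nonneg_right h (by linarith)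

theorem isOpen_edgeRegion (c : ℝ) : IsOpen (edgeRegion c) := by
  refine (isOpen_lt continuous_const continuous_snd).inter
    ((isOpen_lt continuous_snd ?_).inter (isOpen_lt continuous_snd ?_)) <;> fun_prop

theorem convex_edgeRegion (c : ℝ) : Convex ℝ (edgeRegion c) := by
  have h1 : Convex ℝ {p : ℝ × ℝ | 0 < p.2} := by
    exact convex_halfSpace_gt (LinearMap.snd ℝ ℝ ℝ).isLinear 0
  have h2 : Convex ℝ {p : ℝ × ℝ | p.2 - c * p.1 < 0} := by
    exact convex_halfSpace_lt (f := fun p : ℝ × ℝ => p.2 - c * p.1)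
      ((LinearMap.snd ℝ ℝ ℝ) - c • (LinearMap.fst ℝ ℝ ℝ)).isLinear 0
  have h3 : Convex ℝ {p : ℝ × ℝ | p.2 + c * p.1 < c} := by
    exact convex_halfSpace_lt (f := fun p : ℝ × ℝ => p.2 + c * p.1)
      ((LinearMap.snd ℝ ℝ ℝ) + c • (LinearMap.fst ℝ ℝ ℝ)).isLinear c
  convert h1.inter (h2.inter h3) using 1
  ext p
  simp only [edgeRegion, mem_ofPred_eq, mem_inter_iff]
  refine and_congr_right fun _ => and_congr ?_ ?_ <;> constructor <;> intro h <;> linarith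

/-- A segment which is not approached from the upper half-plane at interior points of the edge
avoids a triangle over the edge. -/
theorem eventually_segment_notMem_edgeRegion {q r : ℝ × ℝ}
    (H : ∀ t ∈ Ioo (0 : ℝ) 1, ∀ᶠ p in 𝓝 ((t, 0) : ℝ × ℝ), 0 < p.2 → p ∉ segment ℝ q r) :
    ∀ᶠ c in 𝓝[>] (0 : ℝ), ∀ p ∈ segment ℝ q r, p ∉ edgeRegion c := by
  wlog hqr : q.2 ≤ r.2 generalizing q r
  · simp only [segment_symm ℝ q r] at H ⊢
    exact this H (le_of_not_ge hqr)
  rcases le_or_gt r.2 0 with hr | hr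
  · refine Eventually.of_forall fun c p hp hpc => ?_
    obtain ⟨a, b, ha, hb, hab, rfl⟩ := hp
    have h0 := hpc.1
    simp only [Prod.snd_add, Prod.smul_snd, smul_eq_mul] at h0
    nlinarith
  rcases lt_or_ge 0 q.2 with hq | hq
  -- The whole segment lies above height `q.2`, while the triangle has height at most `c / 2`.
  · filter_upwards [Ioo_mem_nhdsGT hq] with c hc p hp hpc
    obtain ⟨a, b, ha, hb, hab, rfl⟩ := hp
    have h0 := edgeRegion_two_mul_snd hpc
    simp only [Prod.snd_add, Prod.smul_snd, smul_eq_mul] at h0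
    have := hc.2
    nlinarith
  -- The remaining segments cross height zero, at abscissa `t₀`, with inverse slope `k`. If `t₀` is
  -- outside `(0, 1)`, a triangle with `c * |k| < 1` is too flat to be reached.
  have hd : 0 < r.2 - q.2 := by linarith
  set k := (r.1 - q.1) / (r.2 - q.2) with hk
  set t₀ := q.1 - q.2 * k with ht₀
  have hline : ∀ p ∈ segment ℝ q r, p.1 = t₀ + k * p.2 := by
    rintro p ⟨a, b, ha, hb, hab, rfl⟩
    simp only [Prod.fst_add, Prod.smul_fst, Prod.snd_add, Prod.smul_snd, smul_eq_mul]
    obtain rfl : a = 1 - b := by linarith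
    have : k * (r.2 - q.2) = r.1 - q.1 := div_mul_cancel₀ _ hd.ne'
    rw [ht₀]
    linear_combination (-b) * this
  have hmem : ∀ y, q.2 ≤ y → y ≤ r.2 → (t₀ + k * y, y) ∈ segment ℝ q r := by
    intro y h1 h2
    refine ⟨(r.2 - y) / (r.2 - q.2), (y - q.2) / (r.2 - q.2), by apply div_nonneg <;> linarith,
      by apply div_nonneg <;> linarith, by rw [← add_div, div_eq_one_iff_eq hd.ne']; ring, ?_⟩
    ext
    · simp only [Prod.fst_add, Prod.smul_fst, smul_eq_mul, ht₀, hk]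
      field_simp
      ring
    · simp only [Prod.snd_add, Prod.smul_snd, smul_eq_mul]
      field_simp
      ring
  have hsmall : ∀ᶠ c in 𝓝[>] (0 : ℝ), 0 < c ∧ c * |k| < 1 := by
    have : (0 : ℝ) < 1 / (|k| + 1) := by positivity
    filter_upwards [Ioo_mem_nhdsGT this] with c hc
    refine ⟨hc.1, ?_⟩
    have := (lt_div_iff₀ (by positivity)).1 hc.2
    nlinarith [hc.1]
  by_cases h1 : t₀ ≤ 0
  · filter_upwards [hsmall] with c hc p hp hpc
    obtain ⟨h2, h3, -⟩ := hpc
    have h4 := hline p hp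
    have h5 : k * p.2 ≤ |k| * p.2 := mul_le_mul_of_nonneg_right (le_abs_self k) h2.le
    have h6 : c * p.1 ≤ c * (|k| * p.2) := mul_le_mul_of_nonneg_left (by linarith) hc.1.le
    nlinarith
  by_cases h2 : 1 ≤ t₀
  · filter_upwards [hsmall] with c hc p hp hpc
    obtain ⟨h2, -, h3⟩ := hpc
    have h4 := hline p hp
    have h5 : -k * p.2 ≤ |k| * p.2 := mul_le_mul_of_nonneg_right (neg_le_abs k) h2.le
    have h6 : c * (1 - p.1) ≤ c * (|k| * p.2) := mul_le_mul_of_nonneg_left (by linarith) hc.1.le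
    nlinarith
  -- If `t₀` is interior to the edge, the points of the segment just above height zero approach
  -- `(t₀, 0)`, against `H`.
  exfalso
  have hcont : Tendsto (fun y : ℝ => (t₀ + k * y, y)) (𝓝[>] 0) (𝓝 (t₀, 0)) := by
    have : Continuous fun y : ℝ => (t₀ + k * y, y) := by fun_prop
    have h := this.tendsto 0
    simp only [mul_zero, add_zero] at h
    exact h.mono_left nhdsWithin_le_nhds
  have hev := hcont.eventually (H t₀ ⟨not_le.1 h1, not_le.1 h2⟩)
  obtain ⟨y, hy1, hy2⟩ := (hev.and (Ioo_mem_nhdsGT hr)).exists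
  exact hy1 hy2.1 (hmem y (hq.trans hy2.1.le) hy2.2.le)

theorem edgeCoord_segment {e : ℂ × ℂ} {x y z : ℂ} (hz : z ∈ segment ℝ x y) :
    edgeCoord e z ∈ segment ℝ (edgeCoord e x) (edgeCoord e y) := by
  obtain ⟨a, b, ha, hb, hab, rfl⟩ := hz
  refine ⟨a, b, ha, hb, hab, ?_⟩
  have h : (a • x + b • y - e.1) / (e.2 - e.1) =
      a • ((x - e.1) / (e.2 - e.1)) + b • ((y - e.1) / (e.2 - e.1)) := by
    obtain rfl : a = 1 - b := by linarith
    simp only [Complex.real_smul]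
    push_cast
    ring
  simp only [edgeCoord, h]
  ext <;> simp

theorem edgePoint_mem_openSegment (e : ℂ × ℂ) {t : ℝ} (ht : t ∈ Ioo (0 : ℝ) 1) :
    edgePoint e t ∈ openSegment ℝ e.1 e.2 := by
  rw [openSegment_eq_image']
  exact ⟨t, ht, by simp [edgePoint]⟩

theorem exists_edgePoint_of_mem_openSegment {e : ℂ × ℂ} {x : ℂ}
    (hx : x ∈ openSegment ℝ e.1 e.2) : ∃ t ∈ Ioo (0 : ℝ) 1, edgePoint e t = x := by
  rw [openSegment_eq_image'] at hx
  obtain ⟨t, ht, rfl⟩ := hx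
  exact ⟨t, ht, by simp [edgePoint]⟩

namespace PolygonalDomain

variable (K : PolygonalDomain) {e : ℂ × ℂ}

theorem eventually_edgeMap_mem (he : e ∈ K.edges) {t : ℝ} (ht : t ∈ Ioo (0 : ℝ) 1) :
    ∀ᶠ p in 𝓝 ((t, 0) : ℝ × ℝ), 0 < p.2 → edgeMap e p ∈ K.carrier := by
  obtain ⟨ρ, hρ, h⟩ := K.left_mem e he _ (edgePoint_mem_openSegment e ht)
  have h1 : Metric.ball (edgePoint e t) ρ ∈ 𝓝 (edgeMap e (t, 0)) := by
    rw [edgeMap_zero]; exact Metric.ball_mem_nhds _ hρ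
  filter_upwards [(continuous_edgeMap e).continuousAt h1] with p hp hp2
  exact h _ hp ((cross_edgeMap_pos (K.edge_ne e he) p).2 hp2)

theorem segment_subset_frontier (he : e ∈ K.edges) :
    segment ℝ e.1 e.2 ⊆ frontier K.carrier := by
  rw [K.frontier_eq]
  exact fun z hz => mem_biUnion (t := fun e : ℂ × ℂ => segment ℝ e.1 e.2) he hz

/-- A triangle over an edge is contained in the domain. -/
theorem exists_edgeRegion (he : e ∈ K.edges) :
    ∃ c > 0, ∀ p ∈ edgeRegion c, edgeMap e p ∈ K.carrier := by
  have hne := K.edge_ne e he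
  have h1 : ∀ e' ∈ K.edges, ∀ᶠ c in 𝓝[>] (0 : ℝ),
      ∀ p ∈ segment ℝ (edgeCoord e e'.1) (edgeCoord e e'.2), p ∉ edgeRegion c := by
    intro e' he'
    refine eventually_segment_notMem_edgeRegion fun t ht => ?_
    filter_upwards [K.eventually_edgeMap_mem he ht] with p hp hp2 hseg
    have h2 : edgeMap e p ∈ segment ℝ e'.1 e'.2 := by
      obtain ⟨a, b, ha, hb, hab, rfl⟩ := hseg
      refine ⟨a, b, ha, hb, hab, ?_⟩
      conv_lhs => rw [← edgeMap_edgeCoord hne e'.1, ← edgeMap_edgeCoord hne e'.2]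
      obtain rfl : a = 1 - b := by linarith
      simp only [edgeMap, Prod.fst_add, Prod.snd_add, Prod.smul_fst, Prod.smul_snd, smul_eq_mul,
        Complex.real_smul]
      push_cast
      ring
    exact K.disjoint_frontier.le_bot ⟨hp hp2, K.segment_subset_frontier he' h2⟩
  obtain ⟨c, hc, hc0⟩ := (((Filter.eventually_all_finset K.edges).2 h1).and
    self_mem_nhdsWithin).exists
  have hc0 : 0 < c := hc0
  refine ⟨c, hc0, ?_⟩
  -- The triangle is connected and avoids every boundary segment, so it is enough that one of its
  -- points, above the midpoint of the edge, is in the domain.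
  have hsub : edgeMap e '' edgeRegion c ⊆ K.carrier := by
    refine K.subset_of_preconnected ((convex_edgeRegion c).isPreconnected.image _
      (continuous_edgeMap e).continuousOn) ?_ ?_
    · rw [Set.disjoint_left]
      rintro _ ⟨p, hp, rfl⟩ hz
      rw [K.frontier_eq] at hz
      simp only [mem_iUnion] at hz
      obtain ⟨e', he', hz⟩ := hz
      have := edgeCoord_segment (e := e) hz
      rw [edgeCoord_edgeMap hne] at this
      exact hc e' he' p this hp
    · have hcont : Tendsto (fun y : ℝ => ((1 / 2 : ℝ), y)) (𝓝[>] 0) (𝓝 (1 / 2, 0)) := by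
        have : Continuous fun y : ℝ => ((1 / 2 : ℝ), y) := by fun_prop
        exact (this.tendsto 0).mono_left nhdsWithin_le_nhds
      have hev := hcont.eventually (K.eventually_edgeMap_mem he (t := 1 / 2) (by norm_num))
      obtain ⟨y, hy1, hy2⟩ := (hev.and (Ioo_mem_nhdsGT (half_pos hc0))).exists
      refine ⟨_, mem_image_of_mem _ (?_ : ((1 / 2 : ℝ), y) ∈ edgeRegion c), hy1 hy2.1⟩
      have := hy2.2
      refine ⟨hy2.1, ?_, ?_⟩ <;> simp only <;> linarith
  exact fun p hp => hsub (mem_image_of_mem _ hp)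

/-- Without edges the domain would be open and closed, hence the whole plane, which is unbounded.
Coercivity needs one edge on which to fix the additive constant. -/
theorem edges_nonempty : K.edges.Nonempty := by
  rw [Finset.nonempty_iff_ne_empty]
  intro h
  have h1 := K.frontier_eq
  simp only [h, Finset.notMem_empty, iUnion_of_empty, iUnion_empty] at h1
  have h2 : IsClopen K.carrier := isClopen_iff_frontier_eq_empty.2 h1
  rcases isClopen_iff.1 h2 with h3 | h3
  · exact K.isConnected.nonempty.ne_empty h3
  · have := K.isBounded
    rw [h3] at this
    exact NormedSpace.unbounded_univ ℝ ℂ this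

end PolygonalDomain

/-! ### Smooth steps -/

/-- A smooth step from `0` to `1` on `[ε, 2ε]`. -/
def smoothStep (ε y : ℝ) : ℝ := Real.smoothTransition (y / ε - 1)

/-- The derivative of `smoothStep`. -/
def smoothStepDeriv (ε y : ℝ) : ℝ := deriv Real.smoothTransition (y / ε - 1) / ε

theorem contDiff_smoothStep (ε : ℝ) : ContDiff ℝ ∞ (smoothStep ε) :=
  Real.smoothTransition.contDiff.comp ((contDiff_id.div_const ε).sub contDiff_const)

theorem hasDerivAt_smoothStep (ε y : ℝ) :
    HasDerivAt (smoothStep ε) (smoothStepDeriv ε y) y := by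
  have h1 : HasDerivAt Real.smoothTransition (deriv Real.smoothTransition (y / ε - 1))
      (y / ε - 1) :=
    ((Real.smoothTransition.contDiff (n := 1)).differentiable (by simp) _).hasDerivAt
  have h2 : HasDerivAt (fun y : ℝ => y / ε - 1) (1 / ε) y :=
    ((hasDerivAt_id y).div_const ε).sub_const 1
  have h := h1.comp y h2
  rw [mul_one_div] at h
  exact h

theorem smoothStep_eq_zero {ε y : ℝ} (hε : 0 < ε) (hy : y ≤ ε) : smoothStep ε y = 0 :=
  Real.smoothTransition.zero_of_nonpos (by rw [sub_nonpos, div_le_one hε]; exact hy)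

theorem smoothStep_eq_one {ε y : ℝ} (hε : 0 < ε) (hy : 2 * ε ≤ y) : smoothStep ε y = 1 :=
  Real.smoothTransition.one_of_one_le (by
    have : 2 ≤ y / ε := by rwa [le_div_iff₀ hε]
    linarith)

theorem abs_smoothStep_le_one (ε y : ℝ) : |smoothStep ε y| ≤ 1 := by
  unfold smoothStep
  rw [abs_of_nonneg (Real.smoothTransition.nonneg _)]
  exact Real.smoothTransition.le_one _

theorem smoothStepDeriv_nonneg {ε : ℝ} (hε : 0 < ε) (y : ℝ) : 0 ≤ smoothStepDeriv ε y :=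
  div_nonneg (Real.smoothTransition.monotone.deriv_nonneg) hε.le

theorem smoothStepDeriv_eq_zero {ε y : ℝ} (hε : 0 < ε) (hy : y ≤ ε ∨ 2 * ε ≤ y) :
    smoothStepDeriv ε y = 0 := by
  -- The transition attains its minimum or its maximum at this point, which covers the end points
  -- `ε` and `2 * ε` as well.
  have : deriv Real.smoothTransition (y / ε - 1) = 0 := by
    rcases hy with hy | hy
    · refine IsLocalMin.deriv_eq_zero (Eventually.of_forall fun x => ?_)
      rw [Real.smoothTransition.zero_of_nonpos (x := y / ε - 1)
        (by rw [sub_nonpos, div_le_one hε]; exact hy)]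
      exact Real.smoothTransition.nonneg x
    · refine IsLocalMax.deriv_eq_zero (Eventually.of_forall fun x => ?_)
      rw [Real.smoothTransition.one_of_one_le (x := y / ε - 1) (by
        have : 2 ≤ y / ε := by rwa [le_div_iff₀ hε]
        linarith)]
      exact Real.smoothTransition.le_one x
  simp [smoothStepDeriv, this]

theorem continuous_smoothStepDeriv (ε : ℝ) : Continuous (smoothStepDeriv ε) := by
  have : Continuous (deriv Real.smoothTransition) :=
    (Real.smoothTransition.contDiff (n := 1)).continuous_deriv le_rfl
  exact (this.comp ((continuous_id.div_const ε).sub continuous_const)).div_const ε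

theorem exists_smoothStepDeriv_le : ∃ M > 0, ∀ ε > 0, ∀ y, smoothStepDeriv ε y ≤ M / ε := by
  have hc : Continuous (deriv Real.smoothTransition) :=
    (Real.smoothTransition.contDiff (n := 1)).continuous_deriv le_rfl
  obtain ⟨M, hM⟩ := (isCompact_Icc (a := (0 : ℝ)) (b := 1)).bddAbove_image hc.continuousOn
  refine ⟨max M 1, by positivity, fun ε hε y => ?_⟩
  by_cases hy : y ≤ ε ∨ 2 * ε ≤ y
  · rw [smoothStepDeriv_eq_zero hε hy]; positivity
  · push Not at hy
    unfold smoothStepDeriv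
    gcongr
    refine le_trans (hM (mem_image_of_mem _ ⟨?_, ?_⟩)) (le_max_left _ _)
    · have : 1 ≤ y / ε := by rw [le_div_iff₀ hε]; linarith
      linarith
    · have : y / ε ≤ 2 := by rw [div_le_iff₀ hε]; linarith
      linarith

theorem integral_smoothStepDeriv {ε : ℝ} (hε : 0 < ε) :
    ∫ y in Ioi (0 : ℝ), smoothStepDeriv ε y = 1 := by
  have h1 : ∫ y in (0 : ℝ)..(2 * ε), smoothStepDeriv ε y = 1 := by
    rw [intervalIntegral.integral_eq_sub_of_hasDerivAt
      (fun y _ => hasDerivAt_smoothStep ε y)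
      (continuous_smoothStepDeriv ε).continuousOn.intervalIntegrable,
      smoothStep_eq_one hε le_rfl, smoothStep_eq_zero hε hε.le, sub_zero]
  rw [← h1, intervalIntegral.integral_of_le (by positivity)]
  refine setIntegral_eq_of_subset_of_forall_sdiff_eq_zero measurableSet_Ioi
    Ioc_subset_Ioi_self fun y hy => ?_
  refine smoothStepDeriv_eq_zero hε (Or.inr ?_)
  by_contra h
  exact hy.2 ⟨hy.1, (not_le.1 h).le⟩

theorem integrableOn_smoothStepDeriv {ε : ℝ} (hε : 0 < ε) :
    IntegrableOn (smoothStepDeriv ε) (Ioi 0) := by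
  by_contra h
  have := integral_undef h
  rw [integral_smoothStepDeriv hε] at this
  exact one_ne_zero this

/-! ### The trace criterion -/

theorem tendsto_lintegral_strip {γ : ℝ × ℝ → ENNReal} (hγ : Measurable γ)
    (hγi : ∫⁻ p, γ p ≠ ⊤) :
    Tendsto (fun ε : ℝ => ∫⁻ p in {p : ℝ × ℝ | p.2 ∈ Ioo 0 (2 * ε)}, γ p) (𝓝[>] 0) (𝓝 0) := by
  have hm : ∀ ε : ℝ, MeasurableSet {p : ℝ × ℝ | p.2 ∈ Ioo 0 (2 * ε)} := fun ε =>
    measurable_snd measurableSet_Ioo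
  have h : Tendsto (fun ε : ℝ => ∫⁻ p, {p : ℝ × ℝ | p.2 ∈ Ioo 0 (2 * ε)}.indicator γ p)
      (𝓝[>] 0) (𝓝 (∫⁻ p : ℝ × ℝ, 0)) := by
    refine tendsto_lintegral_filter_of_dominated_convergence γ
      (Eventually.of_forall fun ε => hγ.indicator (hm ε))
      (Eventually.of_forall fun ε => Eventually.of_forall fun p => indicator_le_self _ _ _) hγi
      (Eventually.of_forall fun p => ?_)
    refine tendsto_const_nhds.congr' ?_
    rcases le_or_gt p.2 0 with hp | hp
    · exact Eventually.of_forall fun ε =>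
        (indicator_of_notMem (fun h => absurd h.1 (not_lt.2 hp)) _).symm
    · filter_upwards [Ioo_mem_nhdsGT (half_pos hp)] with ε hε
      exact (indicator_of_notMem
        (fun h => by have := h.2; have := hε.2; linarith) _).symm
  rw [lintegral_zero] at h
  exact h.congr fun ε => lintegral_indicator (hm ε) γ

/-- If `f(t, y)` differs from `τ(t)` by at most the integral of `γ` from `(t, 0)` to `(t, y)`,
then the averages of `f` near `y = 0` converge to `τ`. -/
theorem tendsto_integral_smoothStepDeriv {c : ℝ} (hc : 0 < c) {f : ℝ × ℝ → ℝ} {τ : ℝ → ℝ}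
    {γ : ℝ × ℝ → ENNReal} (hγ : Measurable γ) (hγi : ∫⁻ p, γ p ≠ ⊤)
    (hf : MemLp f 2 volume) (hτ : IntegrableOn τ (Ioo 0 1))
    (hb : ∀ᵐ p : ℝ × ℝ, p ∈ edgeRegion c → ‖f p - τ p.1‖ₑ ≤ ∫⁻ s in Ioo 0 p.2, γ (p.1, s))
    {ψ : ℝ × ℝ → ℝ} (hψ : Continuous ψ) (hψc : HasCompactSupport ψ) {A δ : ℝ} (hδ : 0 < δ)
    (hψA : ∀ t y, |ψ (t, y) - ψ (t, 0)| ≤ A * |y|)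
    (hψδ : ∀ t y, 0 < y → y < δ → (t, y) ∉ edgeRegion c → ψ (t, y) = 0) :
    Tendsto (fun ε => ∫ p in edgeRegion c, f p * ψ p * smoothStepDeriv ε p.2) (𝓝[>] 0)
      (𝓝 (∫ t in Ioo (0 : ℝ) 1, τ t * ψ (t, 0))) := by
  have hRm := (isOpen_edgeRegion c).measurableSet
  obtain ⟨B, hB⟩ := hψc.exists_bound_of_continuous hψ
  obtain ⟨M, hM0, hM⟩ := exists_smoothStepDeriv_le
  have hB0 : 0 ≤ B := (norm_nonneg _).trans (hB 0)
  have hA0 : 0 ≤ A := by simpa using (abs_nonneg _).trans (hψA 0 1)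
  have hκ : ∀ ε, Continuous fun p : ℝ × ℝ => ψ p * smoothStepDeriv ε p.2 := fun ε =>
    hψ.mul ((continuous_smoothStepDeriv ε).comp continuous_snd)
  have hκc : ∀ ε, HasCompactSupport fun p : ℝ × ℝ => ψ p * smoothStepDeriv ε p.2 := fun ε =>
    hψc.mul_right
  have i1 : ∀ ε, Integrable (fun p => f p * (ψ p * smoothStepDeriv ε p.2))
      (volume.restrict (edgeRegion c)) := fun ε =>
    (hf.integrable_mul (q := 2) ((hκ ε).memLp_of_hasCompactSupport (hκc ε))).restrict
  have hQ : Integrable (fun p : ℝ × ℝ => τ p.1)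
      (volume.restrict (Ioo (0 : ℝ) 1 ×ˢ Ioo (0 : ℝ) c)) := by
    rw [Measure.volume_eq_prod, ← Measure.prod_restrict]
    exact Integrable.comp_fst (f := τ) hτ _
  have hRQ : edgeRegion c ⊆ Ioo (0 : ℝ) 1 ×ˢ Ioo (0 : ℝ) c := by
    intro p hp
    have h1 := edgeRegion_fst hc hp
    have h2 := edgeRegion_two_mul_snd hp
    exact ⟨h1, hp.1, by have := hp.1; linarith⟩
  have hR : Integrable (fun p : ℝ × ℝ => τ p.1) (volume.restrict (edgeRegion c)) :=
    hQ.mono_measure (Measure.restrict_mono hRQ le_rfl)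
  have hbd : ∀ ε > 0, ∀ p : ℝ × ℝ, ‖ψ p * smoothStepDeriv ε p.2‖ ≤ B * (M / ε) := by
    intro ε hε p
    rw [norm_mul, Real.norm_of_nonneg (smoothStepDeriv_nonneg hε _)]
    exact mul_le_mul (hB p) (hM ε hε _) (smoothStepDeriv_nonneg hε _) hB0
  have i2 : ∀ ε > 0, Integrable (fun p => τ p.1 * (ψ p * smoothStepDeriv ε p.2))
      (volume.restrict (edgeRegion c)) := fun ε hε =>
    hR.mul_bdd (c := B * (M / ε)) (hκ ε).aestronglyMeasurable
      (Eventually.of_forall (hbd ε hε))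
  -- the two parts
  have t1 : Tendsto (fun ε => ∫ p in edgeRegion c, (f p - τ p.1) * (ψ p * smoothStepDeriv ε p.2))
      (𝓝[>] 0) (𝓝 0) := by
    rw [tendsto_zero_iff_enorm_tendsto_zero]
    -- The kernel is at most `M / ε` and lives on a strip of height `2 * ε`, so integrating over the
    -- height costs only the factor `2 * B * M`; the integral of `γ` over the shrinking strip tends
    -- to zero.
    have hlim : Tendsto (fun ε : ℝ => ENNReal.ofReal (2 * B * M) *
        ∫⁻ p in {p : ℝ × ℝ | p.2 ∈ Ioo 0 (2 * ε)}, γ p) (𝓝[>] 0) (𝓝 0) := by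
      simpa using ENNReal.Tendsto.const_mul (tendsto_lintegral_strip hγ hγi)
        (Or.inr ENNReal.ofReal_ne_top)
    refine tendsto_of_tendsto_of_tendsto_of_le_of_le' tendsto_const_nhds hlim
      (Eventually.of_forall fun _ => zero_le) ?_
    filter_upwards [self_mem_nhdsWithin] with ε hε
    have hε : 0 < ε := hε
    calc ‖∫ p in edgeRegion c, (f p - τ p.1) * (ψ p * smoothStepDeriv ε p.2)‖ₑ
        ≤ ∫⁻ p in edgeRegion c, ‖(f p - τ p.1) * (ψ p * smoothStepDeriv ε p.2)‖ₑ :=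
          enorm_integral_le_lintegral_enorm _
      _ ≤ ∫⁻ p in edgeRegion c, {p : ℝ × ℝ | p.2 ∈ Ioo 0 (2 * ε)}.indicator
            (fun p => ENNReal.ofReal (B * (M / ε)) * ∫⁻ s in Ioo 0 (2 * ε), γ (p.1, s)) p := by
          refine lintegral_mono_ae ?_
          rw [ae_restrict_iff' hRm]
          filter_upwards [hb] with p hp hpR
          by_cases h2 : p.2 < 2 * ε
          · rw [indicator_of_mem (show p ∈ {p : ℝ × ℝ | p.2 ∈ Ioo 0 (2 * ε)} from ⟨hpR.1, h2⟩),
              enorm_mul, mul_comm]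
            gcongr
            · rw [← ofReal_norm]
              exact ENNReal.ofReal_le_ofReal (hbd ε hε p)
            · exact (hp hpR).trans (lintegral_mono_set (Ioo_subset_Ioo_right h2.le))
          · rw [smoothStepDeriv_eq_zero hε (Or.inr (not_lt.1 h2))]
            simp
      _ ≤ ∫⁻ p, {p : ℝ × ℝ | p.2 ∈ Ioo 0 (2 * ε)}.indicator
            (fun p => ENNReal.ofReal (B * (M / ε)) * ∫⁻ s in Ioo 0 (2 * ε), γ (p.1, s)) p :=
          lintegral_mono' Measure.restrict_le_self le_rfl
      _ = ∫⁻ t, ∫⁻ y in Ioo 0 (2 * ε),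
            ENNReal.ofReal (B * (M / ε)) * ∫⁻ s in Ioo 0 (2 * ε), γ (t, s) := by
          have hm1 : Measurable fun t => ∫⁻ s in Ioo 0 (2 * ε), γ (t, s) :=
            hγ.lintegral_prod_right'
          rw [Measure.volume_eq_prod, lintegral_prod]
          · refine lintegral_congr fun t => ?_
            rw [← lintegral_indicator measurableSet_Ioo]
            rfl
          · exact (((hm1.comp measurable_fst).const_mul _).indicator
              (measurable_snd measurableSet_Ioo)).aemeasurable
      _ = ENNReal.ofReal (2 * B * M) * ∫⁻ t, ∫⁻ s in Ioo 0 (2 * ε), γ (t, s) := by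
          have hm1 : Measurable fun t => ∫⁻ s in Ioo 0 (2 * ε), γ (t, s) :=
            hγ.lintegral_prod_right'
          simp only [lintegral_const, Measure.restrict_apply MeasurableSet.univ, univ_inter,
            Real.volume_Ioo, sub_zero]
          rw [lintegral_mul_const _ (hm1.const_mul _), lintegral_const_mul _ hm1, mul_right_comm,
            ← ENNReal.ofReal_mul (by positivity)]
          congr 2
          field_simp
      _ = ENNReal.ofReal (2 * B * M) * ∫⁻ p in {p : ℝ × ℝ | p.2 ∈ Ioo 0 (2 * ε)}, γ p := by
          congr 1
          have hs : MeasurableSet {p : ℝ × ℝ | p.2 ∈ Ioo 0 (2 * ε)} :=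
            measurable_snd measurableSet_Ioo
          rw [← lintegral_indicator hs, Measure.volume_eq_prod,
            lintegral_prod _ (hγ.indicator hs).aemeasurable]
          refine lintegral_congr fun t => ?_
          rw [← lintegral_indicator measurableSet_Ioo]
          rfl
  -- For each `t` the kernel has mass one in `y`, and the Lipschitz bound on `ψ` makes the error at
  -- most `A * (2 * ε)`, uniformly in `t`.
  have t2 : Tendsto (fun ε => ∫ p in edgeRegion c, τ p.1 * (ψ p * smoothStepDeriv ε p.2))
      (𝓝[>] 0) (𝓝 (∫ t in Ioo (0 : ℝ) 1, τ t * ψ (t, 0))) := by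
    rw [tendsto_iff_norm_sub_tendsto_zero]
    have hlim : Tendsto (fun ε : ℝ => (∫ t in Ioo (0 : ℝ) 1, ‖τ t‖) * (A * (2 * ε)))
        (𝓝[>] 0) (𝓝 0) := by
      have : Continuous fun ε : ℝ => (∫ t in Ioo (0 : ℝ) 1, ‖τ t‖) * (A * (2 * ε)) := by fun_prop
      have h := this.tendsto 0
      simp only [mul_zero] at h
      exact h.mono_left nhdsWithin_le_nhds
    refine squeeze_zero' (Eventually.of_forall fun _ => norm_nonneg _) ?_ hlim
    filter_upwards [Ioo_mem_nhdsGT (half_pos hδ)] with ε hε'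
    have hε : 0 < ε := hε'.1
    have hεδ : 2 * ε < δ := by have := hε'.2; linarith
    have i3 : Integrable (fun p : ℝ × ℝ => τ p.1 * (ψ p * smoothStepDeriv ε p.2))
        ((volume.restrict (Ioo (0 : ℝ) 1)).prod (volume.restrict (Ioi 0))) := by
      have h1 := (Integrable.mul_prod (f := τ) hτ (integrableOn_smoothStepDeriv hε)).mul_bdd
        (c := B) hψ.aestronglyMeasurable (Eventually.of_forall hB)
      refine h1.congr (Eventually.of_forall fun p => ?_)
      simp only; ring
    have e1 : ∫ p in edgeRegion c, τ p.1 * (ψ p * smoothStepDeriv ε p.2) =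
        ∫ t in Ioo (0 : ℝ) 1, τ t * ∫ y in Ioi (0 : ℝ), ψ (t, y) * smoothStepDeriv ε y := by
      -- Below height `δ` the function `ψ` vanishes off the triangle and above `2 * ε` the kernel
      -- vanishes, so the triangle can be replaced by a product set.
      have h1 : ∫ p in edgeRegion c, τ p.1 * (ψ p * smoothStepDeriv ε p.2) =
          ∫ p in Ioo (0 : ℝ) 1 ×ˢ Ioi (0 : ℝ), τ p.1 * (ψ p * smoothStepDeriv ε p.2) := by
        symm
        refine setIntegral_eq_of_subset_of_forall_sdiff_eq_zero
          (measurableSet_Ioo.prod measurableSet_Ioi)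
          (fun p hp => ⟨edgeRegion_fst hc hp, hp.1⟩) fun p hp => ?_
        by_cases h2 : 2 * ε ≤ p.2
        · rw [smoothStepDeriv_eq_zero hε (Or.inr h2)]; simp
        · rw [hψδ p.1 p.2 hp.1.2 (by push Not at h2; linarith) hp.2]; simp
      rw [h1, Measure.volume_eq_prod, ← Measure.prod_restrict, integral_prod _ i3]
      simp only [integral_const_mul]
    have e2 : ∀ t, ‖(∫ y in Ioi (0 : ℝ), ψ (t, y) * smoothStepDeriv ε y) - ψ (t, 0)‖ ≤
        A * (2 * ε) := by
      intro t
      have j1 := integrableOn_smoothStepDeriv hε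
      have j2 : IntegrableOn (fun y => ψ (t, y) * smoothStepDeriv ε y) (Ioi 0) :=
        j1.bdd_mul (c := B) (by fun_prop : Continuous fun y => ψ (t, y)).aestronglyMeasurable
          (Eventually.of_forall fun y => hB _)
      have h1 : ψ (t, 0) = ∫ y in Ioi (0 : ℝ), ψ (t, 0) * smoothStepDeriv ε y := by
        rw [integral_const_mul, integral_smoothStepDeriv hε, mul_one]
      rw [h1, ← integral_sub j2 (j1.const_mul _)]
      refine (norm_integral_le_of_norm_le (g := fun y => A * (2 * ε) * smoothStepDeriv ε y)
        (j1.const_mul _) ?_).trans ?_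
      · filter_upwards [ae_restrict_mem measurableSet_Ioi] with y hy
        rw [← sub_mul, norm_mul, Real.norm_of_nonneg (smoothStepDeriv_nonneg hε _)]
        by_cases h2 : 2 * ε ≤ y
        · rw [smoothStepDeriv_eq_zero hε (Or.inr h2)]; simp
        · refine mul_le_mul_of_nonneg_right ((hψA t y).trans ?_) (smoothStepDeriv_nonneg hε _)
          rw [abs_of_pos hy]
          exact mul_le_mul_of_nonneg_left (not_le.1 h2).le hA0
      · rw [integral_const_mul, integral_smoothStepDeriv hε, mul_one]
    have i4 : Integrable (fun t => τ t * ∫ y in Ioi (0 : ℝ), ψ (t, y) * smoothStepDeriv ε y)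
        (volume.restrict (Ioo 0 1)) := by
      have := i3.integral_prod_left
      simpa only [integral_const_mul] using this
    have i5 : Integrable (fun t => τ t * ψ (t, 0)) (volume.restrict (Ioo 0 1)) :=
      Integrable.mul_bdd (c := B) hτ
        (by fun_prop : Continuous fun t => ψ (t, 0)).aestronglyMeasurable
        (Eventually.of_forall fun t => hB _)
    rw [e1, ← integral_sub i4 i5, ← integral_mul_const]
    refine norm_integral_le_of_norm_le (hτ.norm.mul_const _) (Eventually.of_forall fun t => ?_)
    rw [← mul_sub, norm_mul]
    exact mul_le_mul_of_nonneg_left (e2 t) (norm_nonneg _)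
  have t3 := t1.add t2
  rw [zero_add] at t3
  refine t3.congr' ?_
  filter_upwards [self_mem_nhdsWithin] with ε hε
  rw [← integral_add _ (i2 ε hε)]
  · refine integral_congr_ae (Eventually.of_forall fun p => ?_)
    simp only; ring
  · refine ((i1 ε).sub (i2 ε hε)).congr (Eventually.of_forall fun p => ?_)
    simp only [Pi.sub_apply]; ring

theorem outwardNormal_inner {e : ℂ × ℂ} (he : e.1 ≠ e.2) (u : ℂ) :
    ⟪outwardNormal e, u⟫ = -(edgeLength e * (u / (e.2 - e.1)).im) := by
  have h : e.2 - e.1 ≠ 0 := sub_ne_zero.2 he.symm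
  have hL := edgeLength_pos he
  have hN : Complex.normSq (e.2 - e.1) = edgeLength e ^ 2 := by
    rw [Complex.normSq_eq_norm_sq]; rfl
  have hu : u = (u / (e.2 - e.1)) * (e.2 - e.1) := (div_mul_cancel₀ u h).symm
  generalize u / (e.2 - e.1) = v at hu ⊢
  have h1 : ⟪outwardNormal e, u⟫ = (u * conj (outwardNormal e)).re := by
    rw [Complex.inner]
  have h2 : u * conj (outwardNormal e) = v * Complex.I * ((edgeLength e : ℝ) : ℂ) := by
    rw [hu]
    simp only [outwardNormal, map_div₀, map_mul, map_neg, Complex.conj_I, Complex.conj_ofReal,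
      neg_neg]
    have h3 : (e.2 - e.1) * conj (e.2 - e.1) = ((edgeLength e : ℝ) : ℂ) ^ 2 := by
      rw [Complex.mul_conj, hN]; push_cast; ring
    have h4 : ((edgeLength e : ℝ) : ℂ) ≠ 0 := by exact_mod_cast hL.ne'
    field_simp
    linear_combination v * h3
  rw [h1, h2, Complex.re_mul_ofReal]
  simp
  ring

/-- The part of `S` in the closed upper half-plane and outside the open double cone over the edge is
compact. It cannot touch the line of the edge, because `S` meets that line only in the open edge; so
it has a positive minimal height. -/
theorem exists_strip {c : ℝ} (hc : 0 < c) {e : ℂ × ℂ} (he : e.1 ≠ e.2) {S : Set ℂ}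
    (hS : IsCompact S)
    (hSe : ∀ z ∈ S, cross e z = 0 → z ∈ openSegment ℝ e.1 e.2) :
    ∃ δ > 0, ∀ t y, 0 < y → y < δ → (t, y) ∉ edgeRegion c → edgeMap e (t, y) ∉ S := by
  set O : Set (ℝ × ℝ) := {p | |p.2| < c * p.1 ∧ |p.2| < c * (1 - p.1)}
  have hO : IsOpen O := by
    have h1 : IsOpen {p : ℝ × ℝ | |p.2| < c * p.1} := isOpen_lt (by fun_prop) (by fun_prop)
    have h2 : IsOpen {p : ℝ × ℝ | |p.2| < c * (1 - p.1)} := isOpen_lt (by fun_prop) (by fun_prop)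
    exact h1.inter h2
  set T : Set ℂ := S ∩ ({z | 0 ≤ (edgeCoord e z).2} ∩ {z | edgeCoord e z ∉ O})
  have hT : IsCompact T := by
    refine hS.inter_right (IsClosed.inter ?_ ?_)
    · exact isClosed_le continuous_const (continuous_snd.comp (continuous_edgeCoord e))
    · exact (hO.preimage (continuous_edgeCoord e)).isClosed_compl
  have hpos : ∀ z ∈ T, 0 < (edgeCoord e z).2 := by
    rintro z ⟨hz1, hz2, hz3⟩
    refine lt_of_le_of_ne hz2 fun h0 => hz3 ?_
    have h1 : cross e z = 0 := by
      rw [← edgeMap_edgeCoord he z, cross_edgeMap, ← h0, mul_zero]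
    obtain ⟨t, ht, rfl⟩ := exists_edgePoint_of_mem_openSegment (hSe z hz1 h1)
    rw [← edgeMap_zero, edgeCoord_edgeMap he]
    have := ht.1
    have := ht.2
    constructor
    · simp only [abs_zero]; positivity
    · simp only [abs_zero]; exact mul_pos hc (by linarith)
  obtain ⟨δ, hδ, h⟩ : ∃ δ > 0, ∀ z ∈ T, δ ≤ (edgeCoord e z).2 := by
    rcases T.eq_empty_or_nonempty with hemp | hne
    · exact ⟨1, one_pos, by simp [hemp]⟩
    · obtain ⟨z₀, hz₀, hmin⟩ := hT.exists_isMinOn hne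
        (continuous_snd.comp (continuous_edgeCoord e)).continuousOn
      exact ⟨_, hpos z₀ hz₀, fun z hz => hmin hz⟩
  refine ⟨δ, hδ, fun t y hy0 hyδ hp hz => ?_⟩
  have := h _ ⟨hz, by rw [mem_ofPred_eq, edgeCoord_edgeMap he]; exact hy0.le, ?_⟩
  · rw [edgeCoord_edgeMap he] at this
    exact absurd this (not_le.2 hyδ)
  · rw [mem_ofPred_eq, edgeCoord_edgeMap he]
    intro hO'
    refine hp ⟨hy0, ?_, ?_⟩
    · have := hO'.1; rwa [abs_of_pos hy0] at this
    · have := hO'.2; rwa [abs_of_pos hy0] at this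

theorem exists_lipschitz_edgeMap {ψ : ℂ → ℝ} (h1 : ContDiff ℝ ∞ ψ) (h2 : HasCompactSupport ψ)
    (e : ℂ × ℂ) :
    ∃ A, ∀ t y, |ψ (edgeMap e (t, y)) - ψ (edgeMap e (t, 0))| ≤ A * |y| := by
  obtain ⟨C, hC⟩ := h1.lipschitzWith_of_hasCompactSupport h2 (by simp)
  refine ⟨C * edgeLength e, fun t y => ?_⟩
  have := hC.dist_le_mul (edgeMap e (t, y)) (edgeMap e (t, 0))
  rw [Real.dist_eq] at this
  refine this.trans (le_of_eq ?_)
  rw [dist_eq_norm]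
  have : edgeMap e (t, y) - edgeMap e (t, 0) = (y : ℂ) * Complex.I * (e.2 - e.1) := by
    simp [edgeMap]; ring
  rw [this, norm_mul, norm_mul]
  simp [edgeLength]
  ring

theorem hasFDerivAt_edgeCoord_snd (e : ℂ × ℂ) (z u : ℂ) :
    ∃ L : ℂ →L[ℝ] ℝ, HasFDerivAt (fun z => (edgeCoord e z).2) L z ∧
      L u = (u / (e.2 - e.1)).im := by
  refine ⟨Complex.imCLM ∘L (ContinuousLinearMap.mul ℝ ℂ (e.2 - e.1)⁻¹), ?_, ?_⟩
  · have h := ((Complex.imCLM ∘L (ContinuousLinearMap.mul ℝ ℂ (e.2 - e.1)⁻¹)).hasFDerivAt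
      (x := z)).sub_const (((e.2 - e.1)⁻¹ * e.1).im)
    refine h.congr_of_eventuallyEq (Eventually.of_forall fun w => ?_)
    simp only [edgeCoord, div_eq_inv_mul, mul_sub, Complex.sub_im]
    rfl
  · simp [div_eq_inv_mul]

theorem contDiff_edgeCoord_snd (e : ℂ × ℂ) : ContDiff ℝ ∞ fun z => (edgeCoord e z).2 := by
  unfold edgeCoord
  exact Complex.imCLM.contDiff.comp ((contDiff_id.sub contDiff_const).div_const _)

theorem contDiff_edgeCoord_fst (e : ℂ × ℂ) : ContDiff ℝ ∞ fun z => (edgeCoord e z).1 := by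
  unfold edgeCoord
  exact Complex.reCLM.contDiff.comp ((contDiff_id.sub contDiff_const).div_const _)

/-- The cutoff removes the part of the support near the line of the edge and below it; what is left
of the support of `ψ` is inside the domain. -/
theorem PolygonalDomain.isTest_mul_smoothStep (K : PolygonalDomain) {e : ℂ × ℂ}
    (he : e ∈ K.edges) {ψ : ℂ → ℝ} (h1 : ContDiff ℝ ∞ ψ) (h2 : HasCompactSupport ψ)
    (h3 : tsupport ψ ∩ {z | 0 ≤ cross e z} ⊆
      (K.carrier ∩ {z | 0 < cross e z}) ∪ openSegment ℝ e.1 e.2) {ε : ℝ} (hε : 0 < ε) :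
    IsTest K.carrier fun z => ψ z * smoothStep ε (edgeCoord e z).2 := by
  have hne := K.edge_ne e he
  refine ⟨h1.mul ((contDiff_smoothStep ε).comp (contDiff_edgeCoord_snd e)), h2.mul_right,
    fun z hz => ?_⟩
  have hz1 : z ∈ tsupport ψ := tsupport_mul_subset_left hz
  have hz2 : ε ≤ (edgeCoord e z).2 := by
    have hcl : IsClosed {z | ε ≤ (edgeCoord e z).2} :=
      isClosed_le continuous_const (continuous_snd.comp (continuous_edgeCoord e))
    refine closure_minimal (fun w hw => ?_) hcl hz
    by_contra hcon
    exact hw (by simp [smoothStep_eq_zero hε (not_le.1 hcon).le])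
  have hz3 : 0 < cross e z := by
    rw [← edgeMap_edgeCoord hne z, cross_edgeMap_pos hne]
    exact hε.trans_le hz2
  rcases h3 ⟨hz1, hz3.le⟩ with h | h
  · exact h.1
  · rw [cross_segment (openSegment_subset_segment _ _ _ h)] at hz3
    exact absurd hz3 (lt_irrefl 0)

theorem fderiv_mul_smoothStep {ψ : ℂ → ℝ} (h1 : ContDiff ℝ ∞ ψ) (e : ℂ × ℂ) (ε : ℝ) (z u : ℂ) :
    fderiv ℝ (fun z => ψ z * smoothStep ε (edgeCoord e z).2) z u =
      smoothStep ε (edgeCoord e z).2 * fderiv ℝ ψ z u +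
        ψ z * smoothStepDeriv ε (edgeCoord e z).2 * (u / (e.2 - e.1)).im := by
  obtain ⟨L, hL, hu⟩ := hasFDerivAt_edgeCoord_snd e z u
  have hd := ((h1.differentiable (by simp)) z).hasFDerivAt.mul
    ((hasDerivAt_smoothStep ε (edgeCoord e z).2).comp_hasFDerivAt z hL)
  have h := hd.fderiv
  simp only [Function.comp_def] at h
  change (fderiv ℝ ((ψ * fun x => smoothStep ε (edgeCoord e x).2)) z) u = _
  rw [h]
  simp only [_root_.add_apply, _root_.smul_apply, smul_eq_mul, hu]
  ring

/-- The weak gradient is tested against `ψ` times a smooth step in the distance to the edge. As the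
step sharpens, the term with its derivative, an approximate identity concentrating on the edge,
converges to the boundary integral. -/
theorem IsSobolev.green_of_bound {K : PolygonalDomain} {e : ℂ × ℂ} (he : e ∈ K.edges) {c : ℝ}
    (hc : 0 < c) {w : ℂ → ℝ} {G : ℂ → ℂ} (hw : IsSobolev K.carrier w G) {τ : ℝ → ℝ} (hτ : IntegrableOn τ (Ioo 0 1))
    {γ : ℝ × ℝ → ENNReal} (hγ : Measurable γ) (hγi : ∫⁻ p, γ p ≠ ⊤)
    (hb : ∀ᵐ p : ℝ × ℝ, p ∈ edgeRegion c →
      ‖w (edgeMap e p) - τ p.1‖ₑ ≤ ∫⁻ s in Ioo 0 p.2, γ (p.1, s))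
    (hw0 : ∀ z ∉ K.carrier, w z = 0) (hG0 : ∀ z ∉ K.carrier, G z = 0)
    {ψ : ℂ → ℝ} (h1 : ContDiff ℝ ∞ ψ) (h2 : HasCompactSupport ψ)
    (h3 : tsupport ψ ∩ {z | 0 ≤ cross e z} ⊆
      (K.carrier ∩ {z | 0 < cross e z}) ∪ openSegment ℝ e.1 e.2) (u : ℂ) :
    ∫ z in K.carrier ∩ {z | 0 < cross e z}, (w z * fderiv ℝ ψ z u + ⟪G z, u⟫ * ψ z) =
      ⟪outwardNormal e, u⟫ * edgeIntegral e fun t => τ t * ψ (edgePoint e t) := by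
  have hne := K.edge_ne e he
  have hLpos := edgeLength_pos hne
  set Y : ℂ → ℝ := fun z => (edgeCoord e z).2 with hY
  have hYc : Continuous Y := continuous_snd.comp (continuous_edgeCoord e)
  set F : ℂ → ℝ := fun z => w z * fderiv ℝ ψ z u + ⟪G z, u⟫ * ψ z with hF
  have hψL : MemLp ψ 2 volume := h1.continuous.memLp_of_hasCompactSupport h2
  have hdL : MemLp (fun z => fderiv ℝ ψ z u) 2 volume :=
    ((h1.continuous_fderiv (by simp)).clm_apply continuous_const).memLp_of_hasCompactSupport
      (h2.fderiv_apply ℝ u)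
  have hGu := memLp_inner_const hw.memLpG u
  have iF1 : Integrable (fun z => w z * fderiv ℝ ψ z u) volume := hw.memLp.integrable_mul hdL
  have iF2 : Integrable (fun z => ⟪G z, u⟫ * ψ z) volume := hGu.integrable_mul hψL
  have iF : Integrable F volume := iF1.add iF2
  have hYpos : ∀ z, 0 < cross e z ↔ 0 < Y z := fun z => by
    conv_lhs => rw [← edgeMap_edgeCoord hne z]
    rw [cross_edgeMap_pos hne]
  have hSm : MeasurableSet (K.carrier ∩ {z | 0 < cross e z}) :=
    (K.isOpen.inter (isOpen_lt continuous_const (continuous_cross e))).measurableSet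
  have hF0 : ∀ z ∉ K.carrier, F z = 0 := fun z hz => by simp [hF, hw0 z hz, hG0 z hz]
  -- the identity for the truncated test function
  have key : ∀ ε > 0, ∫ z in K.carrier ∩ {z | 0 < cross e z}, smoothStep ε (Y z) * F z =
      -(u / (e.2 - e.1)).im * (edgeLength e ^ 2 *
        ∫ p, w (edgeMap e p) * ψ (edgeMap e p) * smoothStepDeriv ε p.2) := by
    intro ε hε
    have hst : ∀ᵐ z, ‖smoothStep ε (Y z)‖ ≤ 1 :=
      Eventually.of_forall fun z => abs_smoothStep_le_one ε _
    have hsm : AEStronglyMeasurable (fun z => smoothStep ε (Y z)) volume :=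
      ((contDiff_smoothStep ε).continuous.comp hYc).aestronglyMeasurable
    have hψs : HasCompactSupport fun z => ψ z * smoothStepDeriv ε (Y z) := h2.mul_right
    have hψs2 : MemLp (fun z => ψ z * smoothStepDeriv ε (Y z)) 2 volume :=
      (h1.continuous.mul ((continuous_smoothStepDeriv ε).comp hYc)).memLp_of_hasCompactSupport hψs
    have i3 : Integrable (fun z => w z * (ψ z * smoothStepDeriv ε (Y z))) volume :=
      hw.memLp.integrable_mul hψs2
    have i4 := iF1.bdd_mul (c := 1) hsm hst
    have i5 := iF2.bdd_mul (c := 1) hsm hst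
    have hweak := hw.weak _ (K.isTest_mul_smoothStep he h1 h2 h3 hε) u
    simp only [fderiv_mul_smoothStep h1] at hweak
    have e1 : ∫ z, w z * (smoothStep ε (Y z) * fderiv ℝ ψ z u +
        ψ z * smoothStepDeriv ε (Y z) * (u / (e.2 - e.1)).im) =
        (∫ z, smoothStep ε (Y z) * (w z * fderiv ℝ ψ z u)) +
          (u / (e.2 - e.1)).im * ∫ z, w z * (ψ z * smoothStepDeriv ε (Y z)) := by
      rw [← integral_const_mul, ← integral_add i4 (i3.const_mul _)]
      exact integral_congr_ae (Eventually.of_forall fun z => by simp only; ring)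
    have e2 : ∫ z, ⟪G z, u⟫ * (ψ z * smoothStep ε (Y z)) =
        ∫ z, smoothStep ε (Y z) * (⟪G z, u⟫ * ψ z) :=
      integral_congr_ae (Eventually.of_forall fun z => by simp only; ring)
    have e3 : ∫ z in K.carrier ∩ {z | 0 < cross e z}, smoothStep ε (Y z) * F z =
        (∫ z, smoothStep ε (Y z) * (w z * fderiv ℝ ψ z u)) +
          ∫ z, smoothStep ε (Y z) * (⟪G z, u⟫ * ψ z) := by
      rw [← integral_add i4 i5, setIntegral_eq_integral_of_forall_compl_eq_zero]
      · exact integral_congr_ae (Eventually.of_forall fun z => by simp only [hF]; ring)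
      · intro z hz
        by_cases hzK : z ∈ K.carrier
        · rw [smoothStep_eq_zero hε, zero_mul]
          have : ¬ 0 < Y z := fun h => hz ⟨hzK, (hYpos z).2 h⟩
          linarith
        · rw [hF0 z hzK, mul_zero]
    have e4 : edgeLength e ^ 2 *
        ∫ p, w (edgeMap e p) * ψ (edgeMap e p) * smoothStepDeriv ε p.2 =
        ∫ z, w z * (ψ z * smoothStepDeriv ε (Y z)) := by
      rw [integral_edgeMap hne]
      simp only [hY, edgeCoord_edgeMap hne, mul_assoc]
    rw [e3, e4]
    change ∫ z, w z * (smoothStep ε (Y z) * fderiv ℝ ψ z u +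
      ψ z * smoothStepDeriv ε (Y z) * (u / (e.2 - e.1)).im) =
      -∫ z, ⟪G z, u⟫ * (ψ z * smoothStep ε (Y z)) at hweak
    rw [e1, e2] at hweak
    linarith
  -- limits
  obtain ⟨A, hA⟩ := exists_lipschitz_edgeMap h1 h2 e
  obtain ⟨δ, hδ, hstrip⟩ := exists_strip hc hne (S := tsupport ψ) h2 fun z hz h0 => by
    rcases h3 ⟨hz, h0.ge⟩ with h | h
    · exact absurd h.2 (by simp [h0])
    · exact h
  have hψδ : ∀ t y, 0 < y → y < δ → (t, y) ∉ edgeRegion c → ψ (edgeMap e (t, y)) = 0 :=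
    fun t y h h' h'' => image_eq_zero_of_notMem_tsupport (hstrip t y h h' h'')
  have hL1 : Tendsto (fun ε => ∫ z in K.carrier ∩ {z | 0 < cross e z}, smoothStep ε (Y z) * F z)
      (𝓝[>] 0) (𝓝 (∫ z in K.carrier ∩ {z | 0 < cross e z}, F z)) := by
    refine tendsto_integral_filter_of_dominated_convergence (fun z => ‖F z‖)
      (Eventually.of_forall fun ε => ?_) (Eventually.of_forall fun ε => ?_)
      iF.norm.restrict ?_
    · exact (((contDiff_smoothStep ε).continuous.comp hYc).aestronglyMeasurable.mul
        iF.aestronglyMeasurable).restrict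
    · refine Eventually.of_forall fun z => ?_
      rw [norm_mul]
      exact mul_le_of_le_one_left (norm_nonneg _) (abs_smoothStep_le_one ε _)
    · filter_upwards [ae_restrict_mem hSm] with z hz
      refine tendsto_const_nhds.congr' ?_
      filter_upwards [Ioo_mem_nhdsGT (half_pos ((hYpos z).1 hz.2))] with ε hε
      rw [smoothStep_eq_one hε.1 (by have := hε.2; linarith), one_mul]
  have hL2 := tendsto_integral_smoothStepDeriv hc hγ hγi (memLp_edgeMap hne hw.memLp) hτ hb
    (ψ := fun p => ψ (edgeMap e p)) (h1.continuous.comp (continuous_edgeMap e))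
    (h2.comp_homeomorph (edgeHomeo e hne)) hδ hA hψδ
  -- The integral over the plane reduces to the triangle: the kernel lives between heights `ε` and
  -- `2 * ε < δ`, where `ψ` vanishes off the triangle.
  have hL3 : Tendsto (fun ε => -(u / (e.2 - e.1)).im * (edgeLength e ^ 2 *
      ∫ p in edgeRegion c, w (edgeMap e p) * ψ (edgeMap e p) * smoothStepDeriv ε p.2))
      (𝓝[>] 0) (𝓝 (∫ z in K.carrier ∩ {z | 0 < cross e z}, F z)) := by
    refine hL1.congr' ?_
    filter_upwards [Ioo_mem_nhdsGT (half_pos hδ)] with ε hε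
    rw [key ε hε.1]
    congr 2
    symm
    refine setIntegral_eq_integral_of_forall_compl_eq_zero fun p hp => ?_
    by_cases hp1 : p.2 ≤ ε ∨ 2 * ε ≤ p.2
    · rw [smoothStepDeriv_eq_zero hε.1 hp1, mul_zero]
    · push Not at hp1
      have := hε.1
      have := hε.2
      rw [hψδ p.1 p.2 (by linarith) (by linarith) hp]
      ring
  have := tendsto_nhds_unique hL3 ((hL2.const_mul (edgeLength e ^ 2)).const_mul _)
  rw [this, outwardNormal_inner hne, edgeIntegral]
  simp only [edgeMap_zero]
  ring

/-- A criterion for `τ` to be the trace of `w`. -/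
theorem HasWeakGrad.isTrace_of_bound {K : PolygonalDomain} {e : ℂ × ℂ} (he : e ∈ K.edges) {c : ℝ}
    (hc : 0 < c) (hR : ∀ p ∈ edgeRegion c, edgeMap e p ∈ K.carrier) {w : ℂ → ℝ} {G : ℂ → ℂ}
    (hw : HasWeakGrad K w G) {τ : ℝ → ℝ} (hτ : MemLp τ 2 (volume.restrict (Ioo (0 : ℝ) 1)))
    {γ : ℝ × ℝ → ENNReal} (hγ : Measurable γ) (hγi : ∫⁻ p, γ p ≠ ⊤)
    (hb : ∀ᵐ p : ℝ × ℝ, p ∈ edgeRegion c →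
      ‖w (edgeMap e p) - τ p.1‖ₑ ≤ ∫⁻ s in Ioo 0 p.2, γ (p.1, s)) :
    IsTrace K e w τ := by
  refine ⟨hτ, G, hw, fun ψ h1 h2 h3 u => ?_⟩
  obtain ⟨w', G', hw', ew, eG, hw0, hG0⟩ := hw.exists_isSobolev
  have hsub : K.carrier ∩ {z | 0 < cross e z} ⊆ K.carrier := inter_subset_left
  have hb' : ∀ᵐ p : ℝ × ℝ, p ∈ edgeRegion c →
      ‖w' (edgeMap e p) - τ p.1‖ₑ ≤ ∫⁻ s in Ioo 0 p.2, γ (p.1, s) := by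
    have ew' := (quasiMeasurePreserving_edgeMap (K.edge_ne e he)).ae
      ((ae_restrict_iff' K.isOpen.measurableSet).1 ew)
    filter_upwards [hb, ew'] with p hp hp' hpR
    rw [← hp' (hR p hpR)]
    exact hp hpR
  rw [← hw'.green_of_bound he hc (hτ.integrable (by norm_num)) hγ hγi hb' hw0 hG0 h1 h2 h3 u]
  refine integral_congr_ae ?_
  filter_upwards [ae_restrict_of_ae_restrict_of_subset hsub ew,
    ae_restrict_of_ae_restrict_of_subset hsub eG] with z hz1 hz2
  rw [hz1, hz2]

/-! ### Existence of traces -/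

theorem IsSobolev.ae_edgeMap {U : Set ℂ} {w : ℂ → ℝ} {G : ℂ → ℂ} (hw : IsSobolev U w G)
    {e : ℂ × ℂ} (he : e.1 ≠ e.2) {c : ℝ} (hR : ∀ p ∈ edgeRegion c, edgeMap e p ∈ U)
    (v : ℝ × ℝ) :
    ∀ᵐ p : ℝ × ℝ, p ∈ edgeRegion c → p + v ∈ edgeRegion c →
      w (edgeMap e (p + v)) - w (edgeMap e p) = ∫ s in (0 : ℝ)..1,
        ⟪G (edgeMap e (p + s • v)), ((v.1 : ℂ) + v.2 * Complex.I) * (e.2 - e.1)⟫ := by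
  set h : ℂ := ((v.1 : ℂ) + v.2 * Complex.I) * (e.2 - e.1)
  have hadd : ∀ p : ℝ × ℝ, ∀ s : ℝ, edgeMap e (p + s • v) = edgeMap e p + s • h := by
    intro p s
    simp only [edgeMap, h, Prod.fst_add, Prod.snd_add, Prod.smul_fst, Prod.smul_snd, smul_eq_mul,
      Complex.real_smul]
    push_cast
    ring
  -- Both end points in the convex triangle force the whole segment into `U`, as `ae_segment`
  -- requires.
  set W : Set ℂ := {z | edgeCoord e z ∈ edgeRegion c ∧ edgeCoord e z + v ∈ edgeRegion c}
  have hW : IsOpen W := by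
    have h1 : IsOpen {z | edgeCoord e z ∈ edgeRegion c} :=
      (isOpen_edgeRegion c).preimage (continuous_edgeCoord e)
    have h2 : IsOpen {z | edgeCoord e z + v ∈ edgeRegion c} :=
      (isOpen_edgeRegion c).preimage ((continuous_edgeCoord e).add continuous_const)
    exact h1.inter h2
  have hseg : ∀ x ∈ W, ∀ s ∈ Icc (0 : ℝ) 1, x + s • h ∈ U := by
    intro x hx s hs
    rw [← edgeMap_edgeCoord he x, ← hadd]
    apply hR
    have := convex_edgeRegion c hx.1 hx.2 (sub_nonneg.2 hs.2) hs.1 (by ring)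
    convert this using 1
    module
  have := (quasiMeasurePreserving_edgeMap he).ae (hw.ae_segment hW h hseg)
  filter_upwards [this] with p hp h1 h2
  have h3 := hp ⟨by rwa [edgeCoord_edgeMap he], by rwa [edgeCoord_edgeMap he]⟩
  have h4 := hadd p 1
  rw [one_smul, one_smul] at h4
  rw [h4, h3]
  simp only [hadd]

theorem intervalIntegral_zero_one_mul (φ : ℝ → ℝ) (a v : ℝ) :
    ∫ s in (0 : ℝ)..1, φ (a + s * v) * v = ∫ s in a..a + v, φ s := by
  have := intervalIntegral.smul_integral_comp_mul_add (a := 0) (b := 1) φ v a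
  rw [intervalIntegral.integral_mul_const, mul_comm]
  simp only [smul_eq_mul, mul_zero, mul_one, zero_add] at this
  rw [add_comm a v, ← this]
  congr 2
  ext s
  ring_nf

/-- In edge coordinates: `τ` is the trace of `f`, whose partial derivatives are `g₁` and `g₂`. -/
structure HasEdgeTrace (c : ℝ) (f g₁ g₂ : ℝ × ℝ → ℝ) (τ : ℝ → ℝ) : Prop where
  meas : Measurable f
  meas₁ : Measurable g₁
  meas₂ : Measurable g₂
  measτ : Measurable τ
  vert : ∀ᵐ p : ℝ × ℝ, p ∈ edgeRegion c → f p = τ p.1 + ∫ s in (0 : ℝ)..p.2, g₂ (p.1, s)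
  horiz : ∀ v : ℝ, ∀ᵐ p : ℝ × ℝ, p ∈ edgeRegion c → (p.1 + v, p.2) ∈ edgeRegion c →
    f (p.1 + v, p.2) - f p = ∫ s in p.1..p.1 + v, g₁ (s, p.2)

theorem ae_intervalIntegrable_slice {g : ℝ × ℝ → ℝ} (hg : MemLp g 2 volume) :
    ∀ᵐ t : ℝ, ∀ a b : ℝ, IntervalIntegrable (fun s => g (t, s)) volume a b := by
  have h : Integrable (fun p => g p ^ 2) (volume.prod volume : Measure (ℝ × ℝ)) :=
    hg.integrable_sq
  have hm := hg.aestronglyMeasurable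
  rw [Measure.volume_eq_prod] at hm
  filter_upwards [h.prod_right_ae, hm.prodMk_left] with t ht htm a b
  have h2 : MemLp (fun s => g (t, s)) 2 volume := (memLp_two_iff_integrable_sq htm).2 ht
  exact ((h2.locallyIntegrable (by norm_num)).integrableOn_isCompact
    isCompact_uIcc).intervalIntegrable

theorem edgeRegion_slice {c t : ℝ} :
    {y | (t, y) ∈ edgeRegion c} = Ioo 0 (min (c * t) (c * (1 - t))) := by
  ext y
  simp [edgeRegion]

/-- Subtracting from `f` its vertical primitive `P` leaves a function `σ` which, for each vertical
shift, is almost everywhere invariant. By Fubini it is almost everywhere constant on vertical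
slices, and this constant is the trace. -/
theorem exists_hasEdgeTrace {c : ℝ} {f g₁ g₂ : ℝ × ℝ → ℝ} (hf : Measurable f)
    (hg₁ : Measurable g₁) (hg₂ : Measurable g₂) (hL : MemLp g₂ 2 volume)
    (hvert : ∀ v : ℝ, ∀ᵐ p : ℝ × ℝ, p ∈ edgeRegion c → (p.1, p.2 + v) ∈ edgeRegion c →
      f (p.1, p.2 + v) - f p = ∫ s in p.2..p.2 + v, g₂ (p.1, s))
    (hhoriz : ∀ v : ℝ, ∀ᵐ p : ℝ × ℝ, p ∈ edgeRegion c → (p.1 + v, p.2) ∈ edgeRegion c →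
      f (p.1 + v, p.2) - f p = ∫ s in p.1..p.1 + v, g₁ (s, p.2)) :
    ∃ τ, HasEdgeTrace c f g₁ g₂ τ := by
  have hRm := (isOpen_edgeRegion c).measurableSet
  set P : ℝ × ℝ → ℝ := fun p => ∫ s, (Ioc 0 p.2).indicator (fun s => g₂ (p.1, s)) s with hP
  have hPm : Measurable P := by
    have h1 : Measurable fun q : (ℝ × ℝ) × ℝ =>
        (Ioc 0 q.1.2).indicator (fun s => g₂ (q.1.1, s)) q.2 := by
      have h2 : (fun q : (ℝ × ℝ) × ℝ => (Ioc 0 q.1.2).indicator (fun s => g₂ (q.1.1, s)) q.2) =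
          {q : (ℝ × ℝ) × ℝ | 0 < q.2 ∧ q.2 ≤ q.1.2}.indicator fun q => g₂ (q.1.1, q.2) := by
        ext q
        simp only [indicator_apply, mem_Ioc, mem_ofPred_eq]
      rw [h2]
      refine (hg₂.comp (by fun_prop)).indicator ?_
      have h3 : MeasurableSet {q : (ℝ × ℝ) × ℝ | 0 < q.2} :=
        measurableSet_lt (by fun_prop) (by fun_prop)
      have h4 : MeasurableSet {q : (ℝ × ℝ) × ℝ | q.2 ≤ q.1.2} :=
        measurableSet_le (by fun_prop) (by fun_prop)
      exact h3.inter h4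
    exact (h1.stronglyMeasurable.integral_prod_right).measurable
  have hPe : ∀ p : ℝ × ℝ, 0 < p.2 → P p = ∫ s in (0 : ℝ)..p.2, g₂ (p.1, s) := by
    intro p hp
    rw [intervalIntegral.integral_of_le hp.le, ← integral_indicator measurableSet_Ioc]
  set σ : ℝ × ℝ → ℝ := fun p => f p - P p with hσ
  have hσm : Measurable σ := hf.sub hPm
  have hint : ∀ᵐ p : ℝ × ℝ, ∀ a b : ℝ,
      IntervalIntegrable (fun s => g₂ (p.1, s)) volume a b :=
    Measure.quasiMeasurePreserving_fst.ae (ae_intervalIntegrable_slice hL)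
  have h1 : ∀ v : ℝ, ∀ᵐ p : ℝ × ℝ, p ∈ edgeRegion c → (p.1, p.2 + v) ∈ edgeRegion c →
      σ (p.1, p.2 + v) = σ p := by
    intro v
    filter_upwards [hvert v, hint] with p hp hi hp1 hp2
    have h2 := hp hp1 hp2
    have h3 := intervalIntegral.integral_add_adjacent_intervals (hi 0 p.2) (hi p.2 (p.2 + v))
    simp only [hσ]
    rw [hPe _ hp1.1, hPe _ hp2.1]
    simp only
    linarith
  -- The exceptional set depends on the shift `v`; joint measurability allows the exchange of "for
  -- all `v`, for almost every `p`" with "for almost every `p`, for almost every `v`".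
  have h2 : ∀ᵐ q : ℝ × (ℝ × ℝ), q.2 ∈ edgeRegion c → (q.2.1, q.2.2 + q.1) ∈ edgeRegion c →
      σ (q.2.1, q.2.2 + q.1) = σ q.2 := by
    rw [Measure.volume_eq_prod]
    refine (Measure.ae_prod_iff_ae_ae ?_).2 (Eventually.of_forall h1)
    have m1 : Measurable fun q : ℝ × (ℝ × ℝ) => (q.2.1, q.2.2 + q.1) := by fun_prop
    have s1 : MeasurableSet {q : ℝ × (ℝ × ℝ) | q.2 ∈ edgeRegion c} := measurable_snd hRm
    have s2 : MeasurableSet {q : ℝ × (ℝ × ℝ) | (q.2.1, q.2.2 + q.1) ∈ edgeRegion c} := m1 hRm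
    have s3 : MeasurableSet {q : ℝ × (ℝ × ℝ) | σ (q.2.1, q.2.2 + q.1) = σ q.2} :=
      measurableSet_eq_fun (hσm.comp m1) (hσm.comp measurable_snd)
    exact s1.imp (s2.imp s3)
  have h3 : ∀ᵐ p : ℝ × ℝ, ∀ᵐ v : ℝ, p ∈ edgeRegion c → (p.1, p.2 + v) ∈ edgeRegion c →
      σ (p.1, p.2 + v) = σ p := by
    have h4 := (Measure.measurePreserving_swap (μ := (volume : Measure (ℝ × ℝ)))
      (ν := (volume : Measure ℝ))).quasiMeasurePreserving.ae h2
    exact Measure.ae_ae_of_ae_prod h4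
  have h4 : ∀ᵐ p : ℝ × ℝ, p ∈ edgeRegion c → ∀ᵐ y : ℝ, (p.1, y) ∈ edgeRegion c →
      σ (p.1, y) = σ p := by
    filter_upwards [h3] with p hp hpR
    have := (measurePreserving_sub_right (volume : Measure ℝ) p.2).quasiMeasurePreserving.ae hp
    filter_upwards [this] with y hy
    simpa using hy hpR
  -- Averaging over the slice, rather than choosing a point of it, makes `τ` measurable.
  set τ : ℝ → ℝ := fun t => (volume.real {y | (t, y) ∈ edgeRegion c})⁻¹ *
    ∫ y, (edgeRegion c).indicator σ (t, y) with hτ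
  refine ⟨τ, hf, hg₁, hg₂, ?_, ?_, hhoriz⟩
  · refine Measurable.mul (Measurable.inv ?_) ?_
    · exact (measurable_measure_prodMk_left hRm).ennreal_toReal
    · exact ((hσm.indicator hRm).stronglyMeasurable.integral_prod_right').measurable
  · filter_upwards [h4] with p hp hpR
    have h5 : σ p = τ p.1 := by
      have h6 : ∀ᵐ y : ℝ, (edgeRegion c).indicator σ (p.1, y) =
          {y | (p.1, y) ∈ edgeRegion c}.indicator (fun _ => σ p) y := by
        filter_upwards [hp hpR] with y hy
        by_cases hyR : (p.1, y) ∈ edgeRegion c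
        · rw [indicator_of_mem hyR, indicator_of_mem (by exact hyR), hy hyR]
        · rw [indicator_of_notMem hyR, indicator_of_notMem (by exact hyR)]
      have hs : MeasurableSet {y | (p.1, y) ∈ edgeRegion c} := measurable_prodMk_left hRm
      have hpos : 0 < volume.real {y | (p.1, y) ∈ edgeRegion c} := by
        rw [edgeRegion_slice, Real.volume_real_Ioo_of_le, sub_zero]
        · exact hpR.1.trans (lt_min hpR.2.1 hpR.2.2)
        · exact (hpR.1.trans (lt_min hpR.2.1 hpR.2.2)).le
      simp only [hτ]
      rw [integral_congr_ae h6, integral_indicator hs, setIntegral_const, smul_eq_mul,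
        inv_mul_cancel_left₀ hpos.ne']
    rw [← h5, ← hPe p hpR.1]
    simp [hσ]

/-- The partial derivatives of `w` in edge coordinates. -/
theorem IsSobolev.exists_hasEdgeTrace {U : Set ℂ} {w : ℂ → ℝ} {G : ℂ → ℂ}
    (hw : IsSobolev U w G) {e : ℂ × ℂ} (he : e.1 ≠ e.2) {c : ℝ}
    (hR : ∀ p ∈ edgeRegion c, edgeMap e p ∈ U) :
    ∃ τ, HasEdgeTrace c (fun p => w (edgeMap e p)) (fun p => ⟪G (edgeMap e p), e.2 - e.1⟫)
      (fun p => ⟪G (edgeMap e p), Complex.I * (e.2 - e.1)⟫) τ := by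
  have hm : Measurable (edgeMap e) := (continuous_edgeMap e).measurable
  have hscal : ∀ (z u : ℂ) (v : ℝ), ⟪z, (v : ℂ) * u⟫ = ⟪z, u⟫ * v := by
    intro z u v
    rw [← Complex.real_smul, real_inner_smul_right, mul_comm]
  refine EVEM.exists_hasEdgeTrace (hw.meas.comp hm) ((hw.measG.comp hm).inner_const)
    ((hw.measG.comp hm).inner_const)
    (memLp_edgeMap he (memLp_inner_const hw.memLpG (Complex.I * (e.2 - e.1)))) ?_ ?_
  · intro v
    filter_upwards [hw.ae_edgeMap he hR (0, v)] with p hp h1 h2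
    have e1 : p + (0, v) = (p.1, p.2 + v) := by ext <;> simp
    rw [e1] at hp
    rw [hp h1 h2, ← intervalIntegral_zero_one_mul]
    refine intervalIntegral.integral_congr fun s _ => ?_
    have e2 : p + s • ((0 : ℝ), v) = (p.1, p.2 + s * v) := by ext <;> simp
    simp only [e2, Complex.ofReal_zero, zero_add, mul_assoc, hscal]
  · intro v
    filter_upwards [hw.ae_edgeMap he hR (v, 0)] with p hp h1 h2
    have e1 : p + (v, 0) = (p.1 + v, p.2) := by ext <;> simp
    rw [e1] at hp
    rw [hp h1 h2, ← intervalIntegral_zero_one_mul]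
    refine intervalIntegral.integral_congr fun s _ => ?_
    have e2 : p + s • (v, (0 : ℝ)) = (p.1 + s * v, p.2) := by ext <;> simp
    simp only [e2, Complex.ofReal_zero, zero_mul, add_zero, hscal]

/-! ### Weighted estimates of traces -/

theorem setLIntegral_fst (u : ℝ → ENNReal) (hu : Measurable u) (S : Set ℝ) (y₀ : ℝ) :
    ∫⁻ p in S ×ˢ Ioo (0 : ℝ) y₀, u p.1 = ENNReal.ofReal y₀ * ∫⁻ t in S, u t := by
  rw [Measure.volume_eq_prod, ← Measure.prod_restrict,
    lintegral_prod _ (by fun_prop : Measurable fun p : ℝ × ℝ => u p.1).aemeasurable]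
  simp only [lintegral_const, Measure.restrict_apply MeasurableSet.univ, univ_inter,
    Real.volume_Ioo, sub_zero]
  rw [lintegral_mul_const _ hu, mul_comm]

theorem setLIntegral_snd (u : ℝ → ENNReal) (hu : Measurable u) (t₁ t₂ : ℝ) (S : Set ℝ) :
    ∫⁻ p in Ioo t₁ t₂ ×ˢ S, u p.2 = ENNReal.ofReal (t₂ - t₁) * ∫⁻ y in S, u y := by
  rw [Measure.volume_eq_prod, ← Measure.prod_restrict,
    lintegral_prod _ (by fun_prop : Measurable fun p : ℝ × ℝ => u p.2).aemeasurable]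
  simp only [lintegral_const, Measure.restrict_apply MeasurableSet.univ, univ_inter,
    Real.volume_Ioo]
  rw [mul_comm]

theorem setLIntegral_comp_add (u : ℝ → ENNReal) (a b v : ℝ) :
    ∫⁻ t in Ioo a b, u (t + v) = ∫⁻ t in Ioo (a + v) (b + v), u t := by
  have := (measurePreserving_add_right (volume : Measure ℝ) v).setLIntegral_comp_preimage_emb
    (measurableEmbedding_addRight v) u (Ioo (a + v) (b + v))
  rw [← this]
  congr 2
  ext t
  simp

namespace HasEdgeTrace

variable {c : ℝ} {f g₁ g₂ : ℝ × ℝ → ℝ} {τ : ℝ → ℝ}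

/-- At each height below `y₀`, `τ` differs from `f` by a vertical integral of `g₂`, bounded by
Cauchy–Schwarz; integrating over the height gives the factor `y₀` on the left. -/
theorem lintegral_sq_le (h : HasEdgeTrace c f g₁ g₂ τ) {t₁ t₂ y₀ : ℝ}
    (hQ : Ioo t₁ t₂ ×ˢ Ioo 0 y₀ ⊆ edgeRegion c) :
    ENNReal.ofReal y₀ * ∫⁻ t in Ioo t₁ t₂, ‖τ t‖ₑ ^ 2 ≤
      2 * (∫⁻ p, ‖f p‖ₑ ^ 2) + 2 * (ENNReal.ofReal y₀ ^ 2 * ∫⁻ p, ‖g₂ p‖ₑ ^ 2) := by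
  have hQm : MeasurableSet (Ioo t₁ t₂ ×ˢ Ioo 0 y₀) := measurableSet_Ioo.prod measurableSet_Ioo
  have m2 : Measurable fun p => ‖g₂ p‖ₑ ^ 2 := h.meas₂.enorm.pow_const 2
  have mf : Measurable fun p => ‖f p‖ₑ ^ 2 := h.meas.enorm.pow_const 2
  set β : ℝ → ENNReal := fun t => ∫⁻ s, ‖g₂ (t, s)‖ₑ ^ 2 with hβ
  have mβ : Measurable β := m2.lintegral_prod_right'
  rw [← setLIntegral_fst _ (h.measτ.enorm.pow_const 2)]
  calc ∫⁻ p in Ioo t₁ t₂ ×ˢ Ioo 0 y₀, ‖τ p.1‖ₑ ^ 2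
      ≤ ∫⁻ p in Ioo t₁ t₂ ×ˢ Ioo 0 y₀, (2 * ‖f p‖ₑ ^ 2 + 2 * (ENNReal.ofReal y₀ * β p.1)) := by
        refine lintegral_mono_ae ?_
        rw [ae_restrict_iff' hQm]
        filter_upwards [h.vert] with p hp hpQ
        have h1 := hp (hQ hpQ)
        have h2 : τ p.1 = f p + -∫ s in (0 : ℝ)..p.2, g₂ (p.1, s) := by linarith
        rw [h2]
        refine (enorm_add_sq_le _ _).trans ?_
        rw [enorm_neg]
        gcongr
        refine (enorm_sq_intervalIntegral_le hpQ.2.1.le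
          (h.meas₂.comp measurable_prodMk_left).aemeasurable).trans ?_
        gcongr
        · have := hpQ.2.2; simpa using this.le
        · exact lintegral_mono' Measure.restrict_le_self le_rfl
    _ = 2 * (∫⁻ p in Ioo t₁ t₂ ×ˢ Ioo 0 y₀, ‖f p‖ₑ ^ 2) +
          2 * (ENNReal.ofReal y₀ * (ENNReal.ofReal y₀ * ∫⁻ t in Ioo t₁ t₂, β t)) := by
        have q : Measurable fun p : ℝ × ℝ => β p.1 := mβ.comp measurable_fst
        rw [lintegral_add_left (mf.const_mul 2), lintegral_const_mul _ mf,
          lintegral_const_mul _ (q.const_mul _), lintegral_const_mul _ q, setLIntegral_fst _ mβ]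
    _ ≤ _ := by
        rw [pow_two, mul_assoc]
        gcongr
        · exact Measure.restrict_le_self
        · refine (lintegral_mono' Measure.restrict_le_self le_rfl).trans (le_of_eq ?_)
          rw [Measure.volume_eq_prod, lintegral_prod _ m2.aemeasurable]

/-- The two boundary points are joined by going up from the edge, across at height `y`, and down
again, and the estimate is integrated over `y`. The constants come from `(a + (b + c))² ≤ 2a² + 4b²
+ 4c²`, the two vertical terms having the same bound. -/
theorem lintegral_sub_sq_le (h : HasEdgeTrace c f g₁ g₂ τ) {t₁ t₂ y₀ v : ℝ} (hv : 0 ≤ v)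
    (hQ : Ioo t₁ t₂ ×ˢ Ioo 0 y₀ ⊆ edgeRegion c)
    (hQ' : Ioo (t₁ + v) (t₂ + v) ×ˢ Ioo 0 y₀ ⊆ edgeRegion c) :
    ENNReal.ofReal y₀ * ∫⁻ t in Ioo t₁ t₂, ‖τ (t + v) - τ t‖ₑ ^ 2 ≤
      2 * (ENNReal.ofReal v * (ENNReal.ofReal (t₂ - t₁) * ∫⁻ p, ‖g₁ p‖ₑ ^ 2)) +
        8 * (ENNReal.ofReal y₀ ^ 2 * ∫⁻ p, ‖g₂ p‖ₑ ^ 2) := by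
  have hQm : MeasurableSet (Ioo t₁ t₂ ×ˢ Ioo 0 y₀) := measurableSet_Ioo.prod measurableSet_Ioo
  have m1 : Measurable fun p => ‖g₁ p‖ₑ ^ 2 := h.meas₁.enorm.pow_const 2
  have m2 : Measurable fun p => ‖g₂ p‖ₑ ^ 2 := h.meas₂.enorm.pow_const 2
  set α : ℝ → ENNReal := fun y => ∫⁻ s, ‖g₁ (s, y)‖ₑ ^ 2 with hα
  set β : ℝ → ENNReal := fun t => ∫⁻ s, ‖g₂ (t, s)‖ₑ ^ 2 with hβ
  have mα : Measurable α := m1.lintegral_prod_left'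
  have mβ : Measurable β := m2.lintegral_prod_right'
  have mβ' : Measurable fun t => β (t + v) := mβ.comp (by fun_prop)
  have mτ : Measurable fun t => ‖τ (t + v) - τ t‖ₑ ^ 2 :=
    ((h.measτ.comp (by fun_prop)).sub h.measτ).enorm.pow_const 2
  have hNα : ∫⁻ y, α y = ∫⁻ p, ‖g₁ p‖ₑ ^ 2 := by
    rw [Measure.volume_eq_prod, lintegral_prod_symm _ m1.aemeasurable]
  have hNβ : ∫⁻ t, β t = ∫⁻ p, ‖g₂ p‖ₑ ^ 2 := by
    rw [Measure.volume_eq_prod, lintegral_prod _ m2.aemeasurable]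
  have hvert' : ∀ᵐ p : ℝ × ℝ, (p.1 + v, p.2) ∈ edgeRegion c →
      f (p.1 + v, p.2) = τ (p.1 + v) + ∫ s in (0 : ℝ)..p.2, g₂ (p.1 + v, s) := by
    have := (measurePreserving_add_right (volume : Measure (ℝ × ℝ))
      (v, (0 : ℝ))).quasiMeasurePreserving.ae h.vert
    filter_upwards [this] with p hp
    have e : p + (v, 0) = (p.1 + v, p.2) := by ext <;> simp
    rwa [e] at hp
  have hg : ∀ t y, 0 < y → y < y₀ →
      ‖∫ s in (0 : ℝ)..y, g₂ (t, s)‖ₑ ^ 2 ≤ ENNReal.ofReal y₀ * β t := by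
    intro t y h1 h2
    refine (enorm_sq_intervalIntegral_le h1.le
      (h.meas₂.comp measurable_prodMk_left).aemeasurable).trans ?_
    gcongr
    · simpa using h2.le
    · exact lintegral_mono' Measure.restrict_le_self le_rfl
  rw [← setLIntegral_fst _ mτ]
  calc ∫⁻ p in Ioo t₁ t₂ ×ˢ Ioo 0 y₀, ‖τ (p.1 + v) - τ p.1‖ₑ ^ 2
      ≤ ∫⁻ p in Ioo t₁ t₂ ×ˢ Ioo 0 y₀, (2 * (ENNReal.ofReal v * α p.2) +
          (4 * (ENNReal.ofReal y₀ * β (p.1 + v)) + 4 * (ENNReal.ofReal y₀ * β p.1))) := by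
        refine lintegral_mono_ae ?_
        rw [ae_restrict_iff' hQm]
        filter_upwards [h.vert, hvert', h.horiz v] with p hp1 hp2 hp3 hpQ
        have hpR := hQ hpQ
        have hpR' : (p.1 + v, p.2) ∈ edgeRegion c :=
          hQ' ⟨⟨by have := hpQ.1.1; simpa using this, by have := hpQ.1.2; simpa using this⟩, hpQ.2⟩
        have h1 := hp1 hpR
        have h2 := hp2 hpR'
        have h3 := hp3 hpR hpR'
        have h4 : τ (p.1 + v) - τ p.1 = (∫ s in p.1..p.1 + v, g₁ (s, p.2)) +
            ((-∫ s in (0 : ℝ)..p.2, g₂ (p.1 + v, s)) + ∫ s in (0 : ℝ)..p.2, g₂ (p.1, s)) := by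
          linarith
        have h5 : ‖∫ s in p.1..p.1 + v, g₁ (s, p.2)‖ₑ ^ 2 ≤ ENNReal.ofReal v * α p.2 := by
          refine (enorm_sq_intervalIntegral_le (by linarith)
            (h.meas₁.comp measurable_prodMk_right).aemeasurable).trans ?_
          rw [add_sub_cancel_left]
          gcongr
          exact lintegral_mono' Measure.restrict_le_self le_rfl
        have h6 := hg (p.1 + v) p.2 hpQ.2.1 hpQ.2.2
        have h7 := hg p.1 p.2 hpQ.2.1 hpQ.2.2
        rw [h4]
        refine (enorm_add_sq_le _ _).trans ?_
        refine add_le_add (by gcongr) ?_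
        calc 2 * ‖(-∫ s in (0 : ℝ)..p.2, g₂ (p.1 + v, s)) + ∫ s in (0 : ℝ)..p.2, g₂ (p.1, s)‖ₑ ^ 2
            ≤ 2 * (2 * ‖∫ s in (0 : ℝ)..p.2, g₂ (p.1 + v, s)‖ₑ ^ 2 +
              2 * ‖∫ s in (0 : ℝ)..p.2, g₂ (p.1, s)‖ₑ ^ 2) := by
              gcongr
              refine (enorm_add_sq_le _ _).trans ?_
              rw [enorm_neg]
          _ ≤ 2 * (2 * (ENNReal.ofReal y₀ * β (p.1 + v)) + 2 * (ENNReal.ofReal y₀ * β p.1)) := by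
              gcongr
          _ = _ := by ring
    _ = 2 * (ENNReal.ofReal v * (ENNReal.ofReal (t₂ - t₁) * ∫⁻ y in Ioo 0 y₀, α y)) +
          (4 * (ENNReal.ofReal y₀ * (ENNReal.ofReal y₀ * ∫⁻ t in Ioo t₁ t₂, β (t + v))) +
            4 * (ENNReal.ofReal y₀ * (ENNReal.ofReal y₀ * ∫⁻ t in Ioo t₁ t₂, β t))) := by
        have q1 : Measurable fun p : ℝ × ℝ => α p.2 := mα.comp measurable_snd
        have q2 : Measurable fun p : ℝ × ℝ => β (p.1 + v) := mβ'.comp measurable_fst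
        have q3 : Measurable fun p : ℝ × ℝ => β p.1 := mβ.comp measurable_fst
        rw [lintegral_add_left ((q1.const_mul _).const_mul _),
          lintegral_add_left ((q2.const_mul _).const_mul _),
          lintegral_const_mul _ (q1.const_mul _), lintegral_const_mul _ q1,
          lintegral_const_mul _ (q2.const_mul _), lintegral_const_mul _ q2,
          lintegral_const_mul _ (q3.const_mul _), lintegral_const_mul _ q3,
          setLIntegral_snd _ mα, setLIntegral_fst _ mβ', setLIntegral_fst _ mβ]
    _ ≤ 2 * (ENNReal.ofReal v * (ENNReal.ofReal (t₂ - t₁) * ∫⁻ p, ‖g₁ p‖ₑ ^ 2)) +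
          (4 * (ENNReal.ofReal y₀ * (ENNReal.ofReal y₀ * ∫⁻ p, ‖g₂ p‖ₑ ^ 2)) +
            4 * (ENNReal.ofReal y₀ * (ENNReal.ofReal y₀ * ∫⁻ p, ‖g₂ p‖ₑ ^ 2))) := by
        gcongr
        · rw [← hNα]; exact lintegral_mono' Measure.restrict_le_self le_rfl
        · rw [← hNβ, ← lintegral_add_right_eq_self β v]
          exact lintegral_mono' Measure.restrict_le_self le_rfl
        · rw [← hNβ]; exact lintegral_mono' Measure.restrict_le_self le_rfl
    _ = _ := by ring

/-- The symmetry `t ↦ 1 - t` of the triangle transfers estimates to the right of a point into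
estimates to its left. -/
theorem reflect (h : HasEdgeTrace c f g₁ g₂ τ) :
    HasEdgeTrace c (fun p => f (1 - p.1, p.2)) (fun p => -g₁ (1 - p.1, p.2))
      (fun p => g₂ (1 - p.1, p.2)) (fun t => τ (1 - t)) := by
  have hm : Measurable fun p : ℝ × ℝ => (1 - p.1, p.2) := by fun_prop
  have hR : ∀ t y : ℝ, (1 - t, y) ∈ edgeRegion c ↔ (t, y) ∈ edgeRegion c := by
    intro t y
    simp only [edgeRegion, mem_ofPred_eq, sub_sub_cancel]
    tauto
  have hq : Measure.QuasiMeasurePreserving (fun p : ℝ × ℝ => (1 - p.1, p.2)) volume volume := by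
    have := ((Measure.measurePreserving_sub_left (volume : Measure ℝ) 1).prod
      (MeasurePreserving.id (volume : Measure ℝ))).quasiMeasurePreserving
    exact this
  refine ⟨h.meas.comp hm, (h.meas₁.comp hm).neg, h.meas₂.comp hm,
    h.measτ.comp (by fun_prop), ?_, fun v => ?_⟩
  · filter_upwards [hq.ae h.vert] with p hp hpR
    exact hp ((hR _ _).2 hpR)
  · filter_upwards [hq.ae (h.horiz (-v))] with p hp h1 h2
    have e : 1 - (p.1 + v) = 1 - p.1 + -v := by ring
    have := hp ((hR _ _).2 h1) (by
      have := (hR (p.1 + v) p.2).2 h2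
      rwa [e] at this)
    simp only [e]
    rw [this, intervalIntegral.integral_neg,
      intervalIntegral.integral_comp_sub_left (fun s => g₁ (s, p.2)) 1,
      intervalIntegral.integral_symm, e]

end HasEdgeTrace

/-- Write `x` as the mean of `x₁` and `x₂` minus the mean of the differences, and apply `(m - d)² ≤
(1 + 1/10) m² + (1 + 10) d²`. The factor `11/20`, only slightly above `1/2`, drives the dyadic
iteration. -/
theorem enorm_sq_average_le (x x₁ x₂ : ℝ) :
    ‖x‖ₑ ^ 2 ≤ ENNReal.ofReal (11 / 20) * (‖x₁‖ₑ ^ 2 + ‖x₂‖ₑ ^ 2) +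
      ENNReal.ofReal (11 / 2) * (‖x₁ - x‖ₑ ^ 2 + ‖x₂ - x‖ₑ ^ 2) := by
  have e : ∀ x : ℝ, ‖x‖ₑ ^ 2 = ENNReal.ofReal (x ^ 2) := fun x => by
    rw [← ofReal_norm, ← ENNReal.ofReal_pow (norm_nonneg _), Real.norm_eq_abs, sq_abs]
  simp only [e]
  rw [← ENNReal.ofReal_add (by positivity) (by positivity),
    ← ENNReal.ofReal_add (by positivity) (by positivity), ← ENNReal.ofReal_mul (by positivity),
    ← ENNReal.ofReal_mul (by positivity), ← ENNReal.ofReal_add (by positivity) (by positivity)]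
  refine ENNReal.ofReal_le_ofReal ?_
  nlinarith [sq_nonneg ((x₁ + x₂) / 2 + 10 * ((x₁ - x) + (x₂ - x)) / 2), sq_nonneg (x₁ - x₂),
    sq_nonneg ((x₁ - x) - (x₂ - x))]

/-- The weight grows by `2 ^ (7/10)` at each halving of the scale while the mass of the trace decays
by `3/5`; the product is less than one. -/
theorem two_rpow_lt : (2 : ℝ) ^ (7 / 10 : ℝ) < 5 / 3 := by
  by_contra hcon
  have h1 : ((5 / 3 : ℝ)) ^ 10 ≤ ((2 : ℝ) ^ (7 / 10 : ℝ)) ^ 10 :=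
    pow_le_pow_left₀ (by norm_num) (not_lt.1 hcon) 10
  rw [← Real.rpow_natCast ((2 : ℝ) ^ (7 / 10 : ℝ)), ← Real.rpow_mul (by norm_num)] at h1
  norm_num at h1

namespace HasEdgeTrace

variable {c : ℝ} {f g₁ g₂ : ℝ × ℝ → ℝ} {τ : ℝ → ℝ}

theorem strip_lintegral_le (h : HasEdgeTrace c f g₁ g₂ τ) {t₁ t₂ y₀ : ℝ} (hy : 0 < y₀)
    (hQ : Ioo t₁ t₂ ×ˢ Ioo 0 y₀ ⊆ edgeRegion c) :
    ∫⁻ t in Ioo t₁ t₂, ‖τ t‖ₑ ^ 2 ≤ ENNReal.ofReal (2 / y₀ + 2 * y₀) *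
      ((∫⁻ p, ‖f p‖ₑ ^ 2) + (∫⁻ p, ‖g₁ p‖ₑ ^ 2) + ∫⁻ p, ‖g₂ p‖ₑ ^ 2) := by
  have h1 := h.lintegral_sq_le hQ
  set E := (∫⁻ p, ‖f p‖ₑ ^ 2) + (∫⁻ p, ‖g₁ p‖ₑ ^ 2) + ∫⁻ p, ‖g₂ p‖ₑ ^ 2
  have h2 : ENNReal.ofReal y₀ * ∫⁻ t in Ioo t₁ t₂, ‖τ t‖ₑ ^ 2 ≤
      ENNReal.ofReal y₀ * (ENNReal.ofReal (2 / y₀ + 2 * y₀) * E) := by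
    refine h1.trans ?_
    calc 2 * (∫⁻ p, ‖f p‖ₑ ^ 2) + 2 * (ENNReal.ofReal y₀ ^ 2 * ∫⁻ p, ‖g₂ p‖ₑ ^ 2)
        ≤ 2 * E + 2 * (ENNReal.ofReal y₀ ^ 2 * E) := by
          gcongr
          · exact le_add_right le_self_add
          · exact le_add_self
      _ = (ENNReal.ofReal 2 + ENNReal.ofReal (2 * y₀ ^ 2)) * E := by
          rw [ENNReal.ofReal_mul (by norm_num), ENNReal.ofReal_pow hy.le]
          simp only [ENNReal.ofReal_ofNat]
          ring
      _ = _ := by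
          rw [← mul_assoc, ← ENNReal.ofReal_mul hy.le, ← ENNReal.ofReal_add (by norm_num)
            (by positivity)]
          congr 2
          field_simp
  exact (ENNReal.mul_le_mul_iff_right (by simpa using hy) ENNReal.ofReal_ne_top).1 h2

/-- Translation estimate for the trace at scale `h`. -/
theorem lintegral_shift_le (h : HasEdgeTrace c f g₁ g₂ τ) (hc : 0 < c) {a r v : ℝ} (ha : 0 ≤ a)
    (hr : 0 < r) (hra : a + 5 * r ≤ 1) (hv : 0 ≤ v) (hv2 : v ≤ 2 * r) :
    ∫⁻ t in Ioo (a + r) (a + 2 * r), ‖τ (t + v) - τ t‖ₑ ^ 2 ≤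
      ENNReal.ofReal ((4 / c + 8 * c) * r) *
        ((∫⁻ p, ‖f p‖ₑ ^ 2) + (∫⁻ p, ‖g₁ p‖ₑ ^ 2) + ∫⁻ p, ‖g₂ p‖ₑ ^ 2) := by
  -- The interval shifted by at most `2 * r` stays at distance at least `r` from both ends of the
  -- edge, so there is room of height `c * r` above it.
  have hbox : ∀ v, 0 ≤ v → v ≤ 2 * r →
      Ioo (a + r + v) (a + 2 * r + v) ×ˢ Ioo 0 (c * r) ⊆ edgeRegion c := by
    rintro v hv hv2 ⟨t, y⟩ ⟨⟨h1, h2⟩, h3, h4⟩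
    simp only at h1 h2 h3 h4
    refine ⟨h3, h4.trans_le ?_, h4.trans_le ?_⟩
    · exact mul_le_mul_of_nonneg_left (by simp only; linarith) hc.le
    · exact mul_le_mul_of_nonneg_left (by simp only; linarith) hc.le
  have hQ := hbox 0 le_rfl (by linarith)
  simp only [add_zero] at hQ
  have h1 := h.lintegral_sub_sq_le hv hQ (hbox v hv hv2)
  set E := (∫⁻ p, ‖f p‖ₑ ^ 2) + (∫⁻ p, ‖g₁ p‖ₑ ^ 2) + ∫⁻ p, ‖g₂ p‖ₑ ^ 2
  have h2 : ENNReal.ofReal (c * r) *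
      ∫⁻ t in Ioo (a + r) (a + 2 * r), ‖τ (t + v) - τ t‖ₑ ^ 2 ≤
      ENNReal.ofReal (c * r) * (ENNReal.ofReal ((4 / c + 8 * c) * r) * E) := by
    refine h1.trans ?_
    have e1 : a + 2 * r - (a + r) = r := by ring
    rw [e1]
    calc 2 * (ENNReal.ofReal v * (ENNReal.ofReal r * ∫⁻ p, ‖g₁ p‖ₑ ^ 2)) +
          8 * (ENNReal.ofReal (c * r) ^ 2 * ∫⁻ p, ‖g₂ p‖ₑ ^ 2)
        ≤ 2 * (ENNReal.ofReal (2 * r) * (ENNReal.ofReal r * E)) +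
          8 * (ENNReal.ofReal (c * r) ^ 2 * E) := by
          gcongr
          · exact le_add_right le_add_self
          · exact le_add_self
      _ = (ENNReal.ofReal (2 * (2 * r * r)) + ENNReal.ofReal (8 * (c * r) ^ 2)) * E := by
          have i1 : ENNReal.ofReal (2 * (2 * r * r)) =
              2 * (ENNReal.ofReal (2 * r) * ENNReal.ofReal r) := by
            rw [ENNReal.ofReal_mul (p := 2) (by norm_num),
              ENNReal.ofReal_mul (p := 2 * r) (by positivity), ENNReal.ofReal_ofNat]
          have i2 : ENNReal.ofReal (8 * (c * r) ^ 2) = 8 * ENNReal.ofReal (c * r) ^ 2 := by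
            rw [ENNReal.ofReal_mul (p := 8) (by norm_num), ENNReal.ofReal_pow (by positivity),
              ENNReal.ofReal_ofNat]
          rw [i1, i2]
          ring
      _ = _ := by
          rw [← mul_assoc (ENNReal.ofReal (c * r)),
            ← ENNReal.ofReal_mul (p := c * r) (by positivity),
            ← ENNReal.ofReal_add (by positivity) (by positivity)]
          congr 2
          field_simp
          ring
  exact (ENNReal.mul_le_mul_iff_right (by simp; positivity) ENNReal.ofReal_ne_top).1 h2

/-- Shifting the interval by `r` and by `2 * r` produces the two halves of the next dyadic interval.
They are disjoint, so the averaging inequality bounds the mass by `11/20` of the mass there, plus an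
error of order `r` from the translation estimates. -/
theorem lintegral_scale_le (h : HasEdgeTrace c f g₁ g₂ τ) (hc : 0 < c) {a r : ℝ} (ha : 0 ≤ a)
    (hr : 0 < r) (hra : a + 5 * r ≤ 1) :
    ∫⁻ t in Ioo (a + r) (a + 2 * r), ‖τ t‖ₑ ^ 2 ≤
      ENNReal.ofReal (11 / 20) * (∫⁻ t in Ioo (a + 2 * r) (a + 4 * r), ‖τ t‖ₑ ^ 2) +
      ENNReal.ofReal (11 * (4 / c + 8 * c) * r) *
        ((∫⁻ p, ‖f p‖ₑ ^ 2) + (∫⁻ p, ‖g₁ p‖ₑ ^ 2) + ∫⁻ p, ‖g₂ p‖ₑ ^ 2) := by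
  have s1 := h.lintegral_shift_le hc ha hr hra hr.le (by linarith)
  have s2 := h.lintegral_shift_le hc ha hr hra (v := 2 * r) (by positivity) le_rfl
  set E := (∫⁻ p, ‖f p‖ₑ ^ 2) + (∫⁻ p, ‖g₁ p‖ₑ ^ 2) + ∫⁻ p, ‖g₂ p‖ₑ ^ 2
  have mτ : Measurable fun t => ‖τ t‖ₑ ^ 2 := h.measτ.enorm.pow_const 2
  have m1 : ∀ v, Measurable fun t => ‖τ (t + v)‖ₑ ^ 2 := fun v => mτ.comp (by fun_prop)
  have m2 : ∀ v, Measurable fun t => ‖τ (t + v) - τ t‖ₑ ^ 2 := fun v =>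
    ((h.measτ.comp (by fun_prop)).sub h.measτ).enorm.pow_const 2
  have m3 : Measurable fun t => ‖τ (t + r)‖ₑ ^ 2 + ‖τ (t + 2 * r)‖ₑ ^ 2 := (m1 _).add (m1 _)
  have m4 : Measurable fun t => ‖τ (t + r) - τ t‖ₑ ^ 2 + ‖τ (t + 2 * r) - τ t‖ₑ ^ 2 :=
    (m2 _).add (m2 _)
  calc ∫⁻ t in Ioo (a + r) (a + 2 * r), ‖τ t‖ₑ ^ 2
      ≤ ∫⁻ t in Ioo (a + r) (a + 2 * r),
          (ENNReal.ofReal (11 / 20) * (‖τ (t + r)‖ₑ ^ 2 + ‖τ (t + 2 * r)‖ₑ ^ 2) +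
          ENNReal.ofReal (11 / 2) *
            (‖τ (t + r) - τ t‖ₑ ^ 2 + ‖τ (t + 2 * r) - τ t‖ₑ ^ 2)) :=
        lintegral_mono fun t => enorm_sq_average_le _ _ _
    _ = ENNReal.ofReal (11 / 20) * ((∫⁻ t in Ioo (a + r) (a + 2 * r), ‖τ (t + r)‖ₑ ^ 2) +
            ∫⁻ t in Ioo (a + r) (a + 2 * r), ‖τ (t + 2 * r)‖ₑ ^ 2) +
          ENNReal.ofReal (11 / 2) *
            ((∫⁻ t in Ioo (a + r) (a + 2 * r), ‖τ (t + r) - τ t‖ₑ ^ 2) +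
              ∫⁻ t in Ioo (a + r) (a + 2 * r), ‖τ (t + 2 * r) - τ t‖ₑ ^ 2) := by
        rw [lintegral_add_left (m3.const_mul _), lintegral_const_mul _ m3,
          lintegral_const_mul _ m4,
          lintegral_add_left (m1 _), lintegral_add_left (m2 _)]
    _ ≤ ENNReal.ofReal (11 / 20) * (∫⁻ t in Ioo (a + 2 * r) (a + 4 * r), ‖τ t‖ₑ ^ 2) +
          ENNReal.ofReal (11 / 2) * (ENNReal.ofReal ((4 / c + 8 * c) * r) * E +
            ENNReal.ofReal ((4 / c + 8 * c) * r) * E) := by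
        gcongr
        rw [setLIntegral_comp_add (fun t => ‖τ t‖ₑ ^ 2),
          setLIntegral_comp_add (fun t => ‖τ t‖ₑ ^ 2), ← lintegral_union measurableSet_Ioo]
        · refine lintegral_mono_set (union_subset (Ioo_subset_Ioo ?_ ?_) (Ioo_subset_Ioo ?_ ?_))
            <;> linarith
        · rw [Set.disjoint_left]
          intro t h1 h2
          have := h1.2
          have := h2.1
          linarith
    _ = _ := by
        rw [← two_mul, ← mul_assoc, ← mul_assoc]
        congr 2
        have e2 : (2 : ENNReal) = ENNReal.ofReal 2 := by simp
        rw [e2, ← ENNReal.ofReal_mul (by norm_num), ← ENNReal.ofReal_mul (by norm_num)]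
        congr 1
        ring

end HasEdgeTrace

/-- The weighted estimate on the right of a point of the edge. -/
theorem exists_weighted_right {c : ℝ} (hc : 0 < c) {a : ℝ} (ha : 0 ≤ a) (ha1 : a < 1) :
    ∃ C : ENNReal, C ≠ ⊤ ∧ ∀ f g₁ g₂ τ, HasEdgeTrace c f g₁ g₂ τ →
      ∫⁻ t in Ioc a (a + 2 * ((1 - a) / 5)), ‖τ t‖ₑ ^ 2 * ENNReal.ofReal (|t - a| ^ (-(7 / 10 : ℝ))) ≤
        C * ((∫⁻ p, ‖f p‖ₑ ^ 2) + (∫⁻ p, ‖g₁ p‖ₑ ^ 2) + ∫⁻ p, ‖g₂ p‖ₑ ^ 2) := by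
  -- All scales `r ≤ l` then satisfy `a + 5 * r ≤ 1`.
  set l := (1 - a) / 5 with hl
  have hl0 : 0 < l := by rw [hl]; linarith
  set B₀ := 2 / (c * l) + 2 * (c * l) with hB₀
  set D := 11 * (4 / c + 8 * c) * l with hD
  -- `B₀` starts the induction on scales. The term `10 * D` closes it: `11/20 * B + D/2 ≤ 3/5 * B`
  -- as soon as `10 * D ≤ B`.
  set B := B₀ + 10 * D with hB
  have hB₀0 : 0 < B₀ := by positivity
  have hD0 : 0 < D := by positivity
  have hB0 : 0 < B := by positivity
  set q : ℝ := (2 : ℝ) ^ (7 / 10 : ℝ) * (3 / 5) with hq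
  have hq0 : 0 < q := by positivity
  have hq1 : q < 1 := by have := two_rpow_lt; rw [hq]; linarith
  have hBD : 10 * D ≤ B := by linarith
  have hBB : B₀ ≤ B := by linarith
  clear_value B
  set L : ℝ := l ^ (-(7 / 10 : ℝ)) with hL
  have hL0 : 0 < L := by positivity
  refine ⟨∑' k : ℕ, ENNReal.ofReal (L * B * q ^ k), ?_, fun f g₁ g₂ τ h => ?_⟩
  · rw [← ENNReal.ofReal_tsum_of_nonneg (fun k => by positivity)
      ((summable_geometric_of_lt_one hq0.le hq1).mul_left _)]
    exact ENNReal.ofReal_ne_top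
  set E := (∫⁻ p, ‖f p‖ₑ ^ 2) + (∫⁻ p, ‖g₁ p‖ₑ ^ 2) + ∫⁻ p, ‖g₂ p‖ₑ ^ 2
  -- The mass on the dyadic interval of length `l / 2 ^ k` decays like `(3/5) ^ k`, slower than its
  -- length but fast enough to beat the weight.
  have key : ∀ k : ℕ, ∫⁻ t in Ioo (a + l / 2 ^ k) (a + 2 * (l / 2 ^ k)), ‖τ t‖ₑ ^ 2 ≤
      ENNReal.ofReal (B * (3 / 5) ^ k) * E := by
    intro k
    induction k with
    | zero =>
      simp only [pow_zero, div_one, mul_one]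
      refine (h.strip_lintegral_le (y₀ := c * l) (by positivity) ?_).trans ?_
      · rintro ⟨t, y⟩ ⟨⟨h1, h2⟩, h3, h4⟩
        simp only at h1 h2 h3 h4
        refine ⟨h3, h4.trans_le ?_, h4.trans_le ?_⟩
        · exact mul_le_mul_of_nonneg_left (by simp only; linarith) hc.le
        · exact mul_le_mul_of_nonneg_left (by simp only; linarith) hc.le
      · gcongr
    | succ k ih =>
      have hr0 : 0 < l / 2 ^ (k + 1) := by positivity
      have hr1 : l / 2 ^ (k + 1) ≤ l := div_le_self hl0.le (one_le_pow₀ (by norm_num))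
      have h1 := h.lintegral_scale_le hc ha hr0 (by linarith)
      have e1 : a + 2 * (l / 2 ^ (k + 1)) = a + l / 2 ^ k := by rw [pow_succ]; field_simp
      have e2 : a + 4 * (l / 2 ^ (k + 1)) = a + 2 * (l / 2 ^ k) := by
        rw [pow_succ]; field_simp; ring
      rw [e2] at h1
      nth_rewrite 2 [e1] at h1
      refine h1.trans ?_
      calc ENNReal.ofReal (11 / 20) *
            (∫⁻ t in Ioo (a + l / 2 ^ k) (a + 2 * (l / 2 ^ k)), ‖τ t‖ₑ ^ 2) +
            ENNReal.ofReal (11 * (4 / c + 8 * c) * (l / 2 ^ (k + 1))) * E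
          ≤ ENNReal.ofReal (11 / 20) * (ENNReal.ofReal (B * (3 / 5) ^ k) * E) +
            ENNReal.ofReal (D / 2 ^ (k + 1)) * E := by
            gcongr
            rw [hD]
            exact le_of_eq (by ring)
        _ = ENNReal.ofReal (11 / 20 * (B * (3 / 5) ^ k) + D / 2 ^ (k + 1)) * E := by
            rw [ENNReal.ofReal_add (by positivity) (by positivity), add_mul,
              ENNReal.ofReal_mul (p := 11 / 20) (q := B * (3 / 5) ^ k) (by norm_num),
              mul_assoc (ENNReal.ofReal (11 / 20))]
        _ ≤ _ := by
            gcongr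
            have h2 : D / 2 ^ (k + 1) ≤ D / 2 * (3 / 5) ^ k := by
              rw [pow_succ, div_mul_eq_div_div_swap, div_eq_mul_inv (D / 2), ← inv_pow]
              gcongr
              norm_num
            have h3 : 10 * D * (3 / 5 : ℝ) ^ k ≤ B * (3 / 5) ^ k := by gcongr
            have h4 : (3 / 5 : ℝ) ^ (k + 1) = (3 / 5) ^ k * (3 / 5) := pow_succ _ _
            rw [h4]
            linarith
  -- The half-open intervals cover every point; they differ from the open ones by null sets.
  have hcov : Ioc a (a + 2 * l) ⊆ ⋃ k : ℕ, Ioc (a + l / 2 ^ k) (a + 2 * (l / 2 ^ k)) := by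
    intro t ht
    obtain ⟨k, h1, h2⟩ := exists_nat_pow_near_of_lt_one (x := (t - a) / (2 * l)) (y := 1 / 2)
      (by have := ht.1; apply div_pos <;> linarith)
      (by rw [div_le_one (by positivity)]; have := ht.2; linarith) (by norm_num) (by norm_num)
    rw [lt_div_iff₀ (by positivity)] at h1
    rw [div_le_iff₀ (by positivity)] at h2
    refine mem_iUnion.2 ⟨k, ?_, ?_⟩
    · have : (1 / 2 : ℝ) ^ (k + 1) * (2 * l) = l / 2 ^ k := by
        rw [pow_succ, one_div, inv_pow]; field_simp
      linarith
    · have : (1 / 2 : ℝ) ^ k * (2 * l) = 2 * (l / 2 ^ k) := by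
        rw [one_div, inv_pow]; field_simp
      linarith
  refine (lintegral_mono_set hcov).trans ((lintegral_iUnion_le _ _).trans ?_)
  rw [← ENNReal.tsum_mul_right]
  refine ENNReal.tsum_le_tsum fun k => ?_
  have hr0 : 0 < l / 2 ^ k := by positivity
  calc ∫⁻ t in Ioc (a + l / 2 ^ k) (a + 2 * (l / 2 ^ k)),
        ‖τ t‖ₑ ^ 2 * ENNReal.ofReal (|t - a| ^ (-(7 / 10 : ℝ)))
      ≤ ∫⁻ t in Ioc (a + l / 2 ^ k) (a + 2 * (l / 2 ^ k)),
        ‖τ t‖ₑ ^ 2 * ENNReal.ofReal ((l / 2 ^ k) ^ (-(7 / 10 : ℝ))) := by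
        refine setLIntegral_mono' measurableSet_Ioc fun t ht => ?_
        have h1 : l / 2 ^ k ≤ t - a := by have := ht.1; linarith
        refine mul_le_mul' le_rfl (ENNReal.ofReal_le_ofReal ?_)
        rw [abs_of_pos (hr0.trans_le h1)]
        exact Real.rpow_le_rpow_of_nonpos hr0 h1 (by norm_num)
    _ = (∫⁻ t in Ioo (a + l / 2 ^ k) (a + 2 * (l / 2 ^ k)), ‖τ t‖ₑ ^ 2) *
        ENNReal.ofReal ((l / 2 ^ k) ^ (-(7 / 10 : ℝ))) := by
        rw [lintegral_mul_const _ (h.measτ.enorm.pow_const 2), restrict_Ioo_eq_restrict_Ioc]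
    _ ≤ ENNReal.ofReal (B * (3 / 5) ^ k) * E *
        ENNReal.ofReal ((l / 2 ^ k) ^ (-(7 / 10 : ℝ))) := by
        gcongr; exact key k
    _ = ENNReal.ofReal (L * B * q ^ k) * E := by
        rw [mul_right_comm, ← ENNReal.ofReal_mul (by positivity)]
        congr 2
        have h2 : ((2 : ℝ) ^ k) ^ (-(7 / 10 : ℝ)) = (((2 : ℝ) ^ (7 / 10 : ℝ)) ^ k)⁻¹ := by
          rw [Real.rpow_neg (by positivity), ← Real.rpow_natCast, ← Real.rpow_mul (by norm_num),
            mul_comm, Real.rpow_mul (by norm_num), Real.rpow_natCast]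
        rw [Real.div_rpow hl0.le (by positivity), h2, hq, mul_pow, hL]
        field_simp

/-- Near `0` the weighted estimate is stronger, because the weight is at least one there; near `1`
it is used after reflection; in the middle the triangle contains a rectangle of fixed height. -/
theorem exists_lintegral_trace_sq_le {c : ℝ} (hc : 0 < c) :
    ∃ C : ENNReal, C ≠ ⊤ ∧ ∀ f g₁ g₂ τ, HasEdgeTrace c f g₁ g₂ τ →
      ∫⁻ t in Ioo (0 : ℝ) 1, ‖τ t‖ₑ ^ 2 ≤
        C * ((∫⁻ p, ‖f p‖ₑ ^ 2) + (∫⁻ p, ‖g₁ p‖ₑ ^ 2) + ∫⁻ p, ‖g₂ p‖ₑ ^ 2) := by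
  obtain ⟨C, hC, h⟩ := exists_weighted_right hc le_rfl one_pos
  have hleft : ∀ f g₁ g₂ τ, HasEdgeTrace c f g₁ g₂ τ → ∫⁻ t in Ioc (0 : ℝ) (2 / 5), ‖τ t‖ₑ ^ 2 ≤
      C * ((∫⁻ p, ‖f p‖ₑ ^ 2) + (∫⁻ p, ‖g₁ p‖ₑ ^ 2) + ∫⁻ p, ‖g₂ p‖ₑ ^ 2) := by
    intro f g₁ g₂ τ ht
    refine le_trans ?_ (h f g₁ g₂ τ ht)
    have e : (0 : ℝ) + 2 * ((1 - 0) / 5) = 2 / 5 := by norm_num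
    rw [e]
    refine setLIntegral_mono' measurableSet_Ioc fun t ht => ?_
    refine le_mul_of_one_le_right' ?_
    rw [ENNReal.one_le_ofReal, sub_zero, abs_of_pos ht.1]
    exact Real.one_le_rpow_of_pos_of_le_one_of_nonpos ht.1 (by have := ht.2; linarith)
      (by norm_num)
  refine ⟨C + C + ENNReal.ofReal (2 / (c / 5) + 2 * (c / 5)), by finiteness,
    fun f g₁ g₂ τ ht => ?_⟩
  have h1 := hleft f g₁ g₂ τ ht
  have h2 := hleft _ _ _ _ ht.reflect
  have h3 := ht.strip_lintegral_le (t₁ := 1 / 5) (t₂ := 4 / 5) (y₀ := c / 5) (by positivity) (by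
    rintro ⟨t, y⟩ ⟨⟨h1, h2⟩, h3, h4⟩
    simp only at h1 h2 h3 h4
    refine ⟨h3, ?_, ?_⟩ <;> simp only <;> nlinarith)
  have hr : ∀ F : ℝ × ℝ → ENNReal, Measurable F → ∫⁻ p : ℝ × ℝ, F (1 - p.1, p.2) = ∫⁻ p, F p := by
    intro F hF
    exact ((Measure.measurePreserving_sub_left (volume : Measure ℝ) 1).prod
      (MeasurePreserving.id (volume : Measure ℝ))).lintegral_comp hF
  simp only [enorm_neg] at h2
  rw [hr (fun p => ‖f p‖ₑ ^ 2) (ht.meas.enorm.pow_const 2),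
    hr (fun p => ‖g₁ p‖ₑ ^ 2) (ht.meas₁.enorm.pow_const 2),
    hr (fun p => ‖g₂ p‖ₑ ^ 2) (ht.meas₂.enorm.pow_const 2)] at h2
  have h4 : ∫⁻ t in Ico (3 / 5 : ℝ) 1, ‖τ t‖ₑ ^ 2 =
      ∫⁻ t in Ioc (0 : ℝ) (2 / 5), ‖τ (1 - t)‖ₑ ^ 2 := by
    rw [← (Measure.measurePreserving_sub_left (volume : Measure ℝ) 1).setLIntegral_comp_preimage
      measurableSet_Ico (ht.measτ.enorm.pow_const 2)]
    congr 2
    ext t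
    simp only [mem_preimage, mem_Ico, mem_Ioc]
    constructor <;> rintro ⟨h1, h2⟩ <;> constructor <;> linarith
  rw [← h4] at h2
  rw [add_mul, add_mul]
  refine le_trans ?_ (add_le_add (add_le_add h1 h2) h3)
  refine (lintegral_mono_set (t := (Ioc 0 (2 / 5) ∪ Ico (3 / 5) 1) ∪ Ioo (1 / 5) (4 / 5)) ?_).trans
    ((lintegral_union_le _ _ _).trans (by gcongr; exact lintegral_union_le _ _ _))
  intro t ht
  by_cases h1 : t ≤ 2 / 5
  · exact Or.inl (Or.inl ⟨ht.1, h1⟩)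
  by_cases h2 : 3 / 5 ≤ t
  · exact Or.inl (Or.inr ⟨h2, ht.2⟩)
  · push Not at h1 h2
    exact Or.inr ⟨by linarith, by linarith⟩

/-- The weighted estimate of the trace, on the right of a point. -/
theorem exists_weighted_right_full {c : ℝ} (hc : 0 < c) {a : ℝ} (ha : 0 ≤ a) (ha1 : a < 1) :
    ∃ C : ENNReal, C ≠ ⊤ ∧ ∀ f g₁ g₂ τ, HasEdgeTrace c f g₁ g₂ τ →
      ∫⁻ t in Ioo a 1, ‖τ t‖ₑ ^ 2 * ENNReal.ofReal (|t - a| ^ (-(7 / 10 : ℝ))) ≤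
        C * ((∫⁻ p, ‖f p‖ₑ ^ 2) + (∫⁻ p, ‖g₁ p‖ₑ ^ 2) + ∫⁻ p, ‖g₂ p‖ₑ ^ 2) := by
  obtain ⟨C, hC, h⟩ := exists_weighted_right hc ha ha1
  obtain ⟨C', hC', h'⟩ := exists_lintegral_trace_sq_le hc
  set l := (1 - a) / 5 with hl
  have hl0 : 0 < l := by rw [hl]; linarith
  refine ⟨C + C' * ENNReal.ofReal ((2 * l) ^ (-(7 / 10 : ℝ))), by finiteness,
    fun f g₁ g₂ τ ht => ?_⟩
  rw [add_mul]
  refine (lintegral_mono_set (t := Ioc a (a + 2 * l) ∪ Ioo (a + 2 * l) 1) ?_).trans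
    ((lintegral_union_le _ _ _).trans (add_le_add (h _ _ _ _ ht) ?_))
  · intro t ht
    by_cases h1 : t ≤ a + 2 * l
    · exact Or.inl ⟨ht.1, h1⟩
    · exact Or.inr ⟨not_le.1 h1, ht.2⟩
  · calc ∫⁻ t in Ioo (a + 2 * l) 1, ‖τ t‖ₑ ^ 2 * ENNReal.ofReal (|t - a| ^ (-(7 / 10 : ℝ)))
        ≤ ∫⁻ t in Ioo (a + 2 * l) 1,
          ‖τ t‖ₑ ^ 2 * ENNReal.ofReal ((2 * l) ^ (-(7 / 10 : ℝ))) := by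
          refine setLIntegral_mono' measurableSet_Ioo fun t ht => ?_
          have h1 : 2 * l ≤ t - a := by have := ht.1; linarith
          refine mul_le_mul' le_rfl (ENNReal.ofReal_le_ofReal ?_)
          rw [abs_of_pos (by linarith)]
          exact Real.rpow_le_rpow_of_nonpos (by positivity) h1 (by norm_num)
      _ = (∫⁻ t in Ioo (a + 2 * l) 1, ‖τ t‖ₑ ^ 2) *
          ENNReal.ofReal ((2 * l) ^ (-(7 / 10 : ℝ))) :=
          lintegral_mul_const _ (ht.measτ.enorm.pow_const 2)
      _ ≤ (∫⁻ t in Ioo (0 : ℝ) 1, ‖τ t‖ₑ ^ 2) * ENNReal.ofReal ((2 * l) ^ (-(7 / 10 : ℝ))) := by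
          gcongr
          linarith
      _ ≤ _ := by
          rw [mul_right_comm]
          gcongr
          exact h' _ _ _ _ ht

/-- The weighted estimate of the trace. -/
theorem exists_weighted {c : ℝ} (hc : 0 < c) {a : ℝ} (ha : 0 ≤ a) (ha1 : a ≤ 1) :
    ∃ C : ENNReal, C ≠ ⊤ ∧ ∀ f g₁ g₂ τ, HasEdgeTrace c f g₁ g₂ τ →
      ∫⁻ t in Ioo (0 : ℝ) 1, ‖τ t‖ₑ ^ 2 * ENNReal.ofReal (|t - a| ^ (-(7 / 10 : ℝ))) ≤
        C * ((∫⁻ p, ‖f p‖ₑ ^ 2) + (∫⁻ p, ‖g₁ p‖ₑ ^ 2) + ∫⁻ p, ‖g₂ p‖ₑ ^ 2) := by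
  have hright : ∀ a : ℝ, 0 ≤ a → a ≤ 1 → ∃ C : ENNReal, C ≠ ⊤ ∧ ∀ f g₁ g₂ τ,
      HasEdgeTrace c f g₁ g₂ τ →
      ∫⁻ t in Ioo a 1, ‖τ t‖ₑ ^ 2 * ENNReal.ofReal (|t - a| ^ (-(7 / 10 : ℝ))) ≤
        C * ((∫⁻ p, ‖f p‖ₑ ^ 2) + (∫⁻ p, ‖g₁ p‖ₑ ^ 2) + ∫⁻ p, ‖g₂ p‖ₑ ^ 2) := by
    intro a ha ha1
    rcases ha1.eq_or_lt with rfl | ha1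
    · exact ⟨0, by simp, fun f g₁ g₂ τ _ => by simp⟩
    · exact exists_weighted_right_full hc ha ha1
  obtain ⟨C, hC, h⟩ := hright a ha ha1
  obtain ⟨C', hC', h'⟩ := hright (1 - a) (by linarith) (by linarith)
  refine ⟨C + C', by finiteness, fun f g₁ g₂ τ ht => ?_⟩
  have h1 := h f g₁ g₂ τ ht
  have h2 := h' _ _ _ _ ht.reflect
  have hr : ∀ F : ℝ × ℝ → ENNReal, Measurable F → ∫⁻ p : ℝ × ℝ, F (1 - p.1, p.2) = ∫⁻ p, F p := by
    intro F hF
    exact ((Measure.measurePreserving_sub_left (volume : Measure ℝ) 1).prod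
      (MeasurePreserving.id (volume : Measure ℝ))).lintegral_comp hF
  simp only [enorm_neg] at h2
  rw [hr (fun p => ‖f p‖ₑ ^ 2) (ht.meas.enorm.pow_const 2),
    hr (fun p => ‖g₁ p‖ₑ ^ 2) (ht.meas₁.enorm.pow_const 2),
    hr (fun p => ‖g₂ p‖ₑ ^ 2) (ht.meas₂.enorm.pow_const 2)] at h2
  have mw : Measurable fun t => ‖τ t‖ₑ ^ 2 * ENNReal.ofReal (|t - a| ^ (-(7 / 10 : ℝ))) := by
    refine (ht.measτ.enorm.pow_const 2).mul (Measurable.ennreal_ofReal ?_)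
    exact Measurable.pow_const (measurable_id.sub_const a).abs _
  have h4 : ∫⁻ t in Ioo 0 a, ‖τ t‖ₑ ^ 2 * ENNReal.ofReal (|t - a| ^ (-(7 / 10 : ℝ))) =
      ∫⁻ t in Ioo (1 - a) 1,
        ‖τ (1 - t)‖ₑ ^ 2 * ENNReal.ofReal (|t - (1 - a)| ^ (-(7 / 10 : ℝ))) := by
    rw [← (Measure.measurePreserving_sub_left (volume : Measure ℝ) 1).setLIntegral_comp_preimage
      measurableSet_Ioo mw]
    have e : ∀ t, |1 - t - a| = |t - (1 - a)| := fun t => by rw [← abs_neg]; ring_nf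
    simp only [e]
    congr 2
    ext t
    simp only [mem_preimage, mem_Ioo]
    constructor <;> rintro ⟨h1, h2⟩ <;> constructor <;> linarith
  rw [← h4] at h2
  rw [add_mul]
  refine le_trans ?_ (add_le_add h1 h2)
  have hcov : (Ioo (0 : ℝ) 1 : Set ℝ) ≤ᵐ[volume] (Ioo a 1 ∪ Ioo 0 a : Set ℝ) := by
    have : ∀ᵐ t : ℝ, t ≠ a := by simp [ae_iff]
    filter_upwards [this] with t hta ht
    rcases lt_or_gt_of_ne hta with h | h
    · exact Or.inr ⟨ht.1, h⟩
    · exact Or.inl ⟨h, ht.2⟩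
  exact (lintegral_mono' (Measure.restrict_mono_ae hcov) le_rfl).trans (lintegral_union_le _ _ _)

/-! ### Existence, bounds and uniqueness of the traces of `H¹(K)` -/

/-- The squared norm of `H¹(K)`. -/
def sobolevSq (K : PolygonalDomain) (w : ℂ → ℝ) (G : ℂ → ℂ) : ENNReal :=
  (∫⁻ z in K.carrier, ‖w z‖ₑ ^ 2) + ∫⁻ z in K.carrier, ‖G z‖ₑ ^ 2

theorem lintegral_enorm_sq_ne_top {α E : Type*} [MeasurableSpace α] {μ : Measure α}
    [NormedAddCommGroup E] {f : α → E} (hf : MemLp f 2 μ) : ∫⁻ x, ‖f x‖ₑ ^ 2 ∂μ ≠ ⊤ := by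
  have h := (eLpNorm_lt_top_iff_lintegral_rpow_enorm_lt_top (by norm_num) (by norm_num)).1 hf.2
  simpa using h.ne

theorem memLp_two_of_lintegral {α E : Type*} [MeasurableSpace α] {μ : Measure α}
    [NormedAddCommGroup E] {f : α → E} (hf : AEStronglyMeasurable f μ)
    (h : ∫⁻ x, ‖f x‖ₑ ^ 2 ∂μ ≠ ⊤) : MemLp f 2 μ := by
  refine ⟨hf, (eLpNorm_lt_top_iff_lintegral_rpow_enorm_lt_top (by norm_num) (by norm_num)).2 ?_⟩
  simpa using h.lt_top

theorem HasWeakGrad.sobolevSq_ne_top {K : PolygonalDomain} {w : ℂ → ℝ} {G : ℂ → ℂ}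
    (h : HasWeakGrad K w G) : sobolevSq K w G ≠ ⊤ :=
  ENNReal.add_ne_top.2 ⟨lintegral_enorm_sq_ne_top h.1, lintegral_enorm_sq_ne_top h.2.1⟩

theorem lintegral_edgeMap_inner_le {e : ℂ × ℂ} (he : e.1 ≠ e.2) (G : ℂ → ℂ) {u : ℂ}
    (hu : ‖u‖ = 1) :
    ∫⁻ p, ‖⟪G (edgeMap e p), u * (e.2 - e.1)⟫‖ₑ ^ 2 ≤ ∫⁻ z, ‖G z‖ₑ ^ 2 := by
  have hL := edgeLength_pos he
  calc ∫⁻ p, ‖⟪G (edgeMap e p), u * (e.2 - e.1)⟫‖ₑ ^ 2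
      ≤ ∫⁻ p, ENNReal.ofReal (edgeLength e ^ 2) * ‖G (edgeMap e p)‖ₑ ^ 2 := by
        refine lintegral_mono fun p => ?_
        rw [ENNReal.ofReal_pow hL.le, ← mul_pow]
        gcongr
        rw [← ofReal_norm, ← ofReal_norm, ← ENNReal.ofReal_mul hL.le]
        refine ENNReal.ofReal_le_ofReal ((norm_inner_le_norm _ _).trans (le_of_eq ?_))
        rw [norm_mul, hu, one_mul, mul_comm]
        rfl
    _ = ∫⁻ z, ‖G z‖ₑ ^ 2 := by
        rw [lintegral_const_mul' _ _ ENNReal.ofReal_ne_top,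
          lintegral_edgeMap he (fun z => ‖G z‖ₑ ^ 2), ← mul_assoc,
          ← ENNReal.ofReal_mul (by positivity), mul_inv_cancel₀ (by positivity)]
        simp

/-- The difference `f - τ` is the vertical integral of `g₂`, so the trace criterion applies with `γ
= |g₂|`, cut off to the box containing the triangle to make it integrable. -/
theorem HasEdgeTrace.isTrace {K : PolygonalDomain} {e : ℂ × ℂ} (he : e ∈ K.edges) {c : ℝ}
    (hc : 0 < c) (hR : ∀ p ∈ edgeRegion c, edgeMap e p ∈ K.carrier) {w w' : ℂ → ℝ} {G : ℂ → ℂ}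
    (hw : HasWeakGrad K w G) (hww : w =ᵐ[K.vol] w') {g₁ g₂ : ℝ × ℝ → ℝ} {τ : ℝ → ℝ}
    (h : HasEdgeTrace c (fun p => w' (edgeMap e p)) g₁ g₂ τ) (hg : MemLp g₂ 2 volume)
    (hτ : MemLp τ 2 (volume.restrict (Ioo (0 : ℝ) 1))) : IsTrace K e w τ := by
  set S : Set (ℝ × ℝ) := Ioo 0 1 ×ˢ Ioo 0 c with hS
  have hSm : MeasurableSet S := measurableSet_Ioo.prod measurableSet_Ioo
  refine hw.isTrace_of_bound he hc hR hτ (γ := S.indicator fun p => ‖g₂ p‖ₑ)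
    (h.meas₂.enorm.indicator hSm) ?_ ?_
  · rw [lintegral_indicator hSm]
    have : IsFiniteMeasure (volume.restrict S) := by
      refine ⟨?_⟩
      rw [Measure.restrict_apply_univ, hS, Measure.volume_eq_prod, Measure.prod_prod]
      simp
    exact ((hg.restrict S).integrable (by norm_num)).2.ne
  · have ew := (quasiMeasurePreserving_edgeMap (K.edge_ne e he)).ae
      ((ae_restrict_iff' K.isOpen.measurableSet).1 hww)
    filter_upwards [h.vert, ew] with p hp hp' hpR
    have hp1 := edgeRegion_fst hc hpR
    rw [hp' (hR p hpR), hp hpR, add_sub_cancel_left, intervalIntegral.integral_of_le hpR.1.le]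
    refine (enorm_integral_le_lintegral_enorm _).trans ?_
    rw [← restrict_Ioo_eq_restrict_Ioc]
    refine setLIntegral_mono' measurableSet_Ioo fun s hs => ?_
    rw [indicator_of_mem]
    refine ⟨hp1, hs.1, hs.2.trans (hpR.2.1.trans_le ?_)⟩
    nlinarith [hp1.2]

/-- The trace theorem in the form needed for singular edge functions: `C` depends on the edge and on
`a`, not on `w`. The point `a` will be the point of the edge nearest to the singular vertex. -/
theorem exists_isTrace_weighted {K : PolygonalDomain} {e : ℂ × ℂ} (he : e ∈ K.edges) {a : ℝ}
    (ha : a ∈ Icc (0 : ℝ) 1) : ∃ C : ENNReal, C ≠ ⊤ ∧ ∀ w G, HasWeakGrad K w G →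
      ∃ τ, IsTrace K e w τ ∧
        ∫⁻ t in Ioo (0 : ℝ) 1, ‖τ t‖ₑ ^ 2 * ENNReal.ofReal (|t - a| ^ (-(7 / 10 : ℝ))) ≤
          C * sobolevSq K w G := by
  have hne := K.edge_ne e he
  obtain ⟨c, hc, hR⟩ := K.exists_edgeRegion he
  obtain ⟨C, hC, h⟩ := exists_weighted hc ha.1 ha.2
  obtain ⟨C', hC', h'⟩ := exists_lintegral_trace_sq_le hc
  refine ⟨C * (ENNReal.ofReal ((edgeLength e ^ 2)⁻¹) + 2), by finiteness, fun w G hw => ?_⟩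
  obtain ⟨w', G', hw', ew, eG, hw0, hG0⟩ := hw.exists_isSobolev
  obtain ⟨τ, hτ⟩ := hw'.exists_hasEdgeTrace hne hR
  have s1 : ∫⁻ z, ‖w' z‖ₑ ^ 2 = ∫⁻ z in K.carrier, ‖w z‖ₑ ^ 2 := by
    rw [lintegral_congr_ae (ew.mono fun z hz => by simp only [hz] : (fun z => ‖w z‖ₑ ^ 2) =ᵐ[K.vol]
      fun z => ‖w' z‖ₑ ^ 2), ← lintegral_indicator K.isOpen.measurableSet]
    congr 1
    ext z
    by_cases hz : z ∈ K.carrier <;> simp [hz, hw0]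
  have s2 : ∫⁻ z, ‖G' z‖ₑ ^ 2 = ∫⁻ z in K.carrier, ‖G z‖ₑ ^ 2 := by
    rw [lintegral_congr_ae (eG.mono fun z hz => by simp only [hz] : (fun z => ‖G z‖ₑ ^ 2) =ᵐ[K.vol]
      fun z => ‖G' z‖ₑ ^ 2), ← lintegral_indicator K.isOpen.measurableSet]
    congr 1
    ext z
    by_cases hz : z ∈ K.carrier <;> simp [hz, hG0]
  have hE : (∫⁻ p, ‖w' (edgeMap e p)‖ₑ ^ 2) + (∫⁻ p, ‖⟪G' (edgeMap e p), e.2 - e.1⟫‖ₑ ^ 2) +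
      ∫⁻ p, ‖⟪G' (edgeMap e p), Complex.I * (e.2 - e.1)⟫‖ₑ ^ 2 ≤
      (ENNReal.ofReal ((edgeLength e ^ 2)⁻¹) + 2) * sobolevSq K w G := by
    have h1 := lintegral_edgeMap_inner_le hne G' (u := 1) (by simp)
    have h2 := lintegral_edgeMap_inner_le hne G' (u := Complex.I) (by simp)
    simp only [one_mul] at h1
    rw [lintegral_edgeMap hne (fun z => ‖w' z‖ₑ ^ 2), s1]
    rw [s2] at h1 h2
    calc _ ≤ ENNReal.ofReal ((edgeLength e ^ 2)⁻¹) * sobolevSq K w G + sobolevSq K w G +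
          sobolevSq K w G := by
          gcongr
          · exact le_self_add
          · exact h1.trans le_add_self
          · exact h2.trans le_add_self
      _ = _ := by ring
  have hfin : (∫⁻ p, ‖w' (edgeMap e p)‖ₑ ^ 2) + (∫⁻ p, ‖⟪G' (edgeMap e p), e.2 - e.1⟫‖ₑ ^ 2) +
      ∫⁻ p, ‖⟪G' (edgeMap e p), Complex.I * (e.2 - e.1)⟫‖ₑ ^ 2 ≠ ⊤ :=
    ne_top_of_le_ne_top (by have := hw.sobolevSq_ne_top; finiteness) hE
  refine ⟨τ, hτ.isTrace he hc hR hw ew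
    (memLp_edgeMap hne (memLp_inner_const hw'.memLpG _)) ?_, ?_⟩
  · exact memLp_two_of_lintegral hτ.measτ.aestronglyMeasurable
      (ne_top_of_le_ne_top (ENNReal.mul_ne_top hC' hfin) (h' _ _ _ _ hτ))
  · rw [mul_assoc]
    exact (h _ _ _ _ hτ).trans (by gcongr)

theorem HasWeakGrad.exists_isTrace {K : PolygonalDomain} {w : ℂ → ℝ} {G : ℂ → ℂ}
    (hw : HasWeakGrad K w G) {e : ℂ × ℂ} (he : e ∈ K.edges) : ∃ τ, IsTrace K e w τ := by
  obtain ⟨C, -, h⟩ := exists_isTrace_weighted he (left_mem_Icc.2 zero_le_one)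
  obtain ⟨τ, hτ, -⟩ := h w G hw
  exact ⟨τ, hτ⟩

theorem norm_outwardNormal {e : ℂ × ℂ} (he : e.1 ≠ e.2) : ‖outwardNormal e‖ = 1 := by
  have hL := edgeLength_pos he
  rw [outwardNormal, norm_div, norm_mul, norm_neg, Complex.norm_I, one_mul, Complex.norm_real,
    Real.norm_of_nonneg hL.le]
  exact div_self hL.ne'

/-- Test functions on the edge extend to test functions of the definition of the trace. -/
theorem exists_extension {K : PolygonalDomain} {e : ℂ × ℂ} (he : e ∈ K.edges) {φ : ℝ → ℝ}
    (hφ : ContDiff ℝ ∞ φ) (hφc : HasCompactSupport φ) (hφs : tsupport φ ⊆ Ioo 0 1) :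
    ∃ ψ : ℂ → ℝ, ContDiff ℝ ∞ ψ ∧ HasCompactSupport ψ ∧
      (tsupport ψ ∩ {z | 0 ≤ cross e z} ⊆
        (K.carrier ∩ {z | 0 < cross e z}) ∪ openSegment ℝ e.1 e.2) ∧
      (∀ t, ψ (edgePoint e t) = φ t) ∧ ∀ t, edgePoint e t ∈ tsupport ψ → t ∈ tsupport φ := by
  have hne := K.edge_ne e he
  obtain ⟨c, hc, hR⟩ := K.exists_edgeRegion he
  -- `m` is a margin between the support of `φ` and the ends of the edge; up to height `c * m`, the
  -- points above the support remain in the triangle.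
  obtain ⟨m, hm, hmφ⟩ : ∃ m > 0, ∀ t ∈ tsupport φ, m < t ∧ m < 1 - t := by
    rcases (tsupport φ).eq_empty_or_nonempty with h0 | h0
    · exact ⟨1, one_pos, by simp [h0]⟩
    · obtain ⟨t₀, ht₀, hmin⟩ := hφc.isCompact.exists_isMinOn h0
        (f := fun t : ℝ => min t (1 - t)) (by fun_prop)
      have hpos : 0 < min t₀ (1 - t₀) := lt_min (hφs ht₀).1 (by linarith [(hφs ht₀).2])
      refine ⟨min t₀ (1 - t₀) / 2, by positivity, fun t ht => ?_⟩
      have := isMinOn_iff.1 hmin t ht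
      exact ⟨by linarith [min_le_left t (1 - t)], by linarith [min_le_right t (1 - t)]⟩
  set δ := c * m with hδ
  have hδ0 : 0 < δ := by positivity
  let χ : ContDiffBump (0 : ℝ) := ⟨δ / 2, δ, by positivity, by linarith⟩
  set ψ : ℂ → ℝ := fun z => φ (edgeCoord e z).1 * χ (edgeCoord e z).2 with hψ
  have hsupp : tsupport ψ ⊆ edgeMap e '' (tsupport φ ×ˢ Metric.closedBall 0 δ) := by
    refine closure_minimal (fun z hz => ?_) ?_
    · rw [Function.mem_support, hψ] at hz
      refine ⟨edgeCoord e z, ⟨subset_tsupport _ (left_ne_zero_of_mul hz), ?_⟩,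
        edgeMap_edgeCoord hne z⟩
      have := χ.support_eq ▸ (Function.mem_support.2 (right_ne_zero_of_mul hz))
      exact Metric.ball_subset_closedBall this
    · exact ((hφc.isCompact.prod (isCompact_closedBall _ _)).image
        (continuous_edgeMap e)).isClosed
  refine ⟨ψ, (hφ.comp (contDiff_edgeCoord_fst e)).mul
    (χ.contDiff.comp (contDiff_edgeCoord_snd e)), ?_, ?_, ?_, fun t ht => ?_⟩
  · exact ((hφc.isCompact.prod (isCompact_closedBall _ _)).image
      (continuous_edgeMap e)).of_isClosed_subset (isClosed_tsupport _) hsupp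
  · rintro z ⟨hz, hz0⟩
    obtain ⟨⟨t, y⟩, ⟨ht, hy⟩, rfl⟩ := hsupp hz
    rw [mem_ofPred_eq, cross_edgeMap] at hz0
    have hL := edgeLength_pos hne
    have hy0 : 0 ≤ y := by
      by_contra hcon
      have := mul_neg_of_pos_of_neg (pow_pos hL 2) (not_le.1 hcon)
      linarith
    rcases hy0.eq_or_lt with rfl | hy0
    · right
      rw [edgeMap_zero]
      exact edgePoint_mem_openSegment e (hφs ht)
    · left
      refine ⟨hR _ ⟨hy0, ?_, ?_⟩, (cross_edgeMap_pos hne _).2 hy0⟩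
      all_goals
        have h1 := hmφ t ht
        have h2 : |y| ≤ δ := by simpa using hy
        have h3 := (le_abs_self y).trans h2
        simp only at h1 ⊢
        nlinarith
  · intro t
    rw [← edgeMap_zero, hψ]
    simp only [edgeCoord_edgeMap hne]
    rw [χ.one_of_mem_closedBall (Metric.mem_closedBall_self (by positivity)), mul_one]
  · obtain ⟨p, hp, hpt⟩ := hsupp ht
    rw [← edgeMap_zero] at hpt
    have := congrArg (edgeCoord e) hpt
    rw [edgeCoord_edgeMap hne, edgeCoord_edgeMap hne] at this
    rw [this] at hp
    exact hp.1

/-- The two Green formulas, tested in the direction of the outward normal, have the same left-hand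
side because weak gradients are unique; every test function on the open edge extends to an
admissible one. -/
theorem IsTrace.ae_unique {K : PolygonalDomain} {e : ℂ × ℂ} (he : e ∈ K.edges) {w : ℂ → ℝ}
    {τ τ' : ℝ → ℝ} (h : IsTrace K e w τ) (h' : IsTrace K e w τ') :
    τ =ᵐ[volume.restrict (Ioo (0 : ℝ) 1)] τ' := by
  have hne := K.edge_ne e he
  obtain ⟨hτ, G, hG, hgreen⟩ := h
  obtain ⟨hτ', G', hG', hgreen'⟩ := h'
  have hGG := hG.ae_unique hG'
  have i1 : IntegrableOn τ (Ioo 0 1) := hτ.integrable (by norm_num)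
  have i2 : IntegrableOn τ' (Ioo 0 1) := hτ'.integrable (by norm_num)
  have key : ∀ᵐ t, t ∈ Ioo (0 : ℝ) 1 → (τ - τ') t = 0 := by
    refine isOpen_Ioo.ae_eq_zero_of_integral_contDiff_smul_eq_zero
      (i1.sub i2).locallyIntegrableOn fun φ hφ hφc hφs => ?_
    obtain ⟨ψ, p1, p2, p3, p4, -⟩ := exists_extension he hφ hφc hφs
    have e1 := hgreen ψ p1 p2 p3 (outwardNormal e)
    have e2 := hgreen' ψ p1 p2 p3 (outwardNormal e)
    have e3 : ∫ z in K.carrier ∩ {z | 0 < cross e z},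
          (w z * fderiv ℝ ψ z (outwardNormal e) + ⟪G z, outwardNormal e⟫ * ψ z) =
        ∫ z in K.carrier ∩ {z | 0 < cross e z},
          (w z * fderiv ℝ ψ z (outwardNormal e) + ⟪G' z, outwardNormal e⟫ * ψ z) := by
      refine integral_congr_ae ?_
      filter_upwards [ae_restrict_of_ae_restrict_of_subset inter_subset_left hGG] with z hz
      rw [hz]
    rw [e1, e2, real_inner_self_eq_norm_sq, norm_outwardNormal hne] at e3
    simp only [edgeIntegral, p4, one_pow, one_mul] at e3
    have e4 := mul_left_cancel₀ (edgeLength_pos hne).ne' e3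
    obtain ⟨M, hM⟩ := hφc.exists_bound_of_continuous hφ.continuous
    have j : ∀ f : ℝ → ℝ, IntegrableOn f (Ioo 0 1) →
        IntegrableOn (fun t => f t * φ t) (Ioo 0 1) := fun f hf =>
      hf.mul_bdd (c := M) hφ.continuous.aestronglyMeasurable (Eventually.of_forall hM)
    have e5 : ∫ t, φ t • (τ - τ') t = ∫ t in Ioo (0 : ℝ) 1, (τ t * φ t - τ' t * φ t) := by
      rw [← setIntegral_eq_integral_of_forall_compl_eq_zero (s := Ioo (0 : ℝ) 1)]
      · congr 1
        ext t
        simp only [Pi.sub_apply, smul_eq_mul]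
        ring
      · intro t ht
        rw [image_eq_zero_of_notMem_tsupport fun h => ht (hφs h), zero_smul]
    rw [e5, integral_sub (j τ i1) (j τ' i2), e4, sub_self]
  rw [EventuallyEq, ae_restrict_iff' measurableSet_Ioo]
  filter_upwards [key] with t ht h
  exact sub_eq_zero.1 (ht h)

theorem IsTrace.congr {K : PolygonalDomain} {e : ℂ × ℂ} {w w' : ℂ → ℝ} {τ : ℝ → ℝ}
    (h : IsTrace K e w τ) (hw : w =ᵐ[K.vol] w') : IsTrace K e w' τ := by
  obtain ⟨hτ, G, hG, hgreen⟩ := h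
  refine ⟨hτ, G, hG.congr hw, fun ψ p1 p2 p3 u => ?_⟩
  rw [← hgreen ψ p1 p2 p3 u]
  refine integral_congr_ae ?_
  filter_upwards [ae_restrict_of_ae_restrict_of_subset inter_subset_left hw] with z hz
  rw [hz]

theorem IsTrace.lin {K : PolygonalDomain} {e : ℂ × ℂ} {w₁ w₂ : ℂ → ℝ}
    {τ₁ τ₂ : ℝ → ℝ} (c : ℝ) (h₁ : IsTrace K e w₁ τ₁) (h₂ : IsTrace K e w₂ τ₂) :
    IsTrace K e (c • w₁ + w₂) (c • τ₁ + τ₂) := by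
  obtain ⟨t1, G₁, g1, gr1⟩ := h₁
  obtain ⟨t2, G₂, g2, gr2⟩ := h₂
  refine ⟨(t1.const_smul c).add t2, _, g1.lin c g2, fun ψ p1 p2 p3 u => ?_⟩
  have hc : Continuous fun z => fderiv ℝ ψ z u :=
    (p1.continuous_fderiv (by simp)).clm_apply continuous_const
  have hs : HasCompactSupport fun z => fderiv ℝ ψ z u := p2.fderiv_apply ℝ u
  have hd : MemLp (fun z => fderiv ℝ ψ z u) 2 K.vol :=
    (hc.memLp_of_hasCompactSupport hs).restrict _
  have hψ : MemLp ψ 2 K.vol := (p1.continuous.memLp_of_hasCompactSupport p2).restrict _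
  have i : ∀ w G, HasWeakGrad K w G → IntegrableOn
      (fun z => w z * fderiv ℝ ψ z u + ⟪G z, u⟫ * ψ z) (K.carrier ∩ {z | 0 < cross e z}) := by
    intro w G hw
    have i1 : IntegrableOn (fun z => w z * fderiv ℝ ψ z u) K.carrier := hw.1.integrable_mul hd
    have i2 : IntegrableOn (fun z => ⟪G z, u⟫ * ψ z) K.carrier :=
      (memLp_inner_const hw.2.1 u).integrable_mul hψ
    exact (i1.add i2).mono_set inter_subset_left
  have hψe : Continuous fun t => ψ (edgePoint e t) :=
    p1.continuous.comp (by unfold edgePoint; fun_prop)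
  obtain ⟨M, hM⟩ := p2.exists_bound_of_continuous p1.continuous
  have j : ∀ τ : ℝ → ℝ, MemLp τ 2 (volume.restrict (Ioo (0 : ℝ) 1)) →
      IntegrableOn (fun t => τ t * ψ (edgePoint e t)) (Ioo 0 1) := fun τ hτ =>
    (hτ.integrable (by norm_num)).mul_bdd (c := M) hψe.aestronglyMeasurable
      (Eventually.of_forall fun t => hM _)
  have e1 : ∀ z, (c • w₁ + w₂) z * fderiv ℝ ψ z u + ⟪(c • G₁ + G₂) z, u⟫ * ψ z =
      c * (w₁ z * fderiv ℝ ψ z u + ⟪G₁ z, u⟫ * ψ z) +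
        (w₂ z * fderiv ℝ ψ z u + ⟪G₂ z, u⟫ * ψ z) := by
    intro z
    simp only [Pi.add_apply, Pi.smul_apply, smul_eq_mul, inner_add_left, real_inner_smul_left]
    ring
  have e2 : ∀ t, (c • τ₁ + τ₂) t * ψ (edgePoint e t) =
      c * (τ₁ t * ψ (edgePoint e t)) + τ₂ t * ψ (edgePoint e t) := by
    intro t
    simp only [Pi.add_apply, Pi.smul_apply, smul_eq_mul]
    ring
  simp only [e1, e2, edgeIntegral]
  rw [integral_add ((i _ _ g1).const_mul c) (i _ _ g2), integral_const_mul,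
    gr1 ψ p1 p2 p3 u, gr2 ψ p1 p2 p3 u, integral_add ((j _ t1).const_mul c) (j _ t2),
    integral_const_mul]
  simp only [edgeIntegral]
  ring

theorem IsTrace.isTrace_edgeTrace {K : PolygonalDomain} {e : ℂ × ℂ} {w : ℂ → ℝ} {τ : ℝ → ℝ}
    (h : IsTrace K e w τ) : IsTrace K e w (edgeTrace K e w) := by
  have hex : ∃ τ, IsTrace K e w τ := ⟨τ, h⟩
  rw [edgeTrace, dif_pos hex]
  exact hex.choose_spec

theorem HasWeakGrad.isTrace_edgeTrace {K : PolygonalDomain} {w : ℂ → ℝ} {G : ℂ → ℂ}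
    (hw : HasWeakGrad K w G) {e : ℂ × ℂ} (he : e ∈ K.edges) : IsTrace K e w (edgeTrace K e w) := by
  obtain ⟨τ, hτ⟩ := hw.exists_isTrace he
  exact hτ.isTrace_edgeTrace

/-! ### Edge functions acting continuously on traces -/

/-- `g` is square integrable for the weight `|t - a| ^ (7/10)`, `a` being a point of the edge. -/
def IsEdgeWeight (g : ℝ → ℝ) : Prop :=
  AEStronglyMeasurable g (volume.restrict (Ioo (0 : ℝ) 1)) ∧ ∃ a ∈ Icc (0 : ℝ) 1,
    ∫⁻ t in Ioo (0 : ℝ) 1, ‖g t‖ₑ ^ 2 * ENNReal.ofReal (|t - a| ^ (7 / 10 : ℝ)) ≠ ⊤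

/-- `g` defines a continuous functional on `H¹(K)` through the trace on the edge `e`. -/
def IsEdgeDual (K : PolygonalDomain) (e : ℂ × ℂ) (g : ℝ → ℝ) : Prop :=
  AEStronglyMeasurable g (volume.restrict (Ioo (0 : ℝ) 1)) ∧ ∃ C : ENNReal, C ≠ ⊤ ∧
    ∀ w G τ, HasWeakGrad K w G → IsTrace K e w τ →
      (∫⁻ t in Ioo (0 : ℝ) 1, ‖g t * τ t‖ₑ) ^ 2 ≤ C * sobolevSq K w G

theorem lintegral_mul_sq_le {α : Type*} [MeasurableSpace α] (μ : Measure α) {f g : α → ENNReal}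
    (hf : AEMeasurable f μ) (hg : AEMeasurable g μ) :
    (∫⁻ x, f x * g x ∂μ) ^ 2 ≤ (∫⁻ x, f x ^ 2 ∂μ) * ∫⁻ x, g x ^ 2 ∂μ := by
  have h := ENNReal.lintegral_mul_le_Lp_mul_Lq μ Real.HolderConjugate.two_two hf hg
  simp only [Pi.mul_apply, ENNReal.rpow_ofNat] at h
  refine (pow_le_pow_left' h 2).trans (le_of_eq ?_)
  have e : ∀ x : ENNReal, (x ^ (1 / 2 : ℝ)) ^ 2 = x := fun x => by
    rw [← ENNReal.rpow_natCast, ← ENNReal.rpow_mul]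
    norm_num
  rw [mul_pow, e, e]

/-- Cauchy–Schwarz after inserting `|t - a| ^ (7/20)` and its inverse: the first factor is the
weighted norm of `g`, the second is bounded by the weighted trace estimate. Uniqueness of traces
allows any trace in the conclusion. -/
theorem IsEdgeWeight.isEdgeDual {K : PolygonalDomain} {e : ℂ × ℂ} (he : e ∈ K.edges) {g : ℝ → ℝ}
    (hg : IsEdgeWeight g) : IsEdgeDual K e g := by
  obtain ⟨hgm, a, ha, hga⟩ := hg
  obtain ⟨C, hC, h⟩ := exists_isTrace_weighted he ha
  refine ⟨hgm, (∫⁻ t in Ioo (0 : ℝ) 1, ‖g t‖ₑ ^ 2 * ENNReal.ofReal (|t - a| ^ (7 / 10 : ℝ))) * C,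
    ENNReal.mul_ne_top hga hC, fun w G τ hw hτ => ?_⟩
  obtain ⟨τ', hτ', hb⟩ := h w G hw
  have hττ := hτ.ae_unique he hτ'
  have hta : ∀ᵐ t ∂(volume.restrict (Ioo (0 : ℝ) 1)), t ≠ a :=
    ae_restrict_of_ae (by simp [ae_iff])
  have mabs : Measurable fun t : ℝ => |t - a| := (measurable_id.sub_const a).abs
  calc (∫⁻ t in Ioo (0 : ℝ) 1, ‖g t * τ t‖ₑ) ^ 2
      = (∫⁻ t in Ioo (0 : ℝ) 1, (‖g t‖ₑ * ENNReal.ofReal (|t - a| ^ (7 / 20 : ℝ))) *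
          (‖τ' t‖ₑ * ENNReal.ofReal (|t - a| ^ (-(7 / 20 : ℝ))))) ^ 2 := by
        congr 1
        refine lintegral_congr_ae ?_
        filter_upwards [hττ, hta] with t h1 h2
        have h3 : 0 < |t - a| := abs_pos.2 (sub_ne_zero.2 h2)
        rw [h1, enorm_mul, mul_mul_mul_comm, ← ENNReal.ofReal_mul (by positivity),
          ← Real.rpow_add h3]
        simp
    _ ≤ _ := lintegral_mul_sq_le _
        (hgm.enorm.mul (mabs.pow_const _).ennreal_ofReal.aemeasurable)
        (hτ'.1.1.enorm.mul (mabs.pow_const _).ennreal_ofReal.aemeasurable)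
    _ = (∫⁻ t in Ioo (0 : ℝ) 1, ‖g t‖ₑ ^ 2 * ENNReal.ofReal (|t - a| ^ (7 / 10 : ℝ))) *
        ∫⁻ t in Ioo (0 : ℝ) 1, ‖τ' t‖ₑ ^ 2 * ENNReal.ofReal (|t - a| ^ (-(7 / 10 : ℝ))) := by
        congr 1 <;>
        · refine lintegral_congr fun t => ?_
          rw [mul_pow, ← ENNReal.ofReal_pow (by positivity), ← Real.rpow_mul_natCast (by positivity)]
          norm_num
    _ ≤ _ := by rw [mul_assoc]; gcongr

theorem IsEdgeDual.integrableOn {K : PolygonalDomain} {e : ℂ × ℂ} {g : ℝ → ℝ}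
    (hg : IsEdgeDual K e g) {w : ℂ → ℝ} {G : ℂ → ℂ} {τ : ℝ → ℝ} (hw : HasWeakGrad K w G)
    (hτ : IsTrace K e w τ) : IntegrableOn (fun t => g t * τ t) (Ioo (0 : ℝ) 1) := by
  obtain ⟨hgm, C, hC, h⟩ := hg
  refine ⟨hgm.mul hτ.1.1, ?_⟩
  have h1 := ne_top_of_le_ne_top (ENNReal.mul_ne_top hC hw.sobolevSq_ne_top) (h w G τ hw hτ)
  exact (lt_top_iff_ne_top.2 fun h2 => h1 (by rw [h2]; simp))

theorem isEdgeWeight_of_continuous {g : ℝ → ℝ} (hg : Continuous g) : IsEdgeWeight g := by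
  refine ⟨hg.aestronglyMeasurable, 0, left_mem_Icc.2 zero_le_one, ?_⟩
  have hc : Continuous fun t : ℝ => ‖g t‖ ^ 2 * |t - 0| ^ (7 / 10 : ℝ) := by
    refine (hg.norm.pow 2).mul (Continuous.rpow_const (by fun_prop) fun t => Or.inr (by norm_num))
  have h : IntegrableOn (fun t : ℝ => ‖g t‖ ^ 2 * |t - 0| ^ (7 / 10 : ℝ)) (Ioo 0 1) :=
    (hc.integrableOn_Icc (a := 0) (b := 1)).mono_set Ioo_subset_Icc_self
  have h2 := h.2.ne
  refine ne_of_eq_of_ne (lintegral_congr fun t => ?_) h2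
  rw [enorm_mul, ← ofReal_norm, ← ofReal_norm, ← ofReal_norm]
  rw [← ENNReal.ofReal_pow (norm_nonneg _), Real.norm_of_nonneg (by positivity : 0 ≤ ‖g t‖ ^ 2),
    Real.norm_of_nonneg (by positivity : 0 ≤ |t - 0| ^ (7 / 10 : ℝ))]

/-! ### The singular functions and their normal derivatives -/

/-- The singular functions are the real or the imaginary part of a holomorphic function of the
complex logarithm. -/
theorem exists_singularFunction_eq (dirichlet : Bool) {α : ℝ} (hα : 1 / 4 ≤ α) :
    ∃ F F' : ℂ → ℂ, ∃ P : ℂ →L[ℝ] ℝ, (∀ l, HasDerivAt F (F' l) l) ∧ Continuous F' ∧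
      (∀ l, |P l| ≤ ‖l‖) ∧
      (∀ l, singularFunction dirichlet α (Real.exp l.re) l.im = P (F l)) ∧
      ∀ R, ∃ C, ∀ l : ℂ, l.re ≤ R → |l.im| ≤ 2 * Real.pi → ‖F' l‖ ≤ C * Real.exp (l.re / 5) := by
  obtain ⟨P, hP1, hP2⟩ : ∃ P : ℂ →L[ℝ] ℝ, (∀ l, |P l| ≤ ‖l‖) ∧
      ∀ l, P l = if dirichlet then l.im else l.re := by
    cases dirichlet
    · exact ⟨Complex.reCLM, Complex.abs_re_le_norm, fun l => by simp⟩
    · exact ⟨Complex.imCLM, Complex.abs_im_le_norm, fun l => by simp⟩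
  have hre : ∀ l : ℂ, (Complex.exp (α * l)).re = Real.exp l.re ^ α * Real.cos (α * l.im) := by
    intro l
    rw [Complex.exp_re, ← Real.exp_mul]
    simp [mul_comm]
  have him : ∀ l : ℂ, (Complex.exp (α * l)).im = Real.exp l.re ^ α * Real.sin (α * l.im) := by
    intro l
    rw [Complex.exp_im, ← Real.exp_mul]
    simp [mul_comm]
  have hnorm : ∀ l : ℂ, ‖Complex.exp (α * l)‖ =
      Real.exp ((α - 1 / 5) * l.re) * Real.exp (l.re / 5) := by
    intro l
    rw [Complex.norm_exp, ← Real.exp_add]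
    simp
    ring
  have hdexp : ∀ l : ℂ, HasDerivAt (fun l : ℂ => Complex.exp (α * l))
      (α * Complex.exp (α * l)) l := by
    intro l
    have h := ((hasDerivAt_id l).const_mul (α : ℂ)).cexp
    simpa [mul_comm] using h
  -- The margin between `1/4` and `1/5` absorbs the factor linear in `l` which the logarithm
  -- contributes when `α` is an integer: `|x| * exp (b * x) ≤ 1 / b` for `x ≤ 0`.
  have hb : 0 < α - 1 / 5 := by linarith
  have hle : ∀ R x : ℝ, x ≤ R → Real.exp ((α - 1 / 5) * x) ≤ Real.exp ((α - 1 / 5) * R) :=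
    fun R x h => by gcongr
  by_cases hm : ∃ m : ℕ, α = m
  · refine ⟨fun l => l * Complex.exp (α * l), fun l => (1 + α * l) * Complex.exp (α * l), P,
      fun l => ?_, by fun_prop, hP1, fun l => ?_, fun R => ?_⟩
    · have h := (hasDerivAt_id' l).mul (hdexp l)
      refine h.congr_deriv ?_
      ring
    · rw [hP2, singularFunction, if_pos hm, Real.log_exp, Complex.mul_im, Complex.mul_re, hre, him]
      split_ifs <;> ring
    · set b := α - 1 / 5
      refine ⟨(1 + α * (2 * Real.pi)) * Real.exp (b * R) + α * (1 / b + |R| * Real.exp (b * R)),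
        fun l hl hli => ?_⟩
      rw [norm_mul, hnorm, ← mul_assoc]
      refine mul_le_mul_of_nonneg_right ?_ (Real.exp_nonneg _)
      have h1 : ‖1 + (α : ℂ) * l‖ ≤ 1 + α * (2 * Real.pi) + α * |l.re| := by
        refine (norm_add_le _ _).trans ?_
        rw [norm_one, norm_mul, Complex.norm_real, Real.norm_of_nonneg (by linarith)]
        have h2 : ‖l‖ ≤ |l.re| + 2 * Real.pi := (Complex.norm_le_abs_re_add_abs_im l).trans
          (by linarith)
        have := mul_le_mul_of_nonneg_left h2 (by linarith : 0 ≤ α)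
        linarith
      have h2 : |l.re| * Real.exp (b * l.re) ≤ 1 / b + |R| * Real.exp (b * R) := by
        rcases le_total l.re 0 with h0 | h0
        · have h3 := Real.add_one_le_exp (-(b * l.re))
          rw [abs_of_nonpos h0]
          have h4 : -l.re * Real.exp (b * l.re) ≤ 1 / b := by
            rw [le_div_iff₀ hb]
            have h5 : Real.exp (-(b * l.re)) * Real.exp (b * l.re) = 1 := by
              rw [← Real.exp_add]; simp
            have h6 := Real.exp_pos (b * l.re)
            nlinarith
          have : 0 ≤ |R| * Real.exp (b * R) := by positivity
          linarith
        · have h3 : |l.re| ≤ |R| := by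
            rw [abs_of_nonneg h0]; exact hl.trans (le_abs_self R)
          have : 0 ≤ 1 / b := by positivity
          have h4 := mul_le_mul h3 (hle R _ hl) (Real.exp_nonneg _) (abs_nonneg R)
          linarith
      calc ‖1 + (α : ℂ) * l‖ * Real.exp (b * l.re)
          ≤ (1 + α * (2 * Real.pi) + α * |l.re|) * Real.exp (b * l.re) := by gcongr
        _ = (1 + α * (2 * Real.pi)) * Real.exp (b * l.re) +
            α * (|l.re| * Real.exp (b * l.re)) := by ring
        _ ≤ _ := by gcongr
  · refine ⟨fun l => Complex.exp (α * l), fun l => α * Complex.exp (α * l), P, hdexp,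
      by fun_prop, hP1, fun l => ?_, fun R => ⟨α * Real.exp ((α - 1 / 5) * R), fun l hl _ => ?_⟩⟩
    · rw [hP2, singularFunction, if_neg hm, hre, him]
    · rw [norm_mul, hnorm, Complex.norm_real, Real.norm_of_nonneg (by linarith), ← mul_assoc]
      gcongr

/-- The principal argument is cut along the negative axis, the polar angle along the ray of
direction `φ`. Changing the sign of the argument matches the cuts, at the price of adding `π`. -/
theorem polarAngle_eq {A : ℂ} {φ : ℝ} {z : ℂ}
    (hz : -((z - A) * Complex.exp (-(φ * Complex.I))) ∈ Complex.slitPlane) :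
    polarAngle A φ z =
      Complex.arg (-((z - A) * Complex.exp (-(φ * Complex.I)))) + Real.pi := by
  set ζ := (z - A) * Complex.exp (-(φ * Complex.I))
  have h0 : ζ ≠ 0 := fun h => Complex.slitPlane_ne_zero hz (by rw [h, neg_zero])
  have h1 := Complex.arg_neg_coe_angle h0
  have h2 : ((Complex.arg (-ζ) + Real.pi : ℝ) : Real.Angle) = (Complex.arg ζ : Real.Angle) := by
    rw [Real.Angle.coe_add, h1, add_assoc, Real.Angle.coe_pi_add_coe_pi, add_zero]
  obtain ⟨k, hk⟩ := Real.Angle.angle_eq_iff_two_pi_dvd_sub.1 h2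
  have h3 := Complex.neg_pi_lt_arg (-ζ)
  have h4 : Complex.arg (-ζ) < Real.pi :=
    lt_of_le_of_ne (Complex.arg_le_pi _) (Complex.mem_slitPlane_iff_arg.1 hz).1
  rw [polarAngle, toIcoMod_eq_iff]
  refine ⟨⟨by linarith, by linarith⟩, -k, ?_⟩
  rw [zsmul_eq_mul]
  push_cast
  linarith

/-- On the cut the logarithm still has a limit along a direction transversal to the cut. The limit
depends on the side, which is how the two lips of a crack are told apart. -/
theorem exists_tendsto_log {w d : ℂ} (h : w ∈ Complex.slitPlane ∨ w.im = 0 ∧ w.re < 0 ∧ d.im ≠ 0) :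
    (∀ᶠ ε : ℝ in 𝓝[>] 0, w + ε * d ∈ Complex.slitPlane) ∧
      ∃ l : ℂ, l.re = Real.log ‖w‖ ∧ |l.im| ≤ Real.pi ∧
        Tendsto (fun ε : ℝ => Complex.log (w + ε * d)) (𝓝[>] 0) (𝓝 l) := by
  have hc : Tendsto (fun ε : ℝ => w + ε * d) (𝓝[>] 0) (𝓝 w) := by
    have : Continuous fun ε : ℝ => w + ε * d := by fun_prop
    have h1 := (this.tendsto 0).mono_left (nhdsWithin_le_nhds (s := Ioi 0))
    simpa using h1
  rcases h with h | ⟨h1, h2, h3⟩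
  · refine ⟨hc.eventually (Complex.isOpen_slitPlane.mem_nhds h), Complex.log w, Complex.log_re w,
      ?_, ((continuousAt_clog h).tendsto).comp hc⟩
    rw [Complex.log_im]
    exact Complex.abs_arg_le_pi w
  · have him : ∀ ε : ℝ, (w + ε * d).im = ε * d.im := fun ε => by simp [h1]
    refine ⟨?_, ?_⟩
    · filter_upwards [self_mem_nhdsWithin] with ε hε
      refine Complex.mem_slitPlane_iff.2 (Or.inr ?_)
      rw [him]
      exact mul_ne_zero (ne_of_gt hε) h3
    · rcases lt_or_gt_of_ne h3 with h3 | h3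
      · refine ⟨Real.log ‖w‖ - Real.pi * Complex.I, by simp, by simp [abs_of_pos Real.pi_pos], ?_⟩
        refine (Complex.tendsto_log_nhdsWithin_im_neg_of_re_neg_of_im_zero h2 h1).comp
          (tendsto_nhdsWithin_iff.2 ⟨hc, ?_⟩)
        filter_upwards [self_mem_nhdsWithin] with ε hε
        rw [him]
        exact mul_neg_of_pos_of_neg hε h3
      · refine ⟨Complex.log w, Complex.log_re w, ?_, ?_⟩
        · rw [Complex.log_im]
          exact Complex.abs_arg_le_pi w
        · refine ((Complex.continuousWithinAt_log_of_re_neg_of_im_zero h2 h1).tendsto).comp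
            (tendsto_nhdsWithin_iff.2 ⟨hc, ?_⟩)
          filter_upwards [self_mem_nhdsWithin] with ε hε
          rw [him]
          exact (mul_pos hε h3).le

/-- If the line is not horizontal it meets the real axis at a single parameter. If it is, the
rotated direction is transversal to the cut, and at most the parameter of the origin is lost. -/
theorem ae_mem_slitPlane_or (p : ℂ) {d : ℂ} (hd : d ≠ 0) {κ : ℝ} (hκ : 0 < κ) :
    ∀ᵐ t : ℝ, p + t * d ∈ Complex.slitPlane ∨
      (p + t * d).im = 0 ∧ (p + t * d).re < 0 ∧ (κ * Complex.I * d).im ≠ 0 := by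
  have hne : ∀ x : ℝ, ∀ᵐ t : ℝ, t ≠ x := fun x => by simp [ae_iff]
  by_cases h0 : d.im = 0
  · have hre : d.re ≠ 0 := fun h => hd (Complex.ext h h0)
    filter_upwards [hne (-p.re / d.re)] with t ht
    by_cases h1 : p.im = 0
    · have h2 : (p + t * d).im = 0 := by simp [h0, h1]
      have h3 : (p + t * d).re ≠ 0 := by
        simp only [Complex.add_re, Complex.mul_re, Complex.ofReal_re, Complex.ofReal_im, zero_mul,
          sub_zero]
        intro h
        apply ht
        field_simp
        linarith
      rcases lt_or_gt_of_ne h3 with h3 | h3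
      · exact Or.inr ⟨h2, h3, by simp [h0, hre, hκ.ne']⟩
      · exact Or.inl (Complex.mem_slitPlane_iff.2 (Or.inl h3))
    · exact Or.inl (Complex.mem_slitPlane_iff.2 (Or.inr (by simp [h0, h1])))
  · filter_upwards [hne (-p.im / d.im)] with t ht
    refine Or.inl (Complex.mem_slitPlane_iff.2 (Or.inr fun h => ht ?_))
    simp only [Complex.add_im, Complex.mul_im, Complex.ofReal_re, Complex.ofReal_im, zero_mul,
      add_zero] at h
    field_simp
    linarith

/-- Away from its cut, the singular function is locally `P ∘ F` of `log ξ + π i`, with `ξ` affine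
and proportional to `z - A`. The scaling and the rotation cancel in `ξ' / ξ = 1 / (z - A)`. -/
theorem fderiv_edgeScaledSingular {dirichlet : Bool} {α : ℝ} {F F' : ℂ → ℂ} {P : ℂ →L[ℝ] ℝ}
    (hF : ∀ l, HasDerivAt F (F' l) l)
    (hS : ∀ l, singularFunction dirichlet α (Real.exp l.re) l.im = P (F l)) {A : ℂ} {φ : ℝ}
    {e : ℂ × ℂ} (he : e.1 ≠ e.2) {z : ℂ}
    (hz : -((z - A) * Complex.exp (-(φ * Complex.I))) / edgeLength e ∈ Complex.slitPlane) (n : ℂ) :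
    fderiv ℝ (edgeScaledSingular dirichlet α A φ e) z n =
      P (F' (Complex.log (-((z - A) * Complex.exp (-(φ * Complex.I))) / edgeLength e) +
        Real.pi * Complex.I) / (z - A) * n) := by
  have hL := edgeLength_pos he
  have hL' : (edgeLength e : ℂ) ≠ 0 := by exact_mod_cast hL.ne'
  set E := Complex.exp (-(φ * Complex.I)) with hE
  have hE1 : ‖E‖ = 1 := by rw [hE, Complex.norm_exp]; simp
  have hE0 : E ≠ 0 := Complex.exp_ne_zero _
  set ξ : ℂ → ℂ := fun z => -((z - A) * E) / edgeLength e with hξ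
  have hξc : Continuous ξ := by fun_prop
  have hev : edgeScaledSingular dirichlet α A φ e =ᶠ[𝓝 z]
      fun z => P (F (Complex.log (ξ z) + Real.pi * Complex.I)) := by
    filter_upwards [hξc.continuousAt.preimage_mem_nhds (Complex.isOpen_slitPlane.mem_nhds hz)]
      with y hy
    have hy0 := Complex.slitPlane_ne_zero hy
    have hy' : -((y - A) * E) = edgeLength e * ξ y := by
      simp only [hξ]; field_simp
    have hys : -((y - A) * E) ∈ Complex.slitPlane := by
      rw [hy', Complex.mem_slitPlane_iff_arg, Complex.arg_real_mul _ hL]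
      exact ⟨(Complex.mem_slitPlane_iff_arg.1 hy).1, mul_ne_zero (by simpa using hL.ne') hy0⟩
    rw [edgeScaledSingular, polarAngle_eq hys, ← hS]
    congr 1
    · rw [Complex.add_re, Complex.log_re]
      have : ‖y - A‖ / edgeLength e = ‖ξ y‖ := by
        simp only [hξ]
        rw [norm_div, norm_neg, norm_mul, hE1, mul_one, Complex.norm_real,
          Real.norm_of_nonneg hL.le]
      rw [this]
      simp [Real.exp_log (norm_pos_iff.2 hy0)]
    · rw [← hE, hy', Complex.arg_real_mul _ hL]
      simp [Complex.log_im]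
  rw [hev.fderiv_eq]
  have hz0 := Complex.slitPlane_ne_zero hz
  have hzA : z - A ≠ 0 := fun h => hz0 (by rw [h]; simp)
  have hd1 : HasDerivAt ξ (-E / edgeLength e) z := by
    have := ((((hasDerivAt_id z).sub_const A).mul_const E).neg).div_const (edgeLength e : ℂ)
    simpa using this
  have hd2 := (hF _).comp z ((hd1.clog hz).add_const (Real.pi * Complex.I))
  have hd3 := P.hasFDerivAt.comp z (hd2.complexToReal_fderiv)
  have hd4 := hd3.fderiv
  simp only [Function.comp_def] at hd4
  rw [hd4]
  have : -E / (edgeLength e : ℂ) / ξ z = 1 / (z - A) := by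
    simp only [hξ]
    field_simp
  rw [this]
  simp [div_eq_mul_inv, hξ]

/-- The worst case is a crack tip, `β = 2π`, with mixed conditions and `j = 1`. -/
theorem singularExponent_ge {mixed : Bool} {β : ℝ} (h0 : 0 < β) (h1 : β ≤ 2 * Real.pi) {j : ℕ}
    (hj : 1 ≤ j) : 1 / 4 ≤ singularExponent mixed β j := by
  have hj' : (1 : ℝ) ≤ j := by exact_mod_cast hj
  have h2 : 1 / 2 ≤ Real.pi / β := by rw [le_div_iff₀ h0]; linarith
  unfold singularExponent
  split_ifs <;> nlinarith

/-- For almost every `t` the one-sided limit of the gradient exists and equals `P` applied to `F' l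
/ (z - A) * n`, and `F'` is of order `x ^ (1/5)` in the scaled distance `x` to `A`. Measurability is
inherited from the derivatives at the distances `1 / (k + 1)` from the edge. -/
theorem exists_singularNormalDeriv_bound (dirichlet : Bool) {α : ℝ} (hα : 1 / 4 ≤ α) (A : ℂ)
    (φ : ℝ) (n : ℂ) {e : ℂ × ℂ} (he : e.1 ≠ e.2) :
    AEStronglyMeasurable (singularNormalDeriv dirichlet α A φ n e)
        (volume.restrict (Ioo (0 : ℝ) 1)) ∧
      ∃ C, ∀ᵐ t ∂(volume.restrict (Ioo (0 : ℝ) 1)), edgePoint e t ≠ A ∧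
        |singularNormalDeriv dirichlet α A φ n e t| ≤
          C * (‖edgePoint e t - A‖ / edgeLength e) ^ (-(4 / 5) : ℝ) := by
  obtain ⟨F, F', P, hF, hF', hP, hS, hbound⟩ := exists_singularFunction_eq dirichlet hα
  have hL := edgeLength_pos he
  have hL' : (edgeLength e : ℂ) ≠ 0 := by exact_mod_cast hL.ne'
  set E := Complex.exp (-(φ * Complex.I)) with hE
  have hE1 : ‖E‖ = 1 := by rw [hE, Complex.norm_exp]; simp
  have hE0 : E ≠ 0 := Complex.exp_ne_zero _
  set p : ℂ := -((e.1 - A) * E) / edgeLength e with hp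
  set d : ℂ := -((e.2 - e.1) * E) / edgeLength e with hd
  have hd0 : d ≠ 0 := by
    rw [hd]
    exact div_ne_zero (neg_ne_zero.2 (mul_ne_zero (sub_ne_zero.2 he.symm) hE0)) hL'
  -- In the rotated and scaled coordinate, moving into the element is moving in the direction `i d`,
  -- orthogonal to the edge.
  have hξ : ∀ t ε : ℝ, -((edgePoint e t - ε * outwardNormal e - A) * E) / edgeLength e =
      p + t * d + ε * (((edgeLength e)⁻¹ : ℝ) * Complex.I * d) := by
    intro t ε
    rw [hp, hd, edgePoint, outwardNormal]
    push_cast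
    field_simp
    ring
  have hw : ∀ t : ℝ, p + t * d = -((edgePoint e t - A) * E) / edgeLength e := by
    intro t
    have := hξ t 0
    simp only [Complex.ofReal_zero, zero_mul, sub_zero, add_zero] at this
    exact this.symm
  have hwn : ∀ t : ℝ, ‖p + t * d‖ = ‖edgePoint e t - A‖ / edgeLength e := by
    intro t
    rw [hw, norm_div, norm_neg, norm_mul, hE1, mul_one, Complex.norm_real,
      Real.norm_of_nonneg hL.le]
  -- On the edge the scaled distance to `A` is `‖p + t * d‖`, which is at most `‖p‖ + ‖d‖`.
  obtain ⟨C, hC⟩ := hbound (Real.log ((‖p‖ + ‖d‖) + 1))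
  have key : ∀ᵐ t : ℝ, edgePoint e t ≠ A ∧ ∃ l : ℂ,
      l.re = Real.log (‖edgePoint e t - A‖ / edgeLength e) ∧ |l.im| ≤ 2 * Real.pi ∧
      Tendsto (fun ε : ℝ => fderiv ℝ (edgeScaledSingular dirichlet α A φ e)
        (edgePoint e t - (ε : ℂ) * outwardNormal e) n) (𝓝[>] 0)
        (𝓝 (P (F' l / (edgePoint e t - A) * n))) := by
    filter_upwards [ae_mem_slitPlane_or p hd0 (inv_pos.2 hL)] with t ht
    have hA : edgePoint e t ≠ A := by
      intro h
      have h1 := hw t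
      rw [h, sub_self, zero_mul, neg_zero, zero_div] at h1
      rw [h1] at ht
      rcases ht with h | h
      · exact Complex.slitPlane_ne_zero h rfl
      · simp at h
    obtain ⟨h1, l, hl1, hl2, hl3⟩ := exists_tendsto_log ht
    refine ⟨hA, l + Real.pi * Complex.I, ?_, ?_, ?_⟩
    · rw [← hwn, ← hl1]
      simp
    · have e1 : (l + Real.pi * Complex.I).im = l.im + Real.pi := by simp
      rw [e1]
      obtain ⟨h2, h3⟩ := abs_le.1 hl2
      have := Real.pi_pos
      exact abs_le.2 ⟨by linarith, by linarith⟩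
    · have hcz : Tendsto (fun ε : ℝ => edgePoint e t - (ε : ℂ) * outwardNormal e - A) (𝓝[>] 0)
          (𝓝 (edgePoint e t - A)) := by
        have : Continuous fun ε : ℝ => edgePoint e t - (ε : ℂ) * outwardNormal e - A := by fun_prop
        have h1 := (this.tendsto 0).mono_left (nhdsWithin_le_nhds (s := Ioi 0))
        simpa using h1
      have hlim := ((P.continuous.tendsto _).comp ((((hF'.tendsto _).comp
        (hl3.add_const (Real.pi * Complex.I))).div hcz (sub_ne_zero.2 hA)).mul_const n))
      refine hlim.congr' ?_
      filter_upwards [h1] with ε hε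
      rw [← hξ] at hε
      rw [fderiv_edgeScaledSingular hF hS he hε n, hξ]
      simp
  have hs : ∀ᵐ t : ℝ, Tendsto (fun ε : ℝ => fderiv ℝ (edgeScaledSingular dirichlet α A φ e)
        (edgePoint e t - (ε : ℂ) * outwardNormal e) n) (𝓝[>] 0)
        (𝓝 (singularNormalDeriv dirichlet α A φ n e t)) := by
    filter_upwards [key] with t ⟨_, l, _, _, hl⟩
    rwa [singularNormalDeriv, hl.limUnder_eq]
  refine ⟨?_, C * ‖n‖ / edgeLength e, ?_⟩
  · have hseq : Tendsto (fun k : ℕ => (1 : ℝ) / (k + 1)) atTop (𝓝[>] 0) :=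
      tendsto_nhdsWithin_iff.2 ⟨tendsto_one_div_add_atTop_nhds_zero_nat,
        Eventually.of_forall fun k => by simp only [mem_Ioi]; positivity⟩
    refine aestronglyMeasurable_of_tendsto_ae atTop
      (f := fun (k : ℕ) t => fderiv ℝ (edgeScaledSingular dirichlet α A φ e)
        (edgePoint e t - (((1 : ℝ) / (k + 1) : ℝ) : ℂ) * outwardNormal e) n) (fun k => ?_) ?_
    · refine Measurable.aestronglyMeasurable ?_
      refine (measurable_fderiv_apply_const ℝ _ n).comp (Continuous.measurable ?_)
      unfold edgePoint
      fun_prop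
    · refine ae_restrict_of_ae ?_
      filter_upwards [hs] with t ht
      exact ht.comp hseq
  · rw [ae_restrict_iff' measurableSet_Ioo]
    filter_upwards [key] with t ⟨hA, l, hl1, hl2, hl⟩ ht
    refine ⟨hA, ?_⟩
    rw [singularNormalDeriv, hl.limUnder_eq]
    have hx : 0 < ‖edgePoint e t - A‖ / edgeLength e :=
      div_pos (norm_pos_iff.2 (sub_ne_zero.2 hA)) hL
    set x := ‖edgePoint e t - A‖ / edgeLength e with hxdef
    have hxR : l.re ≤ Real.log ((‖p‖ + ‖d‖) + 1) := by
      rw [hl1]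
      refine Real.log_le_log hx ?_
      rw [hxdef, ← hwn]
      refine (norm_add_le _ _).trans ?_
      rw [norm_mul, Complex.norm_real, Real.norm_of_nonneg ht.1.le]
      have : t * ‖d‖ ≤ 1 * ‖d‖ := by gcongr; exact ht.2.le
      linarith
    have h1 := hC l hxR hl2
    have h2 : Real.exp (l.re / 5) = x ^ (1 / 5 : ℝ) := by
      rw [hl1, Real.rpow_def_of_pos hx]
      congr 1
      ring
    rw [h2] at h1
    have h3 : ‖edgePoint e t - A‖ = x * edgeLength e := by rw [hxdef]; field_simp
    calc |P (F' l / (edgePoint e t - A) * n)| ≤ ‖F' l / (edgePoint e t - A) * n‖ := hP _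
      _ = ‖F' l‖ / (x * edgeLength e) * ‖n‖ := by rw [norm_mul, norm_div, h3]
      _ ≤ C * x ^ (1 / 5 : ℝ) / (x * edgeLength e) * ‖n‖ := by gcongr
      _ = C * ‖n‖ / edgeLength e * (x ^ (1 / 5 : ℝ) / x) := by field_simp
      _ = _ := by
        have h4 : x ^ (1 / 5 : ℝ) / x = x ^ (-(4 / 5) : ℝ) := by
          nth_rewrite 2 [← Real.rpow_one x]
          rw [← Real.rpow_sub hx]
          norm_num
        rw [h4]

/-- The point `a` is the parameter of the projection of `A` on the line, clamped to `[0, 1]`, so `|t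
- a|` is at most the scaled distance to `A`. The square of the bound times the weight has exponent
`-8/5 + 7/10 = -9/10 > -1`. -/
theorem isEdgeWeight_singularNormalDeriv (dirichlet : Bool) {α : ℝ} (hα : 1 / 4 ≤ α) (A : ℂ)
    (φ : ℝ) (n : ℂ) {e : ℂ × ℂ} (he : e.1 ≠ e.2) :
    IsEdgeWeight (singularNormalDeriv dirichlet α A φ n e) := by
  obtain ⟨hm, C, hC⟩ := exists_singularNormalDeriv_bound dirichlet hα A φ n he
  have hL := edgeLength_pos he
  have hne : e.2 - e.1 ≠ 0 := sub_ne_zero.2 he.symm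
  set a₀ : ℝ := ((A - e.1) / (e.2 - e.1)).re with ha₀
  set a : ℝ := (projIcc (0 : ℝ) 1 zero_le_one a₀ : ℝ) with ha
  have ha1 : a ∈ Icc (0 : ℝ) 1 := (projIcc (0 : ℝ) 1 zero_le_one a₀).2
  have hdist : ∀ t ∈ Ioo (0 : ℝ) 1, |t - a| ≤ ‖edgePoint e t - A‖ / edgeLength e := by
    intro t ht
    have h1 : |t - a| ≤ |t - a₀| := by
      rw [ha, coe_projIcc]
      rcases le_total a₀ 0 with h | h
      · rw [min_eq_right (by linarith), max_eq_left h, abs_of_pos (by linarith [ht.1]),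
          abs_of_pos (by linarith [ht.1])]
        linarith
      · rcases le_total a₀ 1 with h' | h'
        · rw [min_eq_right h', max_eq_right h]
        · rw [min_eq_left h', max_eq_right zero_le_one, abs_of_neg (by linarith [ht.2]),
            abs_of_neg (by linarith [ht.2])]
          linarith
    refine h1.trans ?_
    have h2 : (edgePoint e t - A) / (e.2 - e.1) = t - (A - e.1) / (e.2 - e.1) := by
      rw [edgePoint]; field_simp; ring
    have h3 := Complex.abs_re_le_norm ((edgePoint e t - A) / (e.2 - e.1))
    rw [norm_div] at h3
    refine le_trans (le_of_eq ?_) h3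
    rw [h2]
    simp [ha₀]
  refine ⟨hm, a, ha1, ?_⟩
  have hint : IntegrableOn (fun t : ℝ => C ^ 2 * |t - a| ^ (-(9 / 10) : ℝ)) (Ioo 0 1) := by
    refine Integrable.const_mul ?_ _
    have h1 : ∀ x y : ℝ, IntervalIntegrable (fun t : ℝ => |t| ^ (-(9 / 10) : ℝ)) volume x y := by
      have hpos : ∀ x : ℝ, 0 ≤ x →
          IntervalIntegrable (fun t : ℝ => |t| ^ (-(9 / 10) : ℝ)) volume 0 x := by
        intro x hx
        refine (intervalIntegral.intervalIntegrable_rpow' (by norm_num : (-1 : ℝ) < -(9 / 10))).congr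
          ?_
        rw [uIoc_of_le hx]
        intro t ht
        simp [abs_of_pos ht.1]
      have hall : ∀ x : ℝ, IntervalIntegrable (fun t : ℝ => |t| ^ (-(9 / 10) : ℝ)) volume 0 x := by
        intro x
        rcases le_total 0 x with hx | hx
        · exact hpos x hx
        · have := (IntervalIntegrable.iff_comp_neg (by simp)).1 (hpos (-x) (by linarith))
          simpa using this
      exact fun x y => (hall x).symm.trans (hall y)
    have h2 := (h1 (0 - a) (1 - a)).comp_sub_right a
    simp only [sub_add_cancel] at h2
    exact ((intervalIntegrable_iff_integrableOn_Ioc_of_le zero_le_one).1 h2).mono_set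
      Ioo_subset_Ioc_self
  refine ne_top_of_le_ne_top hint.2.ne (lintegral_mono_ae ?_)
  have hta : ∀ᵐ t ∂(volume.restrict (Ioo (0 : ℝ) 1)), t ≠ a :=
    ae_restrict_of_ae (by simp [ae_iff])
  filter_upwards [hC, hta, ae_restrict_mem measurableSet_Ioo] with t ⟨hA, h1⟩ h2 ht
  have h3 : 0 < |t - a| := abs_pos.2 (sub_ne_zero.2 h2)
  have hx : 0 < ‖edgePoint e t - A‖ / edgeLength e :=
    div_pos (norm_pos_iff.2 (sub_ne_zero.2 hA)) hL
  have hC0 : 0 ≤ C := by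
    have := (abs_nonneg _).trans h1
    exact nonneg_of_mul_nonneg_left this (Real.rpow_pos_of_pos hx _)
  rw [← ofReal_norm, ← ofReal_norm, ← ENNReal.ofReal_pow (norm_nonneg _),
    ← ENNReal.ofReal_mul (by positivity)]
  refine ENNReal.ofReal_le_ofReal ?_
  rw [Real.norm_of_nonneg (by positivity : 0 ≤ C ^ 2 * |t - a| ^ (-(9 / 10) : ℝ)), Real.norm_eq_abs]
  have h4 : |singularNormalDeriv dirichlet α A φ n e t| ≤ C * |t - a| ^ (-(4 / 5) : ℝ) :=
    h1.trans (mul_le_mul_of_nonneg_left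
      (Real.rpow_le_rpow_of_nonpos h3 (hdist t ht) (by norm_num)) hC0)
  calc |singularNormalDeriv dirichlet α A φ n e t| ^ 2 * |t - a| ^ (7 / 10 : ℝ)
      ≤ (C * |t - a| ^ (-(4 / 5) : ℝ)) ^ 2 * |t - a| ^ (7 / 10 : ℝ) := by gcongr
    _ = C ^ 2 * (|t - a| ^ (-(8 / 5) : ℝ) * |t - a| ^ (7 / 10 : ℝ)) := by
        rw [mul_pow, ← Real.rpow_mul_natCast h3.le]
        norm_num
        ring
    _ = _ := by
        rw [← Real.rpow_add h3]
        norm_num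

/-! ### Lifting of edge data and density of the traces -/

/-- The gradient of a function on the plane, as a complex number. -/
def planeGrad (ψ : ℂ → ℝ) (z : ℂ) : ℂ := fderiv ℝ ψ z 1 + fderiv ℝ ψ z Complex.I * Complex.I

theorem planeGrad_inner (ψ : ℂ → ℝ) (z u : ℂ) : ⟪planeGrad ψ z, u⟫ = fderiv ℝ ψ z u := by
  have hu : u = u.re • (1 : ℂ) + u.im • Complex.I := by simp
  conv_rhs => rw [hu, map_add, map_smul, map_smul]
  simp [planeGrad, Complex.inner]

theorem continuous_planeGrad {ψ : ℂ → ℝ} (hψ : ContDiff ℝ ∞ ψ) : Continuous (planeGrad ψ) := by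
  have h : ∀ u, Continuous fun z => fderiv ℝ ψ z u := fun u =>
    (hψ.continuous_fderiv (by simp)).clm_apply continuous_const
  unfold planeGrad
  exact (Complex.continuous_ofReal.comp (h 1)).add
    ((Complex.continuous_ofReal.comp (h Complex.I)).mul continuous_const)

theorem hasCompactSupport_planeGrad {ψ : ℂ → ℝ} (hψ : HasCompactSupport ψ) :
    HasCompactSupport (planeGrad ψ) := by
  refine (hψ.fderiv (𝕜 := ℝ)).mono fun z hz => ?_
  rw [Function.mem_support] at hz ⊢
  intro h
  exact hz (by simp [planeGrad, h])

theorem integral_fderiv_eq_zero {f : ℂ → ℝ} (hf : Differentiable ℝ f) (hi : Integrable f) (u : ℂ)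
    (hi' : Integrable fun z => fderiv ℝ f z u) : ∫ z, fderiv ℝ f z u = 0 := by
  have h := integral_mul_fderiv_eq_neg_fderiv_mul_of_integrable (μ := (volume : Measure ℂ))
    (f := fun _ : ℂ => (1 : ℝ)) (g := f) (v := u) (by simp) (by simpa using hi')
    (by simpa using hi) (by fun_prop) fun x _ => hf x
  simpa using h

/-- Functions that are piecewise smooth on the plane and smooth on the domain. -/
theorem hasWeakGrad_indicator {K : PolygonalDomain} {ψ : ℂ → ℝ} (hψ : ContDiff ℝ ∞ ψ) {S : Set ℂ}
    (hS : MeasurableSet S) (hK : ∀ z ∈ K.carrier, z ∈ tsupport ψ → S ∈ 𝓝 z ∨ Sᶜ ∈ 𝓝 z)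
    (h1 : MemLp ψ 2 K.vol) (h2 : MemLp (planeGrad ψ) 2 K.vol) :
    HasWeakGrad K (S.indicator ψ) (S.indicator (planeGrad ψ)) := by
  classical
  refine ⟨h1.indicator hS, h2.indicator hS, fun η hη u => ?_⟩
  have hηd : Differentiable ℝ η := hη.1.differentiable (by simp)
  have hψd : Differentiable ℝ ψ := hψ.differentiable (by simp)
  set f : ℂ → ℝ := S.indicator fun z => ψ z * η z with hf
  set f' : ℂ → ℝ := S.indicator fun z => ψ z * fderiv ℝ η z u + fderiv ℝ ψ z u * η z with hf'
  -- Near a point of both supports, `S` is locally everything or nothing; near any other point one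
  -- of the factors vanishes. Hence the truncated product is differentiable everywhere, and its
  -- derivative integrates to zero.
  have hfd : ∀ z, DifferentiableAt ℝ f z ∧ fderiv ℝ f z u = f' z := by
    intro z
    have hzero : f =ᶠ[𝓝 z] (fun _ => 0) → f' z = 0 →
        DifferentiableAt ℝ f z ∧ fderiv ℝ f z u = f' z := fun h h' =>
      ⟨(differentiableAt_const 0).congr_of_eventuallyEq h, by rw [h.fderiv_eq, h']; simp⟩
    by_cases hzη : z ∈ tsupport η
    · by_cases hzψ : z ∈ tsupport ψ
      · rcases hK z (hη.2.2 hzη) hzψ with h | h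
        · have he : f =ᶠ[𝓝 z] fun z => ψ z * η z := by
            filter_upwards [h] with y hy
            rw [hf, indicator_of_mem hy]
          refine ⟨((hψd z).mul (hηd z)).congr_of_eventuallyEq he, ?_⟩
          rw [he.fderiv_eq, hf', indicator_of_mem (mem_of_mem_nhds h), fderiv_fun_mul (hψd z) (hηd z)]
          simp [mul_comm]
        · refine hzero ?_ (indicator_of_notMem (mem_of_mem_nhds h) _)
          filter_upwards [h] with y hy
          exact indicator_of_notMem hy _
      · have h := notMem_tsupport_iff_eventuallyEq.1 hzψ
        refine hzero ?_ ?_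
        · filter_upwards [h] with y hy
          rw [hf, indicator_apply]
          simp [hy]
        · rw [hf', indicator_apply, h.fderiv_eq, h.eq_of_nhds]
          simp
    · have h := notMem_tsupport_iff_eventuallyEq.1 hzη
      refine hzero ?_ ?_
      · filter_upwards [h] with y hy
        rw [hf, indicator_apply]
        simp [hy]
      · rw [hf', indicator_apply, h.fderiv_eq, h.eq_of_nhds]
        simp
  have hc : ∀ (φ : ℂ → ℝ) u, ContDiff ℝ ∞ φ → Continuous fun z => fderiv ℝ φ z u :=
    fun φ u hφ => (hφ.continuous_fderiv (by simp)).clm_apply continuous_const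
  have i0 : Integrable fun z => ψ z * η z :=
    (hψ.continuous.mul hη.1.continuous).integrable_of_hasCompactSupport hη.2.1.mul_left
  have i1 : Integrable fun z => ψ z * fderiv ℝ η z u :=
    (hψ.continuous.mul (hc η u hη.1)).integrable_of_hasCompactSupport
      (hη.2.1.fderiv_apply ℝ u).mul_left
  have i2 : Integrable fun z => fderiv ℝ ψ z u * η z :=
    ((hc ψ u hψ).mul hη.1.continuous).integrable_of_hasCompactSupport hη.2.1.mul_left
  have h0 := integral_fderiv_eq_zero (fun z => (hfd z).1) (i0.indicator hS) u
    (((i1.add i2).indicator hS).congr (Eventually.of_forall fun z => ((hfd z).2).symm))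
  have e1 : ∫ z in K.carrier, S.indicator ψ z * fderiv ℝ η z u =
      ∫ z, S.indicator (fun z => ψ z * fderiv ℝ η z u) z := by
    refine Eq.trans ?_ (setIntegral_eq_integral_of_forall_compl_eq_zero (s := K.carrier) ?_)
    · refine integral_congr_ae (Eventually.of_forall fun z => ?_)
      by_cases hz : z ∈ S <;> simp [hz]
    · intro z hz
      have : fderiv ℝ η z = 0 := by
        by_contra hcon
        exact hz (hη.2.2 (support_fderiv_subset ℝ hcon))
      simp [this]
  have e2 : ∫ z in K.carrier, ⟪S.indicator (planeGrad ψ) z, u⟫ * η z =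
      ∫ z, S.indicator (fun z => fderiv ℝ ψ z u * η z) z := by
    refine Eq.trans ?_ (setIntegral_eq_integral_of_forall_compl_eq_zero (s := K.carrier) ?_)
    · refine integral_congr_ae (Eventually.of_forall fun z => ?_)
      by_cases hz : z ∈ S
      · simp only [indicator_of_mem hz, planeGrad_inner]
      · simp [hz]
    · intro z hz
      simp [image_eq_zero_of_notMem_tsupport fun h => hz (hη.2.2 h)]
  rw [e1, e2, eq_neg_iff_add_eq_zero, ← integral_add (i1.indicator hS) (i2.indicator hS), ← h0]
  congr 1
  ext z
  rw [(hfd z).2, hf']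
  simp only [indicator_apply]
  split_ifs <;> simp

theorem hasWeakGrad_of_contDiff {K : PolygonalDomain} {ψ : ℂ → ℝ} (hψ : ContDiff ℝ ∞ ψ)
    (hc : HasCompactSupport ψ) : HasWeakGrad K ψ (planeGrad ψ) := by
  have h := hasWeakGrad_indicator (K := K) hψ MeasurableSet.univ
    (fun z _ _ => Or.inl univ_mem) ((hψ.continuous.memLp_of_hasCompactSupport hc).restrict _)
    (((continuous_planeGrad hψ).memLp_of_hasCompactSupport
      (hasCompactSupport_planeGrad hc)).restrict _)
  simpa using h

theorem PolygonalDomain.isFiniteMeasure_vol (K : PolygonalDomain) : IsFiniteMeasure K.vol :=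
  ⟨by rw [Measure.restrict_apply_univ]; exact K.isBounded.measure_lt_top⟩

theorem hasWeakGrad_const (K : PolygonalDomain) (c : ℝ) : HasWeakGrad K (fun _ => c) 0 := by
  have := K.isFiniteMeasure_vol
  have hg : planeGrad (fun _ : ℂ => c) = 0 := by ext z; simp [planeGrad]
  have h := hasWeakGrad_indicator (K := K) (ψ := fun _ => c) contDiff_const MeasurableSet.univ
    (fun z _ _ => Or.inl univ_mem) (memLp_const c) (by rw [hg]; exact MemLp.zero')
  rw [hg] at h
  simpa using h

theorem isTrace_const {K : PolygonalDomain} {e : ℂ × ℂ} (he : e ∈ K.edges) (c : ℝ) :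
    IsTrace K e (fun _ => c) fun _ => c := by
  obtain ⟨c', hc', hR⟩ := K.exists_edgeRegion he
  exact (hasWeakGrad_const K c).isTrace_of_bound he hc' hR (memLp_const c) (γ := 0)
    measurable_const (by simp) (Eventually.of_forall fun p _ => by simp)

theorem HasWeakGrad.isTrace_zero {K : PolygonalDomain} {e : ℂ × ℂ} (he : e ∈ K.edges) {w : ℂ → ℝ}
    {G : ℂ → ℂ} (hw : HasWeakGrad K w G) {c : ℝ} (hc : 0 < c)
    (h0 : ∀ p ∈ edgeRegion c, w (edgeMap e p) = 0) : IsTrace K e w 0 := by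
  obtain ⟨c', hc', hR⟩ := K.exists_edgeRegion he
  have hm : 0 < min c c' := lt_min hc hc'
  exact hw.isTrace_of_bound he hm (fun p hp => hR p (edgeRegion_mono hm (min_le_right _ _) hp))
    MemLp.zero' (γ := 0) measurable_const (by simp)
    (Eventually.of_forall fun p hp => by
      simp [h0 p (edgeRegion_mono hm (min_le_left _ _) hp)])

theorem exists_edgeRegion_notMem {e : ℂ × ℂ} (he : e.1 ≠ e.2) {S : Set ℂ} (hS : IsCompact S)
    (hd : Disjoint S (segment ℝ e.1 e.2)) : ∃ c > 0, ∀ p ∈ edgeRegion c, edgeMap e p ∉ S := by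
  have hL := edgeLength_pos he
  have hseg : IsCompact (segment ℝ e.1 e.2) := by
    rw [← convexHull_pair (𝕜 := ℝ)]
    exact (Set.toFinite _).isCompact_convexHull (𝕜 := ℝ)
  obtain ⟨δ, hδ, hδS⟩ := hd.exists_thickenings hS hseg.isClosed
  refine ⟨δ / edgeLength e, by positivity, fun p hp hpS => ?_⟩
  have hp1 := edgeRegion_fst (by positivity) hp
  have h1 := edgePoint_mem_openSegment e hp1
  refine Set.disjoint_left.1 hδS (Metric.self_subset_thickening hδ S hpS)
    (Metric.mem_thickening_iff.2 ⟨_, openSegment_subset_segment ℝ _ _ h1, ?_⟩)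
  have h2 : edgeMap e p - edgePoint e p.1 = (p.2 : ℂ) * (Complex.I * (e.2 - e.1)) := by
    rw [edgeMap, edgePoint]; ring
  rw [dist_eq_norm, h2, norm_mul, norm_mul, Complex.norm_I, one_mul, Complex.norm_real,
    Real.norm_of_nonneg hp.1.le]
  have h3 : p.2 < δ / edgeLength e := hp.2.1.trans_le (mul_le_of_le_one_right (by positivity) hp1.2.le)
  exact (lt_div_iff₀ hL).1 h3

theorem IsTest.isTrace_zero {K : PolygonalDomain} {e : ℂ × ℂ} (he : e ∈ K.edges) {ψ : ℂ → ℝ}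
    (hψ : IsTest K.carrier ψ) : IsTrace K e ψ 0 := by
  obtain ⟨c, hc, h⟩ := exists_edgeRegion_notMem (K.edge_ne e he) hψ.2.1.isCompact
    (Set.disjoint_of_subset hψ.2.2 (K.segment_subset_frontier he) K.disjoint_frontier)
  exact (hasWeakGrad_of_contDiff hψ.1 hψ.2.1).isTrace_zero he hc fun p hp =>
    image_eq_zero_of_notMem_tsupport (h p hp)

/-- Two edges with a common relatively interior point are collinear, for otherwise the second would
enter the left side of the first, which belongs to the domain. As they are distinct, they have
opposite orientations: they are the lips of a crack. -/
theorem PolygonalDomain.cross_eq_of_mem_inter (K : PolygonalDomain) {e e' : ℂ × ℂ}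
    (he : e ∈ K.edges) (he' : e' ∈ K.edges) (hne : e ≠ e') {x : ℂ}
    (hx : x ∈ openSegment ℝ e.1 e.2) (hx' : x ∈ openSegment ℝ e'.1 e'.2) :
    ∃ r < 0, ∀ z, cross e' z = r * cross e z := by
  have hd : e.2 - e.1 ≠ 0 := sub_ne_zero.2 (K.edge_ne e he).symm
  have hd' : e'.2 - e'.1 ≠ 0 := sub_ne_zero.2 (K.edge_ne e' he').symm
  have hcx : cross e x = 0 := cross_segment (openSegment_subset_segment ℝ _ _ hx)
  have hcx' : cross e' x = 0 := cross_segment (openSegment_subset_segment ℝ _ _ hx')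
  have hadd : ∀ (e : ℂ × ℂ) (z h : ℂ), cross e (z + h) = cross e z + (conj (e.2 - e.1) * h).im := by
    intro e z h
    rw [cross, cross, ← Complex.add_im]
    congr 1
    ring
  have hpar : (conj (e.2 - e.1) * (e'.2 - e'.1)).im = 0 := by
    by_contra hcon
    set κ := (conj (e.2 - e.1) * (e'.2 - e'.1)).im with hκ
    obtain ⟨ρ, hρ, hball⟩ := K.left_mem e he x hx
    obtain ⟨t, ht, rfl⟩ := exists_edgePoint_of_mem_openSegment hx'
    -- Moving along `e'` by `s * κ` makes `cross e` equal to `s * κ²`, which is positive whatever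
    -- the sign of `κ`.
    have hcont : Tendsto (fun s : ℝ => edgePoint e' (t + s * κ)) (𝓝[>] 0) (𝓝 (edgePoint e' t)) := by
      have : Continuous fun s : ℝ => edgePoint e' (t + s * κ) := by unfold edgePoint; fun_prop
      have h1 := (this.tendsto 0).mono_left (nhdsWithin_le_nhds (s := Ioi 0))
      simpa using h1
    have hcont' : Tendsto (fun s : ℝ => t + s * κ) (𝓝[>] 0) (𝓝 t) := by
      have : Continuous fun s : ℝ => t + s * κ := by fun_prop
      have h1 := (this.tendsto 0).mono_left (nhdsWithin_le_nhds (s := Ioi 0))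
      simpa using h1
    obtain ⟨s, hs1, hs2, hs3⟩ := ((hcont.eventually (Metric.ball_mem_nhds _ hρ)).and
      ((hcont'.eventually (isOpen_Ioo.mem_nhds ht)).and self_mem_nhdsWithin)).exists
    have h1 : edgePoint e' (t + s * κ) = edgePoint e' t + ((s * κ : ℝ) : ℂ) * (e'.2 - e'.1) := by
      unfold edgePoint; push_cast; ring
    have h2 : cross e (edgePoint e' (t + s * κ)) = s * κ * κ := by
      rw [h1, hadd, hcx, zero_add, mul_left_comm, Complex.im_ofReal_mul]
    have h3 : 0 < cross e (edgePoint e' (t + s * κ)) := by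
      rw [h2, mul_assoc]
      exact mul_pos hs3 (mul_self_pos.2 hcon)
    exact Set.disjoint_left.1 K.disjoint_frontier (hball _ hs1 h3)
      (K.segment_subset_frontier he' (openSegment_subset_segment ℝ _ _
        (edgePoint_mem_openSegment e' hs2)))
  set r := ((e'.2 - e'.1) / (e.2 - e.1)).re with hr
  have hd2 : e'.2 - e'.1 = (r : ℂ) * (e.2 - e.1) := by
    have him : ((e'.2 - e'.1) / (e.2 - e.1)).im = 0 := by
      have h1 : (e'.2 - e'.1) / (e.2 - e.1) = (conj (e.2 - e.1) * (e'.2 - e'.1)) *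
          ((Complex.normSq (e.2 - e.1))⁻¹ : ℝ) := by
        rw [div_eq_mul_inv, Complex.inv_def]
        push_cast
        ring
      rw [h1, Complex.im_mul_ofReal, hpar, zero_mul]
    have h2 : ((r : ℝ) : ℂ) = (e'.2 - e'.1) / (e.2 - e.1) := Complex.ext (by simp [hr]) (by simp [him])
    rw [h2]
    field_simp
  have hr0 : r < 0 := by
    rcases lt_trichotomy r 0 with h | h | h
    · exact h
    · rw [h] at hd2
      simp at hd2
      exact absurd hd2 hd'
    · refine absurd ?_ (K.opposite e he e' he' hne x hx hx')
      rw [hd2, ← Complex.real_smul]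
      exact SameRay.sameRay_pos_smul_right _ h
  refine ⟨r, hr0, fun z => ?_⟩
  have h1 : ∀ f : ℂ × ℂ, cross f z = cross f x + (conj (f.2 - f.1) * (z - x)).im := by
    intro f
    rw [← hadd]
    congr 1
    ring
  rw [h1 e, h1 e', hcx, hcx', hd2, map_mul, Complex.conj_ofReal, zero_add, zero_add, mul_assoc,
    Complex.im_ofReal_mul]

/-- The parameters of the points of `e` that are not nodes. -/
def PolygonalDomain.regularParam (K : PolygonalDomain) (e : ℂ × ℂ) : Set ℝ :=
  Ioo 0 1 ∩ {t | ∀ e' ∈ K.edges, edgePoint e t ≠ e'.1 ∧ edgePoint e t ≠ e'.2}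

theorem PolygonalDomain.isOpen_regularParam (K : PolygonalDomain) (e : ℂ × ℂ) :
    IsOpen (K.regularParam e) := by
  have hc : Continuous (edgePoint e) := by unfold edgePoint; fun_prop
  have : {t | ∀ e' ∈ K.edges, edgePoint e t ≠ e'.1 ∧ edgePoint e t ≠ e'.2} =
      ⋂ e' ∈ K.edges, {t | edgePoint e t ≠ e'.1 ∧ edgePoint e t ≠ e'.2} := by
    ext t; simp
  rw [regularParam, this]
  refine isOpen_Ioo.inter (isOpen_biInter_finset fun e' _ => ?_)
  exact (isOpen_ne.preimage hc).inter (isOpen_ne.preimage hc)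

theorem PolygonalDomain.ae_mem_regularParam (K : PolygonalDomain) {e : ℂ × ℂ} (he : e.1 ≠ e.2) :
    ∀ᵐ t : ℝ, t ∈ Ioo (0 : ℝ) 1 → t ∈ K.regularParam e := by
  have h1 : ∀ x : ℂ, ∀ᵐ t : ℝ, edgePoint e t ≠ x := by
    intro x
    have : {t : ℝ | ¬ edgePoint e t ≠ x}.Subsingleton := by
      intro t ht t' ht'
      replace ht := not_not.1 ht
      replace ht' := not_not.1 ht'
      have h := ht.trans ht'.symm
      unfold edgePoint at h
      have h2 := mul_right_cancel₀ (sub_ne_zero.2 he.symm) (add_left_cancel h)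
      exact_mod_cast h2
    exact this.measure_zero _
  have h2 : ∀ᵐ t : ℝ, ∀ e' ∈ K.edges, edgePoint e t ≠ e'.1 ∧ edgePoint e t ≠ e'.2 := by
    rw [eventually_all_finset]
    exact fun e' _ => (h1 e'.1).and (h1 e'.2)
  filter_upwards [h2] with t ht ht1
  exact ⟨ht1, ht⟩

/-- A function of `H¹(K)` with a given smooth trace on one edge and vanishing traces on the other
edges. -/
theorem exists_hasWeakGrad_trace {K : PolygonalDomain} {e : ℂ × ℂ} (he : e ∈ K.edges) {φ : ℝ → ℝ}
    (hφ : ContDiff ℝ ∞ φ) (hφc : HasCompactSupport φ) (hφs : tsupport φ ⊆ K.regularParam e) :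
    ∃ w G, HasWeakGrad K w G ∧ IsTrace K e w φ ∧
      ∀ e' ∈ K.edges, e' ≠ e → IsTrace K e' w 0 := by
  have hne := K.edge_ne e he
  obtain ⟨ψ, p1, p2, p3, p4, p5⟩ := exists_extension he hφ hφc (hφs.trans inter_subset_left)
  -- Truncation to the left of `e` removes the extension from the other lip. It creates no jump
  -- inside the domain, because the support of `ψ` meets the line of `e` only in the edge itself.
  set S : Set ℂ := {z | 0 < cross e z} with hS
  have hSo : IsOpen S := isOpen_lt continuous_const (continuous_cross e)
  have hw : HasWeakGrad K (S.indicator ψ) (S.indicator (planeGrad ψ)) := by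
    refine hasWeakGrad_indicator p1 hSo.measurableSet (fun z hz hzψ => ?_)
      ((p1.continuous.memLp_of_hasCompactSupport p2).restrict _)
      (((continuous_planeGrad p1).memLp_of_hasCompactSupport
        (hasCompactSupport_planeGrad p2)).restrict _)
    rcases lt_trichotomy (cross e z) 0 with h | h | h
    · right
      filter_upwards [(isOpen_lt (continuous_cross e) continuous_const).mem_nhds h] with y hy
      exact not_lt.2 (le_of_lt hy)
    · exfalso
      rcases p3 ⟨hzψ, h.ge⟩ with h1 | h1
      · exact h1.2.ne' h
      · exact Set.disjoint_left.1 K.disjoint_frontier hz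
          (K.segment_subset_frontier he (openSegment_subset_segment ℝ _ _ h1))
    · exact Or.inl (hSo.mem_nhds h)
  refine ⟨_, _, hw, ?_, fun e' he' hee => ?_⟩
  · obtain ⟨c, hc, hR⟩ := K.exists_edgeRegion he
    obtain ⟨A, hA⟩ := exists_lipschitz_edgeMap p1 p2 e
    set Q : Set (ℝ × ℝ) := Ioo 0 1 ×ˢ Ioo 0 c with hQ
    have hQm : MeasurableSet Q := measurableSet_Ioo.prod measurableSet_Ioo
    refine hw.isTrace_of_bound he hc hR
      ((hφ.continuous.memLp_of_hasCompactSupport hφc).restrict _)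
      (γ := Q.indicator fun _ => ENNReal.ofReal A) (measurable_const.indicator hQm) ?_
      (Eventually.of_forall fun p hp => ?_)
    · rw [lintegral_indicator hQm, setLIntegral_const, hQ, Measure.volume_eq_prod,
        Measure.prod_prod]
      simp [ENNReal.mul_eq_top]
    · have hp1 := edgeRegion_fst hc hp
      have hpc : p.2 < c := hp.2.1.trans_le (mul_le_of_le_one_right hc.le hp1.2.le)
      rw [indicator_of_mem (show edgeMap e p ∈ S from (cross_edgeMap_pos hne p).2 hp.1)]
      have h1 := hA p.1 p.2
      rw [edgeMap_zero, p4, abs_of_pos hp.1] at h1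
      have h2 : ∫⁻ s in Ioo 0 p.2, Q.indicator (fun _ => ENNReal.ofReal A) (p.1, s) =
          ENNReal.ofReal A * ENNReal.ofReal p.2 := by
        rw [setLIntegral_congr_fun (g := fun _ => ENNReal.ofReal A) measurableSet_Ioo
          (fun s hs => indicator_of_mem (show (p.1, s) ∈ Q from ⟨hp1, hs.1, hs.2.trans hpc⟩) _),
          setLIntegral_const, Real.volume_Ioo, sub_zero]
      have hA0 : 0 ≤ A := nonneg_of_mul_nonneg_left ((abs_nonneg _).trans h1) hp.1
      rw [h2, ← ENNReal.ofReal_mul hA0, ← ofReal_norm]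
      exact ENNReal.ofReal_le_ofReal h1
  · have hne' := K.edge_ne e' he'
    -- An edge sharing an interior point with `e` is the opposite lip, with the domain on the right
    -- of `e`, where the function is zero. Any other edge could meet the truncated support only at a
    -- node of `K`, and regular parameters avoid the nodes.
    by_cases hx : ∃ x ∈ openSegment ℝ e.1 e.2, x ∈ openSegment ℝ e'.1 e'.2
    · obtain ⟨x, hx, hx'⟩ := hx
      obtain ⟨r, hr, hrz⟩ := K.cross_eq_of_mem_inter he he' hee.symm hx hx'
      refine hw.isTrace_zero he' one_pos fun p hp => indicator_of_notMem (fun hz => ?_) _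
      have h1 := (cross_edgeMap_pos hne' p).2 hp.1
      rw [hrz] at h1
      exact absurd (mul_neg_of_neg_of_pos hr hz) (not_lt.2 h1.le)
    · push Not at hx
      have hcl : IsClosed {z | 0 ≤ cross e z} := isClosed_le continuous_const (continuous_cross e)
      obtain ⟨c, hc, h⟩ := exists_edgeRegion_notMem hne' (p2.isCompact.inter_right hcl) (by
        refine Set.disjoint_left.2 fun z hz hz' => ?_
        rcases p3 hz with h1 | h1
        · exact Set.disjoint_left.1 K.disjoint_frontier h1.1 (K.segment_subset_frontier he' hz')
        · obtain ⟨t, ht, rfl⟩ := exists_edgePoint_of_mem_openSegment h1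
          have h2 := (hφs (p5 t hz.1)).2 e' he'
          exact hx _ h1 (mem_openSegment_of_ne_left_right h2.1.symm h2.2.symm hz'))
      refine hw.isTrace_zero he' hc fun p hp => ?_
      by_contra hcon
      have h1 := mem_of_indicator_ne_zero hcon
      rw [indicator_of_mem h1] at hcon
      exact h p hp ⟨subset_tsupport _ hcon, show 0 ≤ cross e _ from le_of_lt h1⟩

/-! ### Polynomials on the element and on its edges -/

theorem analyticOnNhd_of_mem_bulkPoly {p : ℕ} {f : ℂ → ℝ} (hf : f ∈ bulkPoly p) :
    AnalyticOnNhd ℝ f univ := by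
  have hre : AnalyticOnNhd ℝ (fun z : ℂ => z.re) univ := Complex.reCLM.analyticOnNhd univ
  have him : AnalyticOnNhd ℝ (fun z : ℂ => z.im) univ := Complex.imCLM.analyticOnNhd univ
  induction hf using Submodule.span_induction with
  | mem f hf =>
    obtain ⟨k, l, -, rfl⟩ := hf
    exact (hre.pow k).mul (him.pow l)
  | zero => exact analyticOnNhd_const
  | add f g _ _ hf hg => exact hf.add hg
  | smul c f _ hf => exact (analyticOnNhd_const (v := c)).mul hf

theorem analyticOnNhd_of_mem_edgePoly {p : ℕ} {f : ℝ → ℝ} (hf : f ∈ edgePoly p) :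
    AnalyticOnNhd ℝ f univ := by
  induction hf using Submodule.span_induction with
  | mem f hf =>
    obtain ⟨k, -, rfl⟩ := hf
    exact analyticOnNhd_id.pow k
  | zero => exact analyticOnNhd_const
  | add f g _ _ hf hg => exact hf.add hg
  | smul c f _ hf => exact (analyticOnNhd_const (v := c)).mul hf

theorem continuous_of_mem_bulkPoly {p : ℕ} {f : ℂ → ℝ} (hf : f ∈ bulkPoly p) : Continuous f :=
  continuousOn_univ.1 (analyticOnNhd_of_mem_bulkPoly hf).continuousOn

theorem continuous_of_mem_edgePoly {p : ℕ} {f : ℝ → ℝ} (hf : f ∈ edgePoly p) : Continuous f :=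
  continuousOn_univ.1 (analyticOnNhd_of_mem_edgePoly hf).continuousOn

theorem memLp_of_mem_bulkPoly (K : PolygonalDomain) {p : ℕ} {f : ℂ → ℝ} (hf : f ∈ bulkPoly p) :
    MemLp f 2 K.vol := by
  have := K.isFiniteMeasure_vol
  have hc := continuous_of_mem_bulkPoly hf
  obtain ⟨C, hC⟩ := (K.isBounded.isCompact_closure).exists_bound_of_continuousOn hc.continuousOn
  refine MemLp.of_bound hc.aestronglyMeasurable C ?_
  filter_upwards [ae_restrict_mem K.isOpen.measurableSet] with z hz
  exact hC z (subset_closure hz)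

/-- The polynomial spaces consist of functions on the whole plane, while integrals only see `K`; the
identity theorem for analytic functions bridges the gap. -/
theorem eq_zero_of_mem_bulkPoly {K : PolygonalDomain} {p : ℕ} {f : ℂ → ℝ} (hf : f ∈ bulkPoly p)
    (h : f =ᵐ[K.vol] 0) : f = 0 := by
  have h1 := Measure.eqOn_open_of_ae_eq h K.isOpen (continuous_of_mem_bulkPoly hf).continuousOn
    continuousOn_const
  obtain ⟨z, hz⟩ := K.isConnected.nonempty
  exact (analyticOnNhd_of_mem_bulkPoly hf).eq_of_eventuallyEq (z₀ := z) analyticOnNhd_const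
    (h1.eventuallyEq_of_mem (K.isOpen.mem_nhds hz))

theorem eq_zero_of_mem_edgePoly {p : ℕ} {f : ℝ → ℝ} (hf : f ∈ edgePoly p)
    (h : f =ᵐ[volume.restrict (Ioo (0 : ℝ) 1)] 0) : f = 0 := by
  have h1 := Measure.eqOn_open_of_ae_eq h isOpen_Ioo (continuous_of_mem_edgePoly hf).continuousOn
    continuousOn_const
  exact (analyticOnNhd_of_mem_edgePoly hf).eq_of_eventuallyEq (z₀ := 1 / 2) analyticOnNhd_const
    (h1.eventuallyEq_of_mem (isOpen_Ioo.mem_nhds (by norm_num)))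

theorem finite_bulkPoly (p : ℕ) : Module.Finite ℝ (bulkPoly p) := by
  refine FiniteDimensional.span_of_finite ℝ (Set.Finite.subset
    ((Set.finite_Iio p).image2 (fun (k l : ℕ) (z : ℂ) => z.re ^ k * z.im ^ l) (Set.finite_Iio p)) ?_)
  rintro f ⟨k, l, hkl, rfl⟩
  exact ⟨k, by simp only [mem_Iio]; omega, l, by simp only [mem_Iio]; omega, rfl⟩

theorem IsEdgeDual.integrableOn_self {K : PolygonalDomain} {e : ℂ × ℂ} (he : e ∈ K.edges)
    {g : ℝ → ℝ} (hg : IsEdgeDual K e g) : IntegrableOn g (Ioo (0 : ℝ) 1) := by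
  simpa using hg.integrableOn (hasWeakGrad_const K 1) (isTrace_const he 1)

theorem edgeTrace_ae_eq {K : PolygonalDomain} {e : ℂ × ℂ} (he : e ∈ K.edges) {w : ℂ → ℝ}
    {τ : ℝ → ℝ} (h : IsTrace K e w τ) :
    edgeTrace K e w =ᵐ[volume.restrict (Ioo (0 : ℝ) 1)] τ :=
  h.isTrace_edgeTrace.ae_unique he h

/-- The density of the traces: a functional on `H¹(K)` given by a function on `K` and by functions
on the edges determines these functions. -/
theorem ae_eq_zero_of_forall {K : PolygonalDomain} {q : ℂ → ℝ} (hq : MemLp q 2 K.vol)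
    {g : ℂ × ℂ → ℝ → ℝ} (hg : ∀ e ∈ K.edges, IsEdgeDual K e (g e))
    (h : ∀ w H, HasWeakGrad K w H → (∫ z in K.carrier, q z * w z) +
      ∑ e ∈ K.edges, ∫ t in Ioo (0 : ℝ) 1, g e t * edgeTrace K e w t = 0) :
    q =ᵐ[K.vol] 0 ∧ ∀ e ∈ K.edges, g e =ᵐ[volume.restrict (Ioo (0 : ℝ) 1)] 0 := by
  have := K.isFiniteMeasure_vol
  have hzero : ∀ e ∈ K.edges, ∀ w, IsTrace K e w 0 →
      ∫ t in Ioo (0 : ℝ) 1, g e t * edgeTrace K e w t = 0 := by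
    intro e he w hw
    refine integral_eq_zero_of_ae ?_
    filter_upwards [edgeTrace_ae_eq he hw] with t ht
    simp [ht]
  -- Test functions on `K` have zero traces, so they isolate `q`; afterwards the lifted edge
  -- functions isolate one `g e` at a time.
  have hq0 : q =ᵐ[K.vol] 0 := by
    have key : ∀ᵐ z, z ∈ K.carrier → q z = 0 := by
      refine K.isOpen.ae_eq_zero_of_integral_contDiff_smul_eq_zero
        (IntegrableOn.locallyIntegrableOn (hq.integrable (by norm_num))) fun ψ p1 p2 p3 => ?_
      have ht : IsTest K.carrier ψ := ⟨p1, p2, p3⟩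
      have h1 := h ψ _ (hasWeakGrad_of_contDiff p1 p2)
      rw [Finset.sum_eq_zero fun e he => hzero e he ψ (ht.isTrace_zero he), add_zero] at h1
      rw [← h1, ← setIntegral_eq_integral_of_forall_compl_eq_zero (s := K.carrier)]
      · simp only [smul_eq_mul, mul_comm]
      · intro z hz
        rw [image_eq_zero_of_notMem_tsupport fun h => hz (p3 h), zero_smul]
    rw [EventuallyEq, ae_restrict_iff' K.isOpen.measurableSet]
    exact key
  refine ⟨hq0, fun e he => ?_⟩
  have hgi := (hg e he).integrableOn_self he
  have key : ∀ᵐ t, t ∈ K.regularParam e → g e t = 0 := by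
    refine (K.isOpen_regularParam e).ae_eq_zero_of_integral_contDiff_smul_eq_zero
      (hgi.mono_set inter_subset_left).locallyIntegrableOn fun φ p1 p2 p3 => ?_
    obtain ⟨w, G, hw, hτ, hτ0⟩ := exists_hasWeakGrad_trace he p1 p2 p3
    have h1 := h w G hw
    have h2 : ∫ z in K.carrier, q z * w z = 0 := by
      refine integral_eq_zero_of_ae ?_
      filter_upwards [hq0] with z hz
      simp [hz]
    rw [h2, zero_add, Finset.sum_eq_single_of_mem e he
      fun e' he' hee => hzero e' he' w (hτ0 e' he' hee)] at h1
    rw [← h1, ← setIntegral_eq_integral_of_forall_compl_eq_zero (s := Ioo (0 : ℝ) 1)]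
    · refine integral_congr_ae ?_
      filter_upwards [edgeTrace_ae_eq he hτ] with t ht
      rw [ht, smul_eq_mul, mul_comm]
    · intro t ht
      rw [image_eq_zero_of_notMem_tsupport fun h => ht (p3 h).1, zero_smul]
  rw [EventuallyEq, ae_restrict_iff' measurableSet_Ioo]
  filter_upwards [key, K.ae_mem_regularParam (K.edge_ne e he)] with t h1 h2 h3
  exact h1 (h2 h3)

/-! ### Coercive variational problems and the norm of `H¹(K)` -/

/-- Abstract unisolvence: the solutions of variational problems whose right-hand sides are spanned
by finitely many independent functionals are parametrized by the values of these functionals. -/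
theorem exists_of_coercive {M N ι : Type*} [NormedAddCommGroup M] [InnerProductSpace ℝ M]
    [CompleteSpace M] [NormedAddCommGroup N] [InnerProductSpace ℝ N] [Fintype ι]
    (D : M →L[ℝ] N) (Λ : ι → M →L[ℝ] ℝ) {c : ℝ} (hc : 0 < c)
    (hcoer : ∀ x, c * ‖x‖ ^ 2 ≤ ‖D x‖ ^ 2 + ∑ i, Λ i x ^ 2)
    (hli : ∀ μ : ι → ℝ, (∀ z, ∑ i, μ i * Λ i z = 0) → μ = 0) :
    (∀ x, ∀ μ : ι → ℝ, (∀ z, ⟪D x, D z⟫ = ∑ i, μ i * Λ i z) → (∀ i, Λ i x = 0) → x = 0) ∧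
      ∀ y : ι → ℝ, ∃ x, ∃ μ : ι → ℝ, (∀ z, ⟪D x, D z⟫ = ∑ i, μ i * Λ i z) ∧
        ∀ i, Λ i x = y i := by
  have hinj : ∀ x, ∀ μ : ι → ℝ, (∀ z, ⟪D x, D z⟫ = ∑ i, μ i * Λ i z) → (∀ i, Λ i x = 0) →
      x = 0 := by
    intro x μ h h0
    have h1 := hcoer x
    have h2 := h x
    simp only [h0, mul_zero, Finset.sum_const_zero, real_inner_self_eq_norm_sq] at h2
    simp only [h0, h2, ne_eq, OfNat.ofNat_ne_zero, not_false_eq_true, zero_pow,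
      Finset.sum_const_zero, add_zero] at h1
    have h3 : ‖x‖ ^ 2 = 0 := le_antisymm (nonpos_of_mul_nonpos_right h1 hc) (by positivity)
    exact norm_eq_zero.1 (pow_eq_zero_iff (by norm_num) |>.1 h3)
  refine ⟨hinj, ?_⟩
  set I : N →L[ℝ] N →L[ℝ] ℝ := (innerₗ N).mkContinuous₂ 1 fun x y => by
    simpa using norm_inner_le_norm (𝕜 := ℝ) x y
  -- Adding the squares of the functionals to the degenerate form of `D` makes it coercive.
  set B : M →L[ℝ] M →L[ℝ] ℝ := I.bilinearComp D D + ∑ i, (Λ i).smulRight (Λ i) with hB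
  have hBa : ∀ x z, B x z = ⟪D x, D z⟫ + ∑ i, Λ i x * Λ i z := by
    intro x z
    simp [hB, I]
  have hBc : IsCoercive B := by
    refine ⟨c, hc, fun u => ?_⟩
    rw [hBa, real_inner_self_eq_norm_sq]
    have := hcoer u
    simp only [sq] at this ⊢
    linarith
  have hx : ∀ i, ∃ x, ∀ z, B x z = Λ i z := by
    intro i
    refine ⟨hBc.continuousLinearEquivOfBilin.symm ((InnerProductSpace.toDual ℝ M).symm (Λ i)),
      fun z => ?_⟩
    rw [← hBc.continuousLinearEquivOfBilin_apply, ContinuousLinearEquiv.apply_symm_apply,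
      InnerProductSpace.toDual_symm_apply]
  choose x hx using hx
  set T : (ι → ℝ) →ₗ[ℝ] M := Fintype.linearCombination ℝ x with hT
  -- Moving the added terms to the right shows that every `T μ` solves a problem of the required
  -- form, with coefficients `μ - Λ (T μ)`.
  have hTB : ∀ μ z, ⟪D (T μ), D z⟫ = ∑ i, (μ i - Λ i (T μ)) * Λ i z := by
    intro μ z
    have h1 : B (T μ) z = ∑ i, μ i * Λ i z := by
      rw [hT, Fintype.linearCombination_apply, map_sum, sum_apply]
      refine Finset.sum_congr rfl fun i _ => ?_
      rw [map_smul, smul_apply, hx, smul_eq_mul]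
    rw [hBa] at h1
    simp only [sub_mul, Finset.sum_sub_distrib]
    linarith
  set Φ : (ι → ℝ) →ₗ[ℝ] (ι → ℝ) := (LinearMap.pi fun i => (Λ i).toLinearMap) ∘ₗ T with hΦ
  -- If all `Λ i (T μ)` vanish, then `T μ = 0` by uniqueness, so `∑ μ i Λ i = 0` and independence
  -- gives `μ = 0`. Being square, `Φ` is then onto.
  have hΦi : Function.Injective Φ := by
    rw [injective_iff_map_eq_zero]
    intro μ hμ
    have h0 : ∀ i, Λ i (T μ) = 0 := fun i => congrFun hμ i
    have hT0 := hinj (T μ) _ (hTB μ) h0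
    refine hli μ fun z => ?_
    have := hTB μ z
    rw [hT0] at this
    simpa using this.symm
  intro y
  obtain ⟨μ, hμ⟩ := (LinearMap.injective_iff_surjective.1 hΦi) y
  exact ⟨T μ, _, hTB μ, fun i => congrFun hμ i⟩

/-- Poincaré gives a constant `c` close to `w`. This `c` is the mean of the trace of `w` minus the
mean of the trace of `w - c`, and the latter is bounded by the gradient through the trace estimate.
-/
theorem PolygonalDomain.exists_norm_le (K : PolygonalDomain) {e : ℂ × ℂ} (he : e ∈ K.edges) :
    ∃ C : ENNReal, C ≠ ⊤ ∧ ∀ w G, HasWeakGrad K w G → sobolevSq K w G ≤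
      C * ((∫⁻ z in K.carrier, ‖G z‖ₑ ^ 2) + ‖∫ t in Ioo (0 : ℝ) 1, edgeTrace K e w t‖ₑ ^ 2) := by
  have := K.isFiniteMeasure_vol
  obtain ⟨M, hM, hP⟩ := K.poincare
  obtain ⟨-, C₁, hC₁, h1⟩ :=
    (isEdgeWeight_of_continuous (continuous_const (y := (1 : ℝ)))).isEdgeDual he
  set V := volume K.carrier with hV
  have hVt : V ≠ ⊤ := K.isBounded.measure_lt_top.ne
  refine ⟨1 + 2 * M + 4 * V + 4 * V * (C₁ * (M + 1)), by finiteness, fun w G hw => ?_⟩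
  obtain ⟨c, hc⟩ := hP w G hw
  set N := ∫⁻ z in K.carrier, ‖G z‖ₑ ^ 2 with hN
  set X := ‖∫ t in Ioo (0 : ℝ) 1, edgeTrace K e w t‖ₑ ^ 2 with hX
  have hwc : HasWeakGrad K (fun z => w z - c) G := by
    have h := (hasWeakGrad_const K c).lin (-1) hw
    simp only [smul_zero, zero_add] at h
    convert h using 1
    ext z
    simp
    ring
  have ht0 := hw.isTrace_edgeTrace he
  have ht : IsTrace K e (fun z => w z - c) fun t => edgeTrace K e w t - c := by
    have h := (isTrace_const he c).lin (-1) ht0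
    have e1 : (-1 : ℝ) • (fun _ : ℂ => c) + w = fun z => w z - c := by
      ext z; simp; ring
    have e2 : (-1 : ℝ) • (fun _ : ℝ => c) + edgeTrace K e w = fun t => edgeTrace K e w t - c := by
      ext z; simp; ring
    rwa [e1, e2] at h
  have h2 := h1 _ G _ hwc ht
  simp only [one_mul] at h2
  have h3 : (∫⁻ t in Ioo (0 : ℝ) 1, ‖edgeTrace K e w t - c‖ₑ) ^ 2 ≤ C₁ * (M + 1) * N := by
    refine h2.trans ?_
    rw [mul_assoc, sobolevSq, add_mul, one_mul]
    gcongr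
  have hi : IntegrableOn (edgeTrace K e w) (Ioo 0 1) := ht0.1.integrable (by norm_num)
  have h4 : c = (∫ t in Ioo (0 : ℝ) 1, edgeTrace K e w t) +
      -∫ t in Ioo (0 : ℝ) 1, (edgeTrace K e w t - c) := by
    rw [integral_sub hi (by simp)]
    simp
  have h5 : ‖c‖ₑ ^ 2 ≤ 2 * X + 2 * (C₁ * (M + 1) * N) := by
    rw [h4]
    refine (enorm_add_sq_le _ _).trans ?_
    rw [enorm_neg]
    gcongr
    exact (pow_le_pow_left' (enorm_integral_le_lintegral_enorm _) 2).trans h3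
  have h6 : ∫⁻ z in K.carrier, ‖w z‖ₑ ^ 2 ≤ 2 * (M * N) + 2 * (‖c‖ₑ ^ 2 * V) := by
    calc ∫⁻ z in K.carrier, ‖w z‖ₑ ^ 2
        ≤ ∫⁻ z in K.carrier, (2 * ‖w z - c‖ₑ ^ 2 + 2 * ‖c‖ₑ ^ 2) := by
          refine lintegral_mono fun z => ?_
          have := enorm_add_sq_le (w z - c) c
          rwa [sub_add_cancel] at this
      _ = 2 * (∫⁻ z in K.carrier, ‖w z - c‖ₑ ^ 2) + 2 * (‖c‖ₑ ^ 2 * V) := by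
          rw [lintegral_add_right _ measurable_const, lintegral_const_mul' _ _ (by norm_num),
            setLIntegral_const, mul_assoc]
      _ ≤ _ := by gcongr
  calc sobolevSq K w G ≤ (2 * (M * N) + 2 * ((2 * X + 2 * (C₁ * (M + 1) * N)) * V)) + N := by
        unfold sobolevSq
        gcongr
        exact h6.trans (by gcongr)
    _ = (1 + 2 * M + 4 * V * (C₁ * (M + 1))) * N + 4 * V * X := by ring
    _ ≤ (1 + 2 * M + 4 * V + 4 * V * (C₁ * (M + 1))) * N +
        (1 + 2 * M + 4 * V + 4 * V * (C₁ * (M + 1))) * X := by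
        have a1 : 1 + 2 * M + 4 * V * (C₁ * (M + 1)) ≤
            1 + 2 * M + 4 * V + 4 * V * (C₁ * (M + 1)) := by
          rw [add_assoc (1 + 2 * M)]
          exact add_le_add le_rfl le_add_self
        have a2 : 4 * V ≤ 1 + 2 * M + 4 * V + 4 * V * (C₁ * (M + 1)) :=
          le_add_right le_add_self
        exact add_le_add (mul_le_mul' a1 le_rfl) (mul_le_mul' a2 le_rfl)
    _ = _ := by ring

/-! ### `H¹(K)` as a Hilbert space and its functionals -/

theorem Lp_enorm_sq {α E : Type*} [MeasurableSpace α] {μ : Measure α} [NormedAddCommGroup E]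
    (f : Lp E 2 μ) : ‖f‖ₑ ^ 2 = ∫⁻ x, ‖f x‖ₑ ^ 2 ∂μ := by
  rw [Lp.enorm_def, eLpNorm_eq_lintegral_rpow_enorm_toReal (by norm_num) (by norm_num),
    ← ENNReal.rpow_natCast, ← ENNReal.rpow_mul]
  norm_num

theorem HasWeakGrad.congr_grad {K : PolygonalDomain} {w : ℂ → ℝ} {G G' : ℂ → ℂ}
    (h : HasWeakGrad K w G) (hG : G =ᵐ[K.vol] G') : HasWeakGrad K w G' := by
  obtain ⟨h1, h2, h3⟩ := h
  refine ⟨h1, (memLp_congr_ae hG).1 h2, fun ψ hψ u => ?_⟩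
  rw [h3 ψ hψ u]
  congr 1
  refine integral_congr_ae ?_
  filter_upwards [hG] with z hz
  rw [hz]

/-- `H¹(K)`: pairs of a function and its weak gradient. -/
def sobolevSpace (K : PolygonalDomain) :
    Submodule ℝ (WithLp 2 (Lp ℝ 2 K.vol × Lp ℂ 2 K.vol)) where
  carrier := {x | HasWeakGrad K x.fst x.snd}
  zero_mem' := by
    have h : HasWeakGrad K 0 0 := ⟨MemLp.zero', MemLp.zero', by simp⟩
    exact (h.congr (Lp.coeFn_zero ℝ 2 K.vol).symm).congr_grad (Lp.coeFn_zero ℂ 2 K.vol).symm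
  add_mem' := by
    intro x y hx hy
    have h := hx.lin 1 hy
    simp only [one_smul] at h
    exact (h.congr (Lp.coeFn_add x.fst y.fst).symm).congr_grad (Lp.coeFn_add x.snd y.snd).symm
  smul_mem' := by
    intro c x hx
    have h := hx.lin c (hasWeakGrad_const K 0)
    have e1 : c • (x.fst : ℂ → ℝ) + (fun _ => 0) = c • (x.fst : ℂ → ℝ) := add_zero _
    rw [add_zero, e1] at h
    exact (h.congr (Lp.coeFn_smul c x.fst).symm).congr_grad (Lp.coeFn_smul c x.snd).symm

theorem mem_sobolevSpace {K : PolygonalDomain} {x : WithLp 2 (Lp ℝ 2 K.vol × Lp ℂ 2 K.vol)} :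
    x ∈ sobolevSpace K ↔ HasWeakGrad K x.fst x.snd := Iff.rfl

/-- For each test function and direction, both sides of the defining identity are inner products in
`L²` with fixed elements. Closedness gives the completeness that Lax–Milgram needs. -/
theorem isClosed_sobolevSpace (K : PolygonalDomain) :
    IsClosed (sobolevSpace K : Set (WithLp 2 (Lp ℝ 2 K.vol × Lp ℂ 2 K.vol))) := by
  have : (sobolevSpace K : Set (WithLp 2 (Lp ℝ 2 K.vol × Lp ℂ 2 K.vol))) =
      ⋂ ψ, ⋂ (_ : IsTest K.carrier ψ), ⋂ u : ℂ, {x | ∫ z in K.carrier, x.fst z * fderiv ℝ ψ z u =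
        -∫ z in K.carrier, ⟪x.snd z, u⟫ * ψ z} := by
    ext x
    simp only [mem_iInter]
    exact ⟨fun h => h.2.2, fun h => ⟨Lp.memLp _, Lp.memLp _, h⟩⟩
  rw [this]
  refine isClosed_iInter fun ψ => isClosed_iInter fun hψ => isClosed_iInter fun u => ?_
  have h1 : MemLp (fun z => fderiv ℝ ψ z u) 2 K.vol := (hψ.memLp_fderiv u).restrict _
  have h2 : MemLp (fun z => (ψ z : ℂ) * u) 2 K.vol := (hψ.memLp.ofReal).mul_const u
  have e1 : ∀ f : Lp ℝ 2 K.vol, ∫ z in K.carrier, f z * fderiv ℝ ψ z u = ⟪h1.toLp _, f⟫ := by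
    intro f
    rw [L2.inner_def]
    refine integral_congr_ae ?_
    filter_upwards [h1.coeFn_toLp] with z hz
    rw [hz]
    simp
  have e2 : ∀ f : Lp ℂ 2 K.vol, ∫ z in K.carrier, ⟪f z, u⟫ * ψ z = ⟪h2.toLp _, f⟫ := by
    intro f
    rw [L2.inner_def]
    refine integral_congr_ae ?_
    filter_upwards [h2.coeFn_toLp] with z hz
    rw [hz, ← Complex.real_smul, real_inner_smul_left, real_inner_comm, mul_comm]
  simp only [e1, e2]
  refine isClosed_eq ?_ ?_
  · exact continuous_const.inner (WithLp.continuous_fst ..)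
  · exact (continuous_const.inner (WithLp.continuous_snd ..)).neg

theorem sobolevSq_eq {K : PolygonalDomain} (x : WithLp 2 (Lp ℝ 2 K.vol × Lp ℂ 2 K.vol)) :
    sobolevSq K x.fst x.snd = ENNReal.ofReal (‖x‖ ^ 2) := by
  rw [WithLp.prod_norm_sq_eq_of_L2, ENNReal.ofReal_add (by positivity) (by positivity),
    ENNReal.ofReal_pow (norm_nonneg _), ENNReal.ofReal_pow (norm_nonneg _), ofReal_norm,
    ofReal_norm, Lp_enorm_sq, Lp_enorm_sq]
  rfl

/-- The functionals on `H¹(K)` defined by functions on an edge. -/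
theorem IsEdgeDual.exists_clm {K : PolygonalDomain} {e : ℂ × ℂ} (he : e ∈ K.edges) {g : ℝ → ℝ}
    (hg : IsEdgeDual K e g) : ∃ L : sobolevSpace K →L[ℝ] ℝ, ∀ x : sobolevSpace K,
      L x = ∫ t in Ioo (0 : ℝ) 1, g t * edgeTrace K e x.1.fst t := by
  have htr : ∀ x : sobolevSpace K, IsTrace K e x.1.fst (edgeTrace K e x.1.fst) := fun x =>
    (mem_sobolevSpace.1 x.2).isTrace_edgeTrace he
  have hi : ∀ x : sobolevSpace K,
      IntegrableOn (fun t => g t * edgeTrace K e x.1.fst t) (Ioo (0 : ℝ) 1) := fun x =>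
    hg.integrableOn (mem_sobolevSpace.1 x.2) (htr x)
  have hlin : ∀ (c : ℝ) (x y : sobolevSpace K),
      ∫ t in Ioo (0 : ℝ) 1, g t * edgeTrace K e (c • x + y).1.fst t =
        c * (∫ t in Ioo (0 : ℝ) 1, g t * edgeTrace K e x.1.fst t) +
          ∫ t in Ioo (0 : ℝ) 1, g t * edgeTrace K e y.1.fst t := by
    intro c x y
    have h1 : IsTrace K e (c • x + y).1.fst
        (c • edgeTrace K e x.1.fst + edgeTrace K e y.1.fst) := by
      refine ((htr x).lin c (htr y)).congr ?_
      filter_upwards [Lp.coeFn_add (c • x.1.fst) y.1.fst, Lp.coeFn_smul c x.1.fst] with z h1 h2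
      rw [Pi.add_apply, ← h2, ← Pi.add_apply, ← h1]
      rfl
    rw [← integral_const_mul, ← integral_add ((hi x).const_mul c) (hi y)]
    refine integral_congr_ae ?_
    filter_upwards [edgeTrace_ae_eq he h1] with t ht
    rw [ht]
    simp only [Pi.add_apply, Pi.smul_apply, smul_eq_mul]
    ring
  let L : sobolevSpace K →ₗ[ℝ] ℝ :=
    { toFun := fun x => ∫ t in Ioo (0 : ℝ) 1, g t * edgeTrace K e x.1.fst t
      map_add' := fun x y => by simpa using hlin 1 x y
      map_smul' := fun c x => by
        have h0 : ∫ t in Ioo (0 : ℝ) 1, g t * edgeTrace K e (0 : sobolevSpace K).1.fst t = 0 := by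
          have := hlin 0 0 0
          have h := hlin 1 0 0
          simp only [smul_zero, add_zero] at h
          linarith
        have h := hlin c x 0
        rw [h0, add_zero, add_zero] at h
        exact h }
  obtain ⟨-, C, hC, hb⟩ := hg
  refine ⟨L.mkContinuous (Real.sqrt C.toReal) fun x => ?_, fun x => rfl⟩
  have h1 := hb _ _ _ (mem_sobolevSpace.1 x.2) (htr x)
  rw [sobolevSq_eq] at h1
  have h2 : ‖L x‖ₑ ^ 2 ≤ C * ENNReal.ofReal (‖x‖ ^ 2) :=
    (pow_le_pow_left' (enorm_integral_le_lintegral_enorm _) 2).trans h1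
  rw [← ofReal_norm, ← ENNReal.ofReal_pow (norm_nonneg _), ← ENNReal.ofReal_toReal hC,
    ← ENNReal.ofReal_mul (by positivity), ENNReal.ofReal_le_ofReal_iff (by positivity)] at h2
  refine le_of_sq_le_sq ?_ (by positivity)
  rw [mul_pow, Real.sq_sqrt (by positivity)]
  exact h2

theorem exists_clm_bulk {K : PolygonalDomain} {q : ℂ → ℝ} (hq : MemLp q 2 K.vol) :
    ∃ L : sobolevSpace K →L[ℝ] ℝ, ∀ x : sobolevSpace K,
      L x = ∫ z in K.carrier, q z * x.1.fst z := by
  refine ⟨(innerSL ℝ (hq.toLp q)) ∘L (WithLp.fstL 2 ℝ (Lp ℝ 2 K.vol) (Lp ℂ 2 K.vol)) ∘L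
    (sobolevSpace K).subtypeL, fun x => ?_⟩
  change ⟪hq.toLp q, x.1.fst⟫ = _
  rw [L2.inner_def]
  refine integral_congr_ae ?_
  filter_upwards [hq.coeFn_toLp] with z hz
  rw [hz]
  simp [mul_comm]

theorem IsEdgeDual.add {K : PolygonalDomain} {e : ℂ × ℂ} {g g' : ℝ → ℝ} (h : IsEdgeDual K e g)
    (h' : IsEdgeDual K e g') : IsEdgeDual K e (g + g') := by
  obtain ⟨hm, C, hC, hb⟩ := h
  obtain ⟨hm', C', hC', hb'⟩ := h'
  refine ⟨hm.add hm', 2 * (C + C'), by finiteness, fun w G τ hw hτ => ?_⟩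
  have h1 : ∫⁻ t in Ioo (0 : ℝ) 1, ‖(g + g') t * τ t‖ₑ ≤
      (∫⁻ t in Ioo (0 : ℝ) 1, ‖g t * τ t‖ₑ) + ∫⁻ t in Ioo (0 : ℝ) 1, ‖g' t * τ t‖ₑ := by
    have i1 : AEMeasurable (fun t => ‖g t * τ t‖ₑ) (volume.restrict (Ioo (0 : ℝ) 1)) :=
      (hm.mul hτ.1.1).enorm
    rw [← lintegral_add_left' i1]
    refine lintegral_mono fun t => ?_
    rw [Pi.add_apply, add_mul]
    exact enorm_add_le _ _
  have h2 := ENNReal.rpow_add_le_mul_rpow_add_rpow (∫⁻ t in Ioo (0 : ℝ) 1, ‖g t * τ t‖ₑ)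
    (∫⁻ t in Ioo (0 : ℝ) 1, ‖g' t * τ t‖ₑ) (p := 2) (by norm_num)
  have e1 : (2 : ℝ) - 1 = 1 := by norm_num
  rw [e1, ENNReal.rpow_one, ENNReal.rpow_ofNat, ENNReal.rpow_ofNat, ENNReal.rpow_ofNat] at h2
  calc _ ≤ _ := pow_le_pow_left' h1 2
    _ ≤ _ := h2
    _ ≤ 2 * (C * sobolevSq K w G + C' * sobolevSq K w G) := by
        gcongr
        exacts [hb w G τ hw hτ, hb' w G τ hw hτ]
    _ = _ := by ring

theorem IsEdgeDual.const_smul {K : PolygonalDomain} {e : ℂ × ℂ} {g : ℝ → ℝ} (h : IsEdgeDual K e g)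
    (c : ℝ) : IsEdgeDual K e (c • g) := by
  obtain ⟨hm, C, hC, hb⟩ := h
  refine ⟨hm.const_smul c, ‖c‖ₑ ^ 2 * C, by finiteness, fun w G τ hw hτ => ?_⟩
  simp only [Pi.smul_apply, smul_eq_mul, mul_assoc, enorm_mul c]
  rw [lintegral_const_mul' _ _ enorm_ne_top, mul_pow]
  gcongr
  exact hb w G τ hw hτ

/-! ### The local space as the solutions of variational problems -/

/-- The index set of the functionals. -/
abbrev DofIndex (K : PolygonalDomain) (κ : Type*) (p : ℕ) (F : Set (ℂ × ℂ)) :=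
  κ ⊕ ({e // e ∈ K.edges} × Fin p) ⊕ {e // e ∈ K.edges ∧ e ∈ F}

section Unisolvence

variable {K : PolygonalDomain} {κ : Type*} {p : ℕ} {s : ℂ × ℂ → ℝ → ℝ} {E₁ F : Set (ℂ × ℂ)}
  {n : ℂ × ℂ → ℂ}

theorem exists_clm_dofs {m : κ → ℂ → ℝ} (hm : ∀ k, MemLp (m k) 2 K.vol)
    {b : ℂ × ℂ → Fin p → ℝ → ℝ} (hb : ∀ e l, Continuous (b e l))
    (hs : ∀ e ∈ K.edges, IsEdgeDual K e (s e))
    (i : κ ⊕ ({e // e ∈ K.edges} × Fin p) ⊕ {e // e ∈ K.edges ∧ e ∈ F}) :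
    ∃ L : sobolevSpace K →L[ℝ] ℝ, ∀ x : sobolevSpace K, L x = dofs K m b s F x.1.fst i := by
  rcases i with k | ⟨e, l⟩ | e
  · obtain ⟨L, hL⟩ := exists_clm_bulk (hm k)
    refine ⟨(volume.real K.carrier)⁻¹ • L, fun x => ?_⟩
    rw [smul_apply, hL, dofs, smul_eq_mul]
    simp only [mul_comm (m k _)]
  · obtain ⟨L, hL⟩ := ((isEdgeWeight_of_continuous (hb e l)).isEdgeDual e.2).exists_clm e.2
    refine ⟨((edgeLength e)⁻¹ * edgeLength e) • L, fun x => ?_⟩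
    rw [smul_apply, hL, dofs, edgeIntegral, smul_eq_mul, mul_assoc]
    simp only [mul_comm (b e l _)]
  · obtain ⟨L, hL⟩ := (hs e e.2.1).exists_clm e.2.1
    refine ⟨edgeLength e • L, fun x => ?_⟩
    rw [smul_apply, hL, dofs, edgeIntegral, smul_eq_mul]
    simp only [mul_comm (s e _)]

theorem exists_mem_sobolevSpace {v : Lp ℝ 2 K.vol} {G : ℂ → ℂ} (h : HasWeakGrad K v G) :
    ∃ x : sobolevSpace K, x.1.fst = v ∧ x.1.snd =ᵐ[K.vol] G :=
  ⟨⟨WithLp.toLp 2 (v, h.2.1.toLp G), h.congr_grad h.2.1.coeFn_toLp.symm⟩, rfl, h.2.1.coeFn_toLp⟩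

open Classical in
/-- The coefficients of the edge moments in a combination of the functionals. -/
def edgeCoeff (μ : DofIndex K κ p F → ℝ)
    (e : ℂ × ℂ) (l : Fin p) : ℝ :=
  if h : e ∈ K.edges then μ (.inr (.inl (⟨e, h⟩, l))) else 0

open Classical in
/-- The coefficients of the special moments in a combination of the functionals. -/
def specialCoeff (μ : DofIndex K κ p F → ℝ)
    (e : ℂ × ℂ) : ℝ :=
  if h : e ∈ K.edges ∧ e ∈ F then μ (.inr (.inr ⟨e, h⟩)) else 0

/-- The function on an edge which represents a combination of the functionals. -/
def edgeCombination (b : ℂ × ℂ → Fin p → ℝ → ℝ) (s : ℂ × ℂ → ℝ → ℝ)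
    (μ : DofIndex K κ p F → ℝ) (e : ℂ × ℂ) :
    ℝ → ℝ :=
  ∑ l, edgeCoeff μ e l • b e l + (specialCoeff μ e * edgeLength e) • s e

/-- The function on the element which represents a combination of the functionals. -/
def bulkCombination [Fintype κ] (m : κ → ℂ → ℝ)
    (μ : DofIndex K κ p F → ℝ) : ℂ → ℝ :=
  ∑ k, (μ (.inl k) * (volume.real K.carrier)⁻¹) • m k

theorem IsEdgeDual.edgeCombination {b : ℂ × ℂ → Fin p → ℝ → ℝ} (hb : ∀ e l, Continuous (b e l))
    (hs : ∀ e ∈ K.edges, IsEdgeDual K e (s e))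
    (μ : DofIndex K κ p F → ℝ) {e : ℂ × ℂ}
    (he : e ∈ K.edges) : IsEdgeDual K e (edgeCombination b s μ e) := by
  refine IsEdgeDual.add (IsEdgeWeight.isEdgeDual he (isEdgeWeight_of_continuous ?_))
    ((hs e he).const_smul _)
  simp only [Finset.sum_fn]
  exact continuous_finsetSum _ fun l _ => continuous_const.mul (hb e l)

/-- The dictionary between combinations of functionals and right-hand sides of Green's formula. Edge
moments are normalized by the length, which cancels the arc length factor; special moments are not,
so they carry `edgeLength e`. -/
theorem sum_mul_dofs [Fintype κ] [Fintype {e // e ∈ K.edges ∧ e ∈ F}] {m : κ → ℂ → ℝ}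
    (hm : ∀ k, MemLp (m k) 2 K.vol)
    {b : ℂ × ℂ → Fin p → ℝ → ℝ} (hb : ∀ e l, Continuous (b e l))
    (hs : ∀ e ∈ K.edges, IsEdgeDual K e (s e))
    (μ : DofIndex K κ p F → ℝ) {w : ℂ → ℝ} {H : ℂ → ℂ}
    (hw : HasWeakGrad K w H) :
    ∑ i, μ i * dofs K m b s F w i = (∫ z in K.carrier, bulkCombination m μ z * w z) +
      ∑ e ∈ K.edges, ∫ t in Ioo (0 : ℝ) 1, edgeCombination b s μ e t * edgeTrace K e w t := by
  classical
  have h1 : ∫ z in K.carrier, bulkCombination m μ z * w z =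
      ∑ k, μ (.inl k) * dofs K m b s F w (.inl k) := by
    have e1 : ∀ z, bulkCombination m μ z * w z =
        ∑ k, (μ (.inl k) * (volume.real K.carrier)⁻¹) * (w z * m k z) := by
      intro z
      simp only [bulkCombination, Finset.sum_apply, Pi.smul_apply, smul_eq_mul, Finset.sum_mul]
      exact Finset.sum_congr rfl fun k _ => by ring
    have i1 : ∀ k, Integrable (fun z => w z * m k z) K.vol := fun k => hw.1.integrable_mul (hm k)
    simp only [e1]
    rw [integral_finsetSum _ fun k _ => (i1 k).const_mul _]
    refine Finset.sum_congr rfl fun k _ => ?_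
    rw [integral_const_mul, dofs, mul_assoc]
  have h2 : ∀ e ∈ K.edges,
      ∫ t in Ioo (0 : ℝ) 1, edgeCombination b s μ e t * edgeTrace K e w t =
      (∑ l, edgeCoeff μ e l * ((edgeLength e)⁻¹ *
        edgeIntegral e fun t => edgeTrace K e w t * b e l t)) +
      specialCoeff μ e * edgeIntegral e fun t => edgeTrace K e w t * s e t := by
    intro e he
    have hL := edgeLength_pos (K.edge_ne e he)
    have ht := hw.isTrace_edgeTrace he
    have i1 : ∀ l, IntegrableOn (fun t => b e l t * edgeTrace K e w t) (Ioo 0 1) := fun l =>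
      ((isEdgeWeight_of_continuous (hb e l)).isEdgeDual he).integrableOn hw ht
    have i2 := (hs e he).integrableOn hw ht
    have e1 : ∀ t, edgeCombination b s μ e t * edgeTrace K e w t =
        (∑ l, edgeCoeff μ e l * (b e l t * edgeTrace K e w t)) +
          specialCoeff μ e * edgeLength e * (s e t * edgeTrace K e w t) := by
      intro t
      simp only [edgeCombination, Pi.add_apply, Finset.sum_apply, Pi.smul_apply, smul_eq_mul,
        add_mul, Finset.sum_mul, mul_assoc]
    simp only [e1]
    rw [integral_add (integrable_finsetSum _ fun l _ => (i1 l).const_mul _) (i2.const_mul _),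
      integral_finsetSum _ fun l _ => (i1 l).const_mul _]
    congr 1
    · refine Finset.sum_congr rfl fun l _ => ?_
      rw [integral_const_mul, edgeIntegral, inv_mul_cancel_left₀ hL.ne']
      simp only [mul_comm (b e l _)]
    · rw [integral_const_mul, edgeIntegral, mul_assoc]
      simp only [mul_comm (s e _)]
  rw [Fintype.sum_sum_type, Fintype.sum_sum_type, h1, Finset.sum_congr rfl h2,
    Finset.sum_add_distrib]
  congr 2
  · rw [Fintype.sum_prod_type, ← Finset.sum_coe_sort K.edges]
    refine Finset.sum_congr rfl fun e _ => Finset.sum_congr rfl fun l _ => ?_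
    rw [edgeCoeff, dif_pos e.2]
    rfl
  · have h3 := Finset.sum_subtype (F := inferInstance) (p := fun e => e ∈ K.edges ∧ e ∈ F) (K.edges.filter (· ∈ F))
      (by simp) fun e => specialCoeff μ e * edgeIntegral e fun t => edgeTrace K e w t * s e t
    rw [Finset.sum_filter_of_ne] at h3
    · rw [h3]
      refine Finset.sum_congr rfl fun e _ => ?_
      rw [specialCoeff, dif_pos e.2]
      rfl
    · intro e he h0
      by_contra hcon
      exact h0 (by rw [specialCoeff, dif_neg fun h => hcon h.2, zero_mul])

/-- The coefficients are the coordinates in the given bases, with the area and length normalizations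
undone. -/
theorem exists_combination [Fintype κ] (m : Module.Basis κ ℝ (bulkPoly p))
    (b : ℂ × ℂ → Module.Basis (Fin p) ℝ (edgePoly p)) {q : ℂ → ℝ} (hq : q ∈ bulkPoly p)
    {f : ℂ × ℂ → ℝ → ℝ} (hf : ∀ e, f e ∈ edgePoly p) {c : ℂ × ℂ → ℝ} (hc : ∀ e ∉ F, c e = 0) :
    ∃ μ : DofIndex K κ p F → ℝ,
      bulkCombination (fun k => (m k : ℂ → ℝ)) μ = q ∧
      ∀ e ∈ K.edges, edgeCombination (fun e l => (b e l : ℝ → ℝ)) s μ e = f e + c e • s e := by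
  have hV : volume.real K.carrier ≠ 0 :=
    (ENNReal.toReal_pos (K.isOpen.measure_pos _ K.isConnected.nonempty).ne'
      K.isBounded.measure_lt_top.ne).ne'
  refine ⟨Sum.elim (fun k => m.repr ⟨q, hq⟩ k * volume.real K.carrier)
    (Sum.elim (fun x => (b x.1).repr ⟨f x.1, hf x.1⟩ x.2) fun e => c e * (edgeLength e)⁻¹), ?_,
    fun e he => ?_⟩
  · have h := congrArg Subtype.val (m.sum_repr ⟨q, hq⟩)
    simp only [Submodule.coe_sum, Submodule.coe_smul] at h
    simp only [bulkCombination, Sum.elim_inl, mul_inv_cancel_right₀ hV]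
    exact h
  · have h := congrArg Subtype.val ((b e).sum_repr ⟨f e, hf e⟩)
    simp only [Submodule.coe_sum, Submodule.coe_smul] at h
    have hL := edgeLength_pos (K.edge_ne e he)
    simp only [edgeCombination, edgeCoeff, dif_pos he, Sum.elim_inr, Sum.elim_inl]
    congr 1
    by_cases heF : e ∈ F
    · rw [specialCoeff, dif_pos ⟨he, heF⟩]
      simp only [Sum.elim_inr]
      rw [inv_mul_cancel_right₀ hL.ne']
    · rw [specialCoeff, dif_neg fun h => heF h.2, hc e heF]
      simp

theorem bulkCombination_mem [Fintype κ] (m : κ → bulkPoly p)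
    (μ : DofIndex K κ p F → ℝ) :
    bulkCombination (fun k => (m k : ℂ → ℝ)) μ ∈ bulkPoly p :=
  Submodule.sum_mem _ fun k _ => Submodule.smul_mem _ _ (m k).2

theorem edgeCombination_mem (hF : F ⊆ E₁) (b : ℂ × ℂ → Fin p → edgePoly p)
    (μ : DofIndex K κ p F → ℝ) (e : ℂ × ℂ) :
    edgeCombination (fun e l => (b e l : ℝ → ℝ)) s μ e ∈ enrichedEdgePoly p E₁ s e := by
  have h1 : ∑ l, edgeCoeff μ e l • (b e l : ℝ → ℝ) ∈ edgePoly p :=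
    Submodule.sum_mem _ fun l _ => Submodule.smul_mem _ _ (b e l).2
  rw [edgeCombination, enrichedEdgePoly]
  split_ifs with h
  · exact Submodule.add_mem_sup h1
      (Submodule.smul_mem _ _ (Submodule.mem_span_singleton_self _))
  · rw [specialCoeff, dif_neg fun h' => h (hF h'.2), zero_mul, zero_smul, add_zero]
    exact h1

/-- Off `directEdges` the special function is absent or almost everywhere a polynomial, and then its
multiple is absorbed into `f`. -/
theorem exists_ae_eq_of_mem_enrichedEdgePoly {e : ℂ × ℂ} {g : ℝ → ℝ}
    (hg : g ∈ enrichedEdgePoly p E₁ s e) : ∃ f ∈ edgePoly p, ∃ c : ℝ,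
      (e ∉ directEdges p E₁ s → c = 0) ∧
      g =ᵐ[volume.restrict (Ioo (0 : ℝ) 1)] f + c • s e := by
  rw [enrichedEdgePoly] at hg
  split_ifs at hg with h
  · obtain ⟨f, hf, x, hx, rfl⟩ := Submodule.mem_sup.1 hg
    obtain ⟨c, rfl⟩ := Submodule.mem_span_singleton.1 hx
    by_cases hd : e ∈ directEdges p E₁ s
    · exact ⟨f, hf, c, fun h => absurd hd h, EventuallyEq.rfl⟩
    · have hd' : ∃ f' ∈ edgePoly p, s e =ᵐ[volume.restrict (Ioo (0 : ℝ) 1)] f' := by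
        by_contra hcon
        push Not at hcon
        exact hd ⟨h, hcon⟩
      obtain ⟨f', hf', hs'⟩ := hd'
      refine ⟨f + c • f', add_mem hf (Submodule.smul_mem _ _ hf'), 0, fun _ => rfl, ?_⟩
      filter_upwards [hs'] with t ht
      simp [ht]
  · exact ⟨g, hg, 0, fun _ => rfl, by simp⟩

theorem inner_outwardNormal_sq {e : ℂ × ℂ} (he : e.1 ≠ e.2) {u : ℂ}
    (hu : u = outwardNormal e ∨ u = -outwardNormal e) :
    ⟪outwardNormal e, u⟫ * ⟪outwardNormal e, u⟫ = 1 := by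
  rcases hu with rfl | rfl <;>
  simp [norm_outwardNormal he]

/-- Green's formula with the Laplacian moved to the right: its integrals against `-q` and against
the edge functions form a combination of the degrees of freedom of `w`. -/
theorem exists_coeff_of_mem_localSpace [Fintype κ]
    [Fintype {e // e ∈ K.edges ∧ e ∈ directEdges p E₁ s}]
    (m : Module.Basis κ ℝ (bulkPoly p))
    (b : ℂ × ℂ → Module.Basis (Fin p) ℝ (edgePoly p))
    (hs : ∀ e ∈ K.edges, IsEdgeDual K e (s e)) {v : Lp ℝ 2 K.vol}
    (hv : v ∈ localSpace K n p (enrichedEdgePoly p E₁ s)) :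
    ∃ G, HasWeakGrad K v G ∧ ∃ μ : DofIndex K κ p (directEdges p E₁ s) → ℝ, ∀ w H, HasWeakGrad K w H → ∫ z in K.carrier, ⟪G z, H z⟫ =
      ∑ i, μ i * dofs K (fun k => (m k : ℂ → ℝ)) (fun e l => (b e l : ℝ → ℝ)) s
        (directEdges p E₁ s) w i := by
  obtain ⟨G, q, hq, g, hg, h⟩ := hv
  have hex : ∀ e, ∃ f ∈ edgePoly p, ∃ c : ℝ, (e ∉ directEdges p E₁ s → c = 0) ∧ (e ∈ K.edges →
      g e =ᵐ[volume.restrict (Ioo (0 : ℝ) 1)] f + c • s e) := by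
    intro e
    by_cases he : e ∈ K.edges
    · obtain ⟨f, hf, c, h1, h2⟩ := exists_ae_eq_of_mem_enrichedEdgePoly (hg e he)
      exact ⟨f, hf, c, h1, fun _ => h2⟩
    · exact ⟨0, zero_mem _, 0, fun _ => rfl, fun h => absurd h he⟩
  choose f hf c hc hfc using hex
  -- The sign relates the fixed normal to the outward one; the length turns the parameter integral
  -- into arc length.
  set σ : ℂ × ℂ → ℝ := fun e => ⟪outwardNormal e, n e⟫ * edgeLength e with hσ
  obtain ⟨μ, hμ1, hμ2⟩ := exists_combination (K := K) (s := s) m b (neg_mem hq)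
    (f := fun e => σ e • f e) (fun e => Submodule.smul_mem _ _ (hf e)) (c := fun e => σ e * c e)
    (F := directEdges p E₁ s) fun e he => by rw [hc e he, mul_zero]
  refine ⟨G, h.grad, μ, fun w H hw => ?_⟩
  rw [sum_mul_dofs (fun k => memLp_of_mem_bulkPoly K (m k).2)
    (fun e l => continuous_of_mem_edgePoly (b e l).2) hs μ hw, hμ1]
  obtain ⟨-, h2⟩ := h.normal w H hw (fun e => edgeTrace K e w)
    fun e he => hw.isTrace_edgeTrace he
  have h3 : ∀ e ∈ K.edges, ⟪outwardNormal e, n e⟫ *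
        (edgeIntegral e fun t => g e t * edgeTrace K e w t) =
      ∫ t in Ioo (0 : ℝ) 1, edgeCombination (fun e l => (b e l : ℝ → ℝ)) s μ e t *
        edgeTrace K e w t := by
    intro e he
    rw [edgeIntegral, ← mul_assoc, ← integral_const_mul, hμ2 e he]
    refine integral_congr_ae ?_
    filter_upwards [hfc e he] with t ht
    rw [ht]
    simp only [Pi.add_apply, Pi.smul_apply, smul_eq_mul, hσ]
    ring
  rw [Finset.sum_congr rfl h3] at h2
  rw [← h2]
  simp only [Pi.neg_apply, neg_mul, integral_neg]
  ring

/-- Test functions see only the bulk part of the right-hand side, which identifies the Laplacian; a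
general `w` then gives the normal derivatives. The sign of the normal squares to one, so the same
sign converts back. -/
theorem mem_localSpace_of_coeff [Fintype κ] [Fintype {e // e ∈ K.edges ∧ e ∈ F}] (hF : F ⊆ E₁)
    (m : κ → bulkPoly p) (b : ℂ × ℂ → Fin p → edgePoly p)
    (hs : ∀ e ∈ K.edges, IsEdgeDual K e (s e))
    (hn : ∀ e ∈ K.edges, n e = outwardNormal e ∨ n e = -outwardNormal e)
    {v : Lp ℝ 2 K.vol} {G : ℂ → ℂ} (hv : HasWeakGrad K v G)
    {μ : DofIndex K κ p F → ℝ}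
    (h : ∀ w H, HasWeakGrad K w H → ∫ z in K.carrier, ⟪G z, H z⟫ =
      ∑ i, μ i * dofs K (fun k => (m k : ℂ → ℝ)) (fun e l => (b e l : ℝ → ℝ)) s F w i) :
    v ∈ localSpace K n p (enrichedEdgePoly p E₁ s) := by
  have hm : ∀ k, MemLp (m k : ℂ → ℝ) 2 K.vol := fun k => memLp_of_mem_bulkPoly K (m k).2
  have hb : ∀ e l, Continuous (b e l : ℝ → ℝ) := fun e l => continuous_of_mem_edgePoly (b e l).2
  have hq := bulkCombination_mem m μ
  set q := bulkCombination (fun k => (m k : ℂ → ℝ)) μ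
  set g := edgeCombination (fun e l => (b e l : ℝ → ℝ)) s μ with hg
  have hqL := memLp_of_mem_bulkPoly K hq
  refine ⟨G, -q, neg_mem hq, fun e => (⟪outwardNormal e, n e⟫ * (edgeLength e)⁻¹) • g e,
    fun e _ => Submodule.smul_mem _ _ (edgeCombination_mem hF b μ e), hv, hqL.neg, fun ψ hψ => ?_,
    fun w H hw τ hτ => ?_⟩
  · have hψw := hasWeakGrad_of_contDiff (K := K) hψ.1 hψ.2.1
    have h1 := h ψ _ hψw
    rw [sum_mul_dofs hm hb hs μ hψw, Finset.sum_eq_zero, add_zero] at h1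
    · simp only [Pi.neg_apply, neg_mul, integral_neg, neg_neg]
      rw [← h1]
      refine integral_congr_ae (Eventually.of_forall fun z => ?_)
      simp only
      rw [real_inner_comm, planeGrad_inner]
    · intro e he
      refine integral_eq_zero_of_ae ?_
      filter_upwards [edgeTrace_ae_eq he (hψ.isTrace_zero he)] with t ht
      simp [ht]
  · have hgd : ∀ e ∈ K.edges, IsEdgeDual K e (g e) := fun e he => .edgeCombination hb hs μ he
    refine ⟨fun e he => ?_, ?_⟩
    · have := ((hgd e he).integrableOn hw (hτ e he)).const_mul
        (⟪outwardNormal e, n e⟫ * (edgeLength e)⁻¹)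
      simp only [Pi.smul_apply, smul_eq_mul, mul_assoc] at this ⊢
      exact this
    · rw [h w H hw, sum_mul_dofs hm hb hs μ hw]
      simp only [Pi.neg_apply, neg_mul, integral_neg]
      rw [add_right_comm, add_neg_cancel, zero_add]
      refine Finset.sum_congr rfl fun e he => ?_
      have hL := edgeLength_pos (K.edge_ne e he)
      have hσ := inner_outwardNormal_sq (K.edge_ne e he) (hn e he)
      rw [edgeIntegral, ← mul_assoc, ← integral_const_mul]
      refine integral_congr_ae ?_
      filter_upwards [edgeTrace_ae_eq he (hτ e he)] with t ht
      rw [ht]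
      simp only [Pi.smul_apply, smul_eq_mul]
      have : ⟪outwardNormal e, n e⟫ * edgeLength e *
          (⟪outwardNormal e, n e⟫ * (edgeLength e)⁻¹ * g e t * τ e t) =
          (⟪outwardNormal e, n e⟫ * ⟪outwardNormal e, n e⟫) *
            (edgeLength e * (edgeLength e)⁻¹) * (g e t * τ e t) := by ring
      rw [this, hσ, mul_inv_cancel₀ hL.ne', one_mul, one_mul]

end Unisolvence

/-! ### Independence, coercivity and unisolvence on an element -/

section Unisolvence

variable {K : PolygonalDomain} {κ : Type*} {p : ℕ} {s : ℂ × ℂ → ℝ → ℝ} {E₁ F : Set (ℂ × ℂ)}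
  {n : ℂ × ℂ → ℂ}

/-- `edgeTrace` is chosen separately for each function, so linearity is not formal; it is read off
from the linear functionals on `H¹(K)`, which rest on the uniqueness of traces. -/
theorem dofs_lin {m : κ → ℂ → ℝ} (hm : ∀ k, MemLp (m k) 2 K.vol)
    {b : ℂ × ℂ → Fin p → ℝ → ℝ} (hb : ∀ e l, Continuous (b e l))
    (hs : ∀ e ∈ K.edges, IsEdgeDual K e (s e)) {v v' : Lp ℝ 2 K.vol} {G G' : ℂ → ℂ}
    (h : HasWeakGrad K v G) (h' : HasWeakGrad K v' G') (c : ℝ) :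
    dofs K m b s F (c • v + v' : Lp ℝ 2 K.vol) = c • dofs K m b s F v + dofs K m b s F v' := by
  ext i
  obtain ⟨L, hL⟩ := exists_clm_dofs (F := F) hm hb hs i
  obtain ⟨x, hx, -⟩ := exists_mem_sobolevSpace h
  obtain ⟨x', hx', -⟩ := exists_mem_sobolevSpace h'
  have h1 := hL (c • x + x')
  have h2 : (c • x + x').1.fst = c • v + v' := by rw [← hx, ← hx']; rfl
  rw [h2, map_add, map_smul, hL, hL, hx, hx'] at h1
  exact h1.symm

theorem dofs_congr {m : κ → ℂ → ℝ} {b : ℂ × ℂ → Fin p → ℝ → ℝ} {w w' : ℂ → ℝ} {G : ℂ → ℂ}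
    (h : HasWeakGrad K w G) (hw : w =ᵐ[K.vol] w') : dofs K m b s F w = dofs K m b s F w' := by
  have htr : ∀ e ∈ K.edges, ∀ f : ℝ → ℝ, edgeIntegral e (fun t => edgeTrace K e w t * f t) =
      edgeIntegral e fun t => edgeTrace K e w' t * f t := by
    intro e he f
    rw [edgeIntegral, edgeIntegral]
    congr 1
    refine integral_congr_ae ?_
    filter_upwards [edgeTrace_ae_eq he (((h.congr hw).isTrace_edgeTrace he).congr hw.symm)]
      with t ht
    rw [ht]
  ext i
  rcases i with k | ⟨e, l⟩ | e
  · simp only [dofs]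
    congr 1
    refine integral_congr_ae ?_
    filter_upwards [hw] with z hz
    rw [hz]
  · simp only [dofs]
    rw [htr e e.2]
  · simp only [dofs]
    rw [htr e e.2.1]

/-- By density of the traces, the bulk function and the edge functions of the combination vanish. A
nonzero special coefficient would make `s e` almost everywhere a polynomial, which `directEdges`
excludes; the rest is independence of the polynomial bases. -/
theorem eq_zero_of_sum_mul_dofs_eq_zero [Fintype κ]
    [Fintype {e // e ∈ K.edges ∧ e ∈ directEdges p E₁ s}]
    (m : Module.Basis κ ℝ (bulkPoly p))
    (b : ℂ × ℂ → Module.Basis (Fin p) ℝ (edgePoly p))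
    (hs : ∀ e ∈ K.edges, IsEdgeDual K e (s e)) {μ : DofIndex K κ p (directEdges p E₁ s) → ℝ}
    (h : ∀ w H, HasWeakGrad K w H → ∑ i, μ i * dofs K (fun k => (m k : ℂ → ℝ))
      (fun e l => (b e l : ℝ → ℝ)) s (directEdges p E₁ s) w i = 0) : μ = 0 := by
  have hm : ∀ k, MemLp (m k : ℂ → ℝ) 2 K.vol := fun k => memLp_of_mem_bulkPoly K (m k).2
  have hb : ∀ e l, Continuous (b e l : ℝ → ℝ) := fun e l => continuous_of_mem_edgePoly (b e l).2
  have hV : volume.real K.carrier ≠ 0 :=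
    (ENNReal.toReal_pos (K.isOpen.measure_pos _ K.isConnected.nonempty).ne'
      K.isBounded.measure_lt_top.ne).ne'
  have hq := bulkCombination_mem m μ
  obtain ⟨h1, h2⟩ := ae_eq_zero_of_forall (memLp_of_mem_bulkPoly K hq)
    (fun e he => .edgeCombination hb hs μ he)
    (fun w H hw => by rw [← sum_mul_dofs hm hb hs μ hw]; exact h w H hw)
  have hk : ∀ k, μ (.inl k) = 0 := by
    have h3 := eq_zero_of_mem_bulkPoly hq h1
    have h4 : ∑ k, (μ (.inl k) * (volume.real K.carrier)⁻¹) • m k = 0 := by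
      apply Subtype.ext
      rw [Submodule.coe_sum]
      exact h3
    intro k
    have := Fintype.linearIndependent_iff.1 m.linearIndependent _ h4 k
    exact (mul_eq_zero.1 this).resolve_right (inv_ne_zero hV)
  have hsp : ∀ e ∈ K.edges, specialCoeff μ e = 0 := by
    intro e he
    by_contra hc
    have heF : e ∈ directEdges p E₁ s := by
      by_contra hcon
      exact hc (by rw [specialCoeff, dif_neg fun h => hcon h.2])
    have hL := edgeLength_pos (K.edge_ne e he)
    have hc' : specialCoeff μ e * edgeLength e ≠ 0 := mul_ne_zero hc hL.ne'
    refine heF.2 (-(specialCoeff μ e * edgeLength e)⁻¹ •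
      ∑ l, edgeCoeff μ e l • (b e l : ℝ → ℝ)) (Submodule.smul_mem _ _
      (Submodule.sum_mem _ fun l _ => Submodule.smul_mem _ _ (b e l).2)) ?_
    filter_upwards [h2 e he] with t ht
    simp only [edgeCombination, Pi.add_apply, Pi.smul_apply, smul_eq_mul, Pi.zero_apply] at ht ⊢
    field_simp
    linarith
  have hel : ∀ e ∈ K.edges, ∀ l, edgeCoeff μ e l = 0 := by
    intro e he
    have h3 := h2 e he
    rw [edgeCombination, hsp e he, zero_mul, zero_smul, add_zero] at h3
    have h4 := eq_zero_of_mem_edgePoly (p := p)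
      (Submodule.sum_mem _ fun l _ => Submodule.smul_mem _ _ (b e l).2) h3
    have h5 : ∑ l, edgeCoeff μ e l • b e l = 0 := by
      apply Subtype.ext
      rw [Submodule.coe_sum]
      exact h4
    exact Fintype.linearIndependent_iff.1 (b e).linearIndependent _ h5
  funext i
  rcases i with k | ⟨e, l⟩ | e
  · exact hk k
  · have := hel e e.2 l
    rwa [edgeCoeff, dif_pos e.2] at this
  · have := hsp e e.2.1
    rwa [specialCoeff, dif_pos e.2] at this

theorem one_mem_edgePoly (hp : 1 ≤ p) : (fun _ : ℝ => (1 : ℝ)) ∈ edgePoly p :=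
  Submodule.subset_span ⟨0, hp, by simp⟩

/-- Since `p ≥ 1`, the constant `1` is a combination of the edge basis, so the mean of the trace on
one edge is a combination of edge moments. It controls the norm together with the gradient. -/
theorem exists_coercive [Fintype κ] [Fintype {e // e ∈ K.edges ∧ e ∈ F}] (hp : 1 ≤ p)
    {m : κ → ℂ → ℝ} (b : ℂ × ℂ → Module.Basis (Fin p) ℝ (edgePoly p))
    {Λ : DofIndex K κ p F → sobolevSpace K →L[ℝ] ℝ}
    (hΛ : ∀ i x, Λ i x = dofs K m (fun e l => (b e l : ℝ → ℝ)) s F x.1.fst i) :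
    ∃ c > 0, ∀ x : sobolevSpace K, c * ‖x‖ ^ 2 ≤ ‖x.1.snd‖ ^ 2 + ∑ i, Λ i x ^ 2 := by
  obtain ⟨e, he⟩ := K.edges_nonempty
  have hL := edgeLength_pos (K.edge_ne e he)
  obtain ⟨C, hC, h⟩ := K.exists_norm_le he
  set a := (b e).repr ⟨_, one_mem_edgePoly hp⟩ with ha
  have h1 : ∀ t : ℝ, ∑ l, a l * (b e l : ℝ → ℝ) t = 1 := by
    intro t
    have h := congrArg Subtype.val ((b e).sum_repr ⟨_, one_mem_edgePoly hp⟩)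
    simp only [Submodule.coe_sum, Submodule.coe_smul] at h
    have h' := congrFun h t
    simp only [Finset.sum_apply, Pi.smul_apply, smul_eq_mul] at h'
    exact h'
  set A := ∑ l, a l ^ 2 with hA
  have hA0 : 0 ≤ A := Finset.sum_nonneg fun l _ => sq_nonneg _
  have key : ∀ x : sobolevSpace K, ‖x‖ ^ 2 ≤ C.toReal * (‖x.1.snd‖ ^ 2 + A * ∑ i, Λ i x ^ 2) := by
    intro x
    have hx := mem_sobolevSpace.1 x.2
    have ht := hx.isTrace_edgeTrace he
    have h2 : ∫ t in Ioo (0 : ℝ) 1, edgeTrace K e x.1.fst t =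
        ∑ l, a l * Λ (.inr (.inl (⟨e, he⟩, l))) x := by
      have i1 : ∀ l, IntegrableOn (fun t => edgeTrace K e x.1.fst t * (b e l : ℝ → ℝ) t)
          (Ioo 0 1) := by
        intro l
        have := ((isEdgeWeight_of_continuous (continuous_of_mem_edgePoly (b e l).2)).isEdgeDual
          he).integrableOn hx ht
        simpa only [mul_comm] using this
      have e1 : ∀ t, edgeTrace K e x.1.fst t =
          ∑ l, a l * (edgeTrace K e x.1.fst t * (b e l : ℝ → ℝ) t) := by
        intro t
        conv_lhs => rw [← mul_one (edgeTrace K e x.1.fst t), ← h1 t, Finset.mul_sum]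
        exact Finset.sum_congr rfl fun l _ => by ring
      conv_lhs => enter [2, t]; rw [e1]
      rw [integral_finsetSum _ fun l _ => (i1 l).const_mul _]
      refine Finset.sum_congr rfl fun l _ => ?_
      rw [hΛ, dofs, integral_const_mul, edgeIntegral, inv_mul_cancel_left₀ hL.ne']
    have h3 : (∫ t in Ioo (0 : ℝ) 1, edgeTrace K e x.1.fst t) ^ 2 ≤ A * ∑ i, Λ i x ^ 2 := by
      rw [h2]
      refine (Finset.sum_mul_sq_le_sq_mul_sq _ _ _).trans ?_
      refine mul_le_mul_of_nonneg_left ?_ hA0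
      refine (Finset.sum_le_sum_of_subset_of_nonneg (Finset.subset_univ
        (Finset.univ.map ⟨fun l => (.inr (.inl (⟨e, he⟩, l)) : DofIndex K κ p F),
          fun l l' h => by simpa using h⟩)) fun i _ _ => sq_nonneg (Λ i x)).trans' (le_of_eq ?_)
      rw [Finset.sum_map]
      rfl
    have h4 := h _ _ hx
    rw [sobolevSq_eq, ← Lp_enorm_sq x.1.snd, ← ofReal_norm, ← ofReal_norm,
      ← ENNReal.ofReal_pow (norm_nonneg _), ← ENNReal.ofReal_pow (norm_nonneg _),
      ← ENNReal.ofReal_add (by positivity) (by positivity), ← ENNReal.ofReal_toReal hC,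
      ← ENNReal.ofReal_mul (by positivity), ENNReal.ofReal_le_ofReal_iff (by positivity),
      Real.norm_eq_abs, sq_abs] at h4
    refine h4.trans (mul_le_mul_of_nonneg_left (add_le_add le_rfl h3) ENNReal.toReal_nonneg)
  -- The added `1` keeps the denominator positive even if `C` is zero.
  refine ⟨(C.toReal * (1 + A) + 1)⁻¹, by positivity, fun x => ?_⟩
  rw [inv_mul_le_iff₀ (by positivity)]
  have h5 : 0 ≤ ∑ i, Λ i x ^ 2 := Finset.sum_nonneg fun i _ => sq_nonneg _
  refine (key x).trans ?_
  have h6 := ENNReal.toReal_nonneg (a := C)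
  have h7 : 0 ≤ ‖x.1.snd‖ ^ 2 := by positivity
  nlinarith [mul_nonneg h6 h5, mul_nonneg (mul_nonneg h6 hA0) h7]

/-- The abstract result is applied to `M = H¹(K)`, with `D` the weak gradient into `L²` and `Λ` the
functionals without the redundant special moments. -/
theorem unisolvence (hp : 1 ≤ p) (m : Module.Basis κ ℝ (bulkPoly p))
    (b : ℂ × ℂ → Module.Basis (Fin p) ℝ (edgePoly p))
    (hn : ∀ e ∈ K.edges, n e = outwardNormal e ∨ n e = -outwardNormal e)
    (hs : ∀ e ∈ K.edges, IsEdgeDual K e (s e)) :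
    (∀ v ∈ localSpace K n p (enrichedEdgePoly p E₁ s),
      dofs K (fun k => (m k : ℂ → ℝ)) (fun e l => (b e l : ℝ → ℝ)) s (directEdges p E₁ s) v = 0 →
      v = 0) ∧
    ∀ y, ∃ v ∈ localSpace K n p (enrichedEdgePoly p E₁ s),
      dofs K (fun k => (m k : ℂ → ℝ)) (fun e l => (b e l : ℝ → ℝ)) s (directEdges p E₁ s) v = y := by
  have hfin := finite_bulkPoly p
  have hκ : Finite κ := Module.Finite.finite_basis m
  have := Fintype.ofFinite κ
  have : Finite {e // e ∈ K.edges ∧ e ∈ directEdges p E₁ s} :=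
    (K.edges.finite_toSet.subset fun e he => he.1 :
      {e | e ∈ K.edges ∧ e ∈ directEdges p E₁ s}.Finite)
  have := Fintype.ofFinite {e // e ∈ K.edges ∧ e ∈ directEdges p E₁ s}
  have hm : ∀ k, MemLp (m k : ℂ → ℝ) 2 K.vol := fun k => memLp_of_mem_bulkPoly K (m k).2
  have hb : ∀ e l, Continuous (b e l : ℝ → ℝ) := fun e l => continuous_of_mem_edgePoly (b e l).2
  choose Λ hΛ using exists_clm_dofs (F := directEdges p E₁ s) hm hb hs
  obtain ⟨c, hc, hcoer⟩ := exists_coercive hp b hΛ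
  have : CompleteSpace (sobolevSpace K) := (isClosed_sobolevSpace K).completeSpace_coe
  -- Green's formula quantifies over functions, the Hilbert space over classes; the degrees of
  -- freedom do not distinguish them.
  have hgen : ∀ w H, HasWeakGrad K w H → ∃ z : sobolevSpace K,
      (∀ i, Λ i z = dofs K (fun k => (m k : ℂ → ℝ)) (fun e l => (b e l : ℝ → ℝ)) s
        (directEdges p E₁ s) w i) ∧ z.1.snd =ᵐ[K.vol] H := by
    intro w H hw
    have hww := hw.1.coeFn_toLp
    obtain ⟨z, hz, hzH⟩ := exists_mem_sobolevSpace (hw.congr hww.symm)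
    exact ⟨z, fun i => by rw [hΛ, hz, dofs_congr hw hww.symm], hzH⟩
  obtain ⟨hinj, hsurj⟩ := exists_of_coercive
    ((WithLp.sndL 2 ℝ (Lp ℝ 2 K.vol) (Lp ℂ 2 K.vol)) ∘L (sobolevSpace K).subtypeL) Λ hc hcoer
    (fun μ hμ => eq_zero_of_sum_mul_dofs_eq_zero m b hs fun w H hw => by
      obtain ⟨z, hz, -⟩ := hgen w H hw
      simpa only [hz] using hμ z)
  have hD : ∀ x z : sobolevSpace K,
      ⟪((WithLp.sndL 2 ℝ (Lp ℝ 2 K.vol) (Lp ℂ 2 K.vol)) ∘L (sobolevSpace K).subtypeL) x,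
        ((WithLp.sndL 2 ℝ (Lp ℝ 2 K.vol) (Lp ℂ 2 K.vol)) ∘L (sobolevSpace K).subtypeL) z⟫ =
      ∫ y in K.carrier, ⟪x.1.snd y, z.1.snd y⟫ := fun x z => L2.inner_def _ _
  refine ⟨fun v hv h0 => ?_, fun y => ?_⟩
  · obtain ⟨G, hG, μ, hμ⟩ := exists_coeff_of_mem_localSpace m b hs hv
    obtain ⟨x, hx, hxG⟩ := exists_mem_sobolevSpace hG
    have := hinj x μ (fun z => ?_) fun i => by rw [hΛ, hx, h0]; rfl
    · rw [← hx, this]; rfl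
    · rw [hD]
      have h1 := hμ _ _ (mem_sobolevSpace.1 z.2)
      simp only [← hΛ] at h1
      rw [← h1]
      refine integral_congr_ae ?_
      filter_upwards [hxG] with t ht
      rw [ht]
  · obtain ⟨x, μ, h1, h2⟩ := hsurj y
    refine ⟨x.1.fst, mem_localSpace_of_coeff (fun e he => he.1) m (fun e => b e) hs hn
      (mem_sobolevSpace.1 x.2) (μ := μ) fun w H hw => ?_, funext fun i => by rw [← hΛ, h2]⟩
    obtain ⟨z, hz, hzH⟩ := hgen w H hw
    have h3 := h1 z
    rw [hD] at h3
    simp only [hz] at h3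
    rw [← h3]
    refine integral_congr_ae ?_
    filter_upwards [hzH] with t ht
    rw [ht]

end Unisolvence

end EVEM

end

/-! ### The lemma for an element of the mesh -/

open EVEM in
theorem lemma3p1 (Ω : PolygonalDomain) (T : PolygonalMesh Ω)
    -- the singular vertex `A`, the direction `φ` of its polar coordinates, its interior angle `β`
    (A : ℂ) (φ β : ℝ) (hA : HasCorner Ω A φ β)
    -- the singular function
    (mixed dirichlet : Bool) (j : ℕ) (hj : 1 ≤ j)
    (α : ℝ) (hα : α = singularExponent mixed β j)
    -- the parameter of the first layer, the polynomial order, the unit normals of the edges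
    (γ : ℝ) (hγ : 0 < γ) (p : ℕ) (hp : 1 ≤ p) (n : ℂ × ℂ → ℂ)
    (hn : ∀ i, ∀ e ∈ (T.elem i).edges, n e = outwardNormal e ∨ n e = -outwardNormal e)
    -- the first layer of edges and the special edge functions
    (E₁ : Set (ℂ × ℂ)) (hE₁ : E₁ = firstLayerEdges T A γ)
    (s : ℂ × ℂ → ℝ → ℝ) (hs : s = fun e => singularNormalDeriv dirichlet α A φ (n e) e)
    -- an element, and bases of the polynomial spaces
    (i : T.ι) (K : PolygonalDomain) (hK : K = T.elem i)
    {κ : Type*} (m : Module.Basis κ ℝ (bulkPoly p))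
    (b : ℂ × ℂ → Module.Basis (Fin p) ℝ (edgePoly p))
    -- the local space and its functionals
    (V : Submodule ℝ (Lp ℝ 2 K.vol)) (hV : V = localSpace K n p (enrichedEdgePoly p E₁ s))
    (dof : (F : Set (ℂ × ℂ)) → V →
      κ ⊕ ({e // e ∈ K.edges} × Fin p) ⊕ {e // e ∈ K.edges ∧ e ∈ F} → ℝ)
    (hdof : dof = fun F (v : V) =>
      dofs K (fun k => m k) (fun e l => b e l) s F (v : Lp ℝ 2 K.vol)) :
    -- the functionals are well defined
    (∀ v ∈ V, (∀ k, IntegrableOn (fun z => v z * (m k : ℂ → ℝ) z) K.carrier) ∧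
      ∀ e ∈ K.edges, IsTrace K e v (edgeTrace K e v) ∧
        (∀ l, IntegrableOn (fun t => edgeTrace K e v t * (b e l : ℝ → ℝ) t) (Ioo (0 : ℝ) 1)) ∧
        (e ∈ E₁ → IntegrableOn (fun t => edgeTrace K e v t * s e t) (Ioo (0 : ℝ) 1))) ∧
    -- they are linear and determine the functions of the local space
    IsLinearMap ℝ (dof E₁) ∧ Function.Injective (dof E₁) ∧
    -- without the special moments that are redundant (none, if all the sums defining the edge
    -- spaces are direct), they are also independent, and as many as the dimension
    Function.Bijective (dof (directEdges p E₁ s)) := by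
  subst hs hV hdof
  have hn' : ∀ e ∈ K.edges, n e = outwardNormal e ∨ n e = -outwardNormal e := by
    subst hK
    exact hn i
  have hα' : 1 / 4 ≤ α := hα ▸ singularExponent_ge hA.1 hA.2.1 hj
  set s : ℂ × ℂ → ℝ → ℝ := fun e => singularNormalDeriv dirichlet α A φ (n e) e
  have hsd : ∀ e ∈ K.edges, IsEdgeDual K e (s e) := fun e he =>
    (isEdgeWeight_singularNormalDeriv dirichlet hα' A φ (n e) (K.edge_ne e he)).isEdgeDual he
  have hm : ∀ k, MemLp (m k : ℂ → ℝ) 2 K.vol := fun k => memLp_of_mem_bulkPoly K (m k).2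
  have hb : ∀ e l, Continuous (b e l : ℝ → ℝ) := fun e l => continuous_of_mem_edgePoly (b e l).2
  obtain ⟨hinj, hsurj⟩ := unisolvence (E₁ := E₁) hp m b hn' hsd
  have hlin : ∀ F : Set (ℂ × ℂ), IsLinearMap ℝ
      fun v : localSpace K n p (enrichedEdgePoly p E₁ s) =>
        dofs K (fun k => m k) (fun e l => b e l) s F (v : Lp ℝ 2 K.vol) := by
    intro F
    -- `dofs_lin` treats `c • v + v'` in one go; homogeneity is the case `v' = 0`, once the
    -- functionals are known to vanish at zero.
    have h0 := hasWeakGrad_const K 0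
    have hz : HasWeakGrad K (0 : Lp ℝ 2 K.vol) 0 := h0.congr (Lp.coeFn_zero ℝ 2 K.vol).symm
    have hzero : dofs K (fun k => (m k : ℂ → ℝ)) (fun e l => (b e l : ℝ → ℝ)) s F
        (0 : Lp ℝ 2 K.vol) = 0 := by
      have h := dofs_lin (F := F) hm hb hsd hz hz 1
      rw [one_smul, one_smul, add_zero] at h
      exact left_eq_add.1 h
    refine ⟨?_, ?_⟩
    · rintro ⟨v, G, q, hq, g, hg, h⟩ ⟨v', G', q', hq', g', hg', h'⟩
      have := dofs_lin (F := F) hm hb hsd h.grad h'.grad 1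
      rwa [one_smul, one_smul] at this
    · rintro c ⟨v, G, q, hq, g, hg, h⟩
      have := dofs_lin (F := F) hm hb hsd h.grad hz c
      rwa [hzero, add_zero, add_zero] at this
  have hinjF : Function.Injective fun v : localSpace K n p (enrichedEdgePoly p E₁ s) =>
      dofs K (fun k => (m k : ℂ → ℝ)) (fun e l => (b e l : ℝ → ℝ)) s (directEdges p E₁ s)
        (v : Lp ℝ 2 K.vol) :=
    (injective_iff_map_eq_zero (hlin _).mk').2 fun v hv => Subtype.ext (hinj v v.2 hv)
  refine ⟨fun v hv => ?_, hlin E₁, ?_, hinjF, fun y => ?_⟩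
  · obtain ⟨G, q, hq, g, hg, h⟩ := hv
    refine ⟨fun k => h.grad.1.integrable_mul (hm k), fun e he => ?_⟩
    have ht := h.grad.isTrace_edgeTrace he
    have hi : ∀ f : ℝ → ℝ, IsEdgeDual K e f →
        IntegrableOn (fun t => edgeTrace K e v t * f t) (Ioo (0 : ℝ) 1) := fun f hf => by
      simpa only [mul_comm] using hf.integrableOn h.grad ht
    exact ⟨ht, fun l => hi _ ((isEdgeWeight_of_continuous (hb e l)).isEdgeDual he),
      fun _ => hi _ (hsd e he)⟩
  -- The edges of `directEdges` belong to `E₁`, so the vanishing of all functionals includes that of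
  -- the reduced family, which already determines `v`.
  · refine (injective_iff_map_eq_zero (hlin E₁).mk').2 fun v hv => Subtype.ext (hinj v v.2 ?_)
    funext x
    rcases x with k | x | e
    · exact congrFun hv (.inl k)
    · exact congrFun hv (.inr (.inl x))
    · exact congrFun hv (.inr (.inr ⟨e, e.2.1, e.2.2.1⟩))
  · obtain ⟨v, hv, hy⟩ := hsurj y
    exact ⟨⟨v, hv⟩, hy⟩
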